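/- **Theorem (Asymptotic normality).** Let $p=p_1+p_2$ be fixed and let $(Z_i,\varepsilon_i)$, $i\ge 1$, be i.i.d., where $Z_i=(Z_{i1},\dots,Z_{ip})$ has continuous paths on $[0,1]$ and the predictors are split into a relevant block of size $p_1$ and a nuisance block of size $p_2$. Let $Y_i=\sum_{j=1}^p\int_0^1\beta_j(t)Z_{ij}(t)\,dt+\varepsilon_i$. *Estimator.* For each $n$ let $\psi_1,\dots,\psi_{K_z}$ ($K_z=K_z(n)$) be a basis, not necessarily orthonormal, of the space of splines of degree $q$ with equispaced knots on $[0,1]$. Let $\mathbf Z$ be the $n\times pK_z$ design matrix whose entries are pre-smoothed values of $\langle Z_{ij},\psi_k\rangle=\int_0^1 Z_{ij}\psi_k$, computed by a measurable map from the values of $Z_{ij}$ on a common grid $s_1,\dots,s_M\in[0,1]$, $M=M(n)$. Let $\mathbf R_0=\bigl(\int_0^1\psi_k^{(m)}\psi_l^{(m)}\bigr)_{k,l}$ and $\mathbf R_\lambda=\operatorname{diag}(\lambda_{1,n}\mathbf R_0,\dots,\lambda_{1,n}\mathbf R_0,\lambda_{2,n}\mathbf R_0,\dots,\lambda_{2,n}\mathbf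 R_0)$ ($p_1$ blocks with $\lambda_{1,n}\ge0$ and $p_2$ blocks with $\lambda_{2,n}\ge0$, all deterministic). Put $\widehat{\mathbf b}_n=(\mathbf Z^\top\mathbf Z+\mathbf R_\lambda)^{-1}\mathbf Z^\top\mathbf y$ with $\mathbf y=(Y_1,\dots,Y_n)^\top$, $\widehat\beta_{j,n}=\sum_k\widehat b_{n,jk}\psi_k$, $\mathbf G_n=n^{-1}\mathbf Z^\top\mathbf Z$, $\mathbf M_n=\mathbf G_n+n^{-1}\mathbf R_\lambda$, $\mathbf V_n=\mathbf M_n^{-1}\mathbf G_n\mathbf M_n^{-1}$, $\mathbf S_n=\mathbf Z(\mathbf Z^\top\mathbf Z+\mathbf R_\lambda)^{-1}\mathbf Z^\top$ and $\widehat\sigma_n^2=(n-\operatorname{tr}\mathbf S_n)^{-1}\|\mathbf y-\mathbf Z\widehat{\mathbf b}_n\|^2$. For $x\in L^2([0,1])^p$ let $\Psi(x)=\sum_j\int_0^1\beta_jx_j$, $\widehat\Psi_n(x)=\sum_j\int_0^1\widehat\beta_{j,n}x_j$ and $\mathbf w_{x,n}=(\langle x_j,\psi_k\rangle)_{j,k}$.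 *Assumptions*, as $n\to\infty$: - (A1) Each $\beta_j$ is in the Hölder class $\mathcal C^s([0,1])$, $s=s'+\nu$, $s'\in\mathbb N$, $\nu\in[0,1]$, and $q\ge s$. - (A2) $m\le s$. - (A3) There is $C_1$ with $\|Z_{ij}\|_\infty\le C_1$ a.s. for all $i,j$. The pre-smoothing error is negligible: $\sum_{i=1}^n\sum_{j,k}\bigl(\mathbf Z_{i,jk}-\langle Z_{ij},\psi_k\rangle\bigr)^2\to0$ in probability. - (A4) $M\to\infty$, $\max_\ell|s_{\ell+1}-s_\ell|\to0$, $K_z\to\infty$, $K_z=o(M)$. - (A5) $\mathbb E[\varepsilon_i\mid Z_i]=0$, $\mathbb E[\varepsilon_i^2]=\sigma^2$, $\operatorname{Var}(\varepsilon_i\mid Z_i)\le\sigma^2$, $\mathbb E[\varepsilon_i^4]<\infty$. - (A6) The operator $\Gamma$ on $L^2([0,1])^p$ with $\langle f,\Gamma g\rangle=\mathbb E\bigl[\sum_j\langle f_j,Z_{1j}\rangle\sum_j\langle g_j,Z_{1j}\rangle\bigr]$ has an orthonormal basis of eigenfunctions $v_1,v_2,\dots$ with eigenvalues $\gamma_1\ge\gamma_2\ge\dots>0$.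 There is $C$ such that $\mathbb E\bigl[\bigl(\sum_{j,k}b_{jk}\langle Z_{1j},\psi_k\rangle\bigr)^2\bigr]\le C\sum_{j,k}b_{jk}^2$ for all $n$ and $b\in\mathbb R^{pK_z}$ (automatic for an orthonormal basis). - (A7) The eigenvalues of $\mathbf G_n$ are bounded away from zero and infinity in probability: for every $\delta>0$ there are $0<c\le C$ such that, for all large $n$, they all lie in $[c,C]$ with probability at least $1-\delta$. - (A8) The predictors are partitioned into the two blocks above. - (U1) $K_z\to\infty$, $K_z=o(n^{1/2})$. (U2)–(U3) $\lambda_{1,n},\lambda_{2,n}=o\bigl(n^{-1/2}K_z^{-(2m-1)}\bigr)$. (U4) $K_z^{-s}=o(n^{-1/2})$. Let $x\in L^2([0,1])^p$ satisfy $\langle\Gamma^{-1}x,x\rangle:=\sum_k\langle x,v_k\rangle^2/\gamma_k<\infty$ and the non-degeneracy condition (A9): $\liminf_n\mathbf w_{x,n}^\top\mathbf V_n\mathbf w_{x,n}>0$ in probability, i.e. for every $\delta>0$ there is $c>0$ such that $\mathbb P(\mathbf w_{x,n}^\top\mathbf V_n\mathbf w_{x,n}<c)\le\delta$ for all large $n$.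 *Then* $$\sqrt n\,\bigl(\widehat\Psi_n(x)-\Psi(x)\bigr)\xrightarrow{d}\mathcal N\bigl(0,\sigma^2\langle\Gamma^{-1}x,x\rangle\bigr).$$ Moreover $\widehat V_n(x)=\widehat\sigma_n^2\,\mathbf w_{x,n}^\top\mathbf V_n\mathbf w_{x,n}$ converges in probability to $\sigma^2\langle\Gamma^{-1}x,x\rangle$; $\operatorname{tr}(\mathbf S_n)=O_{\mathbb P}(pK_z)$ and $\operatorname{tr}(\mathbf S_n)=o_{\mathbb P}(n)$; and, if $\sigma^2>0$, $$\frac{\widehat V_n(x)}{\sigma^2\langle\Gamma^{-1}x,x\rangle}\xrightarrow{\mathbb P}1.$$ -/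

import Mathlib

open MeasureTheory ProbabilityTheory Filter Topology Asymptotics
open scoped NNReal ENNReal unitInterval

noncomputable section

namespace FRidge

/-! ### Function spaces on `[0,1]` -/

/-- Borel structure of the space of continuous sample paths. -/
instance instMeasurableSpacePaths : MeasurableSpace C(I, ℝ) := borel _

instance instBorelSpacePaths : BorelSpace C(I, ℝ) := ⟨rfl⟩

/-- Index set of the predictors: a relevant block of size `p₁`, a nuisance block of size `p₂`. -/
abbrev Pred (p₁ p₂ : ℕ) := Fin p₁ ⊕ Fin p₂

/-- Sample space of the stacked predictor process `(Z_1, …, Z_p)`, with continuous paths. -/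
abbrev Paths (p₁ p₂ : ℕ) := Pred p₁ p₂ → C(I, ℝ)

/-- The Hilbert space `L²([0,1])^p`. -/
abbrev L2p (p₁ p₂ : ℕ) := PiLp 2 (fun _ : Pred p₁ p₂ => Lp ℝ 2 (volume : Measure I))

/-- The stacked path as an element of `L²([0,1])^p`. -/
def toL2p {p₁ p₂ : ℕ} (z : Paths p₁ p₂) : L2p p₁ p₂ :=
  WithLp.toLp 2 fun j => ContinuousMap.toLp 2 (volume : Measure I) ℝ (z j)

/-- The (uncentred) covariance operator of a random stacked path, `Γ g = E[⟨Z, g⟩ Z]`, that is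
`⟨f, Γ g⟩ = E[(∑ⱼ ⟨fⱼ, Zⱼ⟩) (∑ⱼ ⟨gⱼ, Zⱼ⟩)]`. -/
def covOp {Ω : Type*} [MeasurableSpace Ω] {p₁ p₂ : ℕ} (P : Measure Ω) (Z : Ω → Paths p₁ p₂) :
    L2p p₁ p₂ → L2p p₁ p₂ :=
  fun g => ∫ ω, (inner ℝ (toL2p (Z ω)) g : ℝ) • toL2p (Z ω) ∂P

/-- The Hölder class `𝒞^{s' + ν}` on `[0,1]`: `s'` continuous derivatives, the last of which is
`ν`-Hölder. -/
def HolderClass (s' : ℕ) (ν : ℝ≥0) (f : ℝ → ℝ) : Prop :=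
  ContDiffOn ℝ s' f (Set.Icc 0 1) ∧
    ∃ C : ℝ≥0, HolderOnWith C ν (iteratedDerivWithin s' f (Set.Icc 0 1)) (Set.Icc 0 1)

/-- Splines of degree `q ≥ 1` with the `κ - 1` equispaced interior knots `i / κ` of `[0,1]`,
through the truncated power functions; a space of dimension `κ + q`. -/
def splineSpace (q κ : ℕ) : Submodule ℝ (ℝ → ℝ) :=
  Submodule.span ℝ
    ({f | ∃ l : ℕ, l ≤ q ∧ f = fun t => t ^ l} ∪
      {f | ∃ i : ℕ, 1 ≤ i ∧ i < κ ∧ f = fun t => (max (t - (i : ℝ) / (κ : ℝ)) 0) ^ q})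

/-! ### Probabilistic order notation -/

/-- `X n = O_P(a n)`. -/
def IsBigOInProb {Ω : Type*} [MeasurableSpace Ω] (P : Measure Ω) (X : ℕ → Ω → ℝ) (a : ℕ → ℝ) :
    Prop :=
  ∀ δ : ℝ, 0 < δ → ∃ C : ℝ, ∀ᶠ n in atTop, P {ω | C * a n < |X n ω|} ≤ ENNReal.ofReal δ

/-! ### Model and estimator -/

/-- The random curves `Z i`, the errors `ε i` (`i` is the observation index) and the coefficient
functions `β j`. -/
structure Model (Ω : Type*) (p₁ p₂ : ℕ) where
  Z : ℕ → Ω → Paths p₁ p₂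
  ε : ℕ → Ω → ℝ
  β : Pred p₁ p₂ → ℝ → ℝ

/-- The deterministic ingredients of the penalised spline estimator at each sample size `n`. -/
structure Scheme where
  /-- spline degree -/
  q : ℕ
  /-- order of the derivative in the roughness penalty -/
  m : ℕ
  /-- number of knot intervals -/
  κ : ℕ → ℕ
  κ_pos : ∀ n, 1 ≤ κ n
  /-- the spline basis -/
  ψ : (n : ℕ) → Fin (κ n + q) → ℝ → ℝ
  ψ_indep : ∀ n, LinearIndependent ℝ (ψ n)
  ψ_span : ∀ n, Submodule.span ℝ (Set.range (ψ n)) = splineSpace q (κ n)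
  /-- number of points of the common observation grid -/
  M : ℕ → ℕ
  /-- the observation grid -/
  grid : (n : ℕ) → Fin (M n) → I
  /-- the pre-smoother: from the values of a curve on the grid to its coefficient vector -/
  smooth : (n : ℕ) → (Fin (M n) → ℝ) → (Fin (κ n + q) → ℝ)
  smooth_measurable : ∀ n, Measurable (smooth n)
  /-- penalty parameter of the relevant block -/
  lam₁ : ℕ → ℝ
  /-- penalty parameter of the nuisance block -/
  lam₂ : ℕ → ℝ
  lam₁_nonneg : ∀ n, 0 ≤ lam₁ n
  lam₂_nonneg : ∀ n, 0 ≤ lam₂ n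

namespace Scheme

variable (S : Scheme)

/-- The spline basis dimension `K_z`. -/
def K (n : ℕ) : ℕ := S.κ n + S.q

/-- Gram matrix of the `m`-th derivatives of the basis functions. -/
def R₀ (n : ℕ) : Matrix (Fin (S.κ n + S.q)) (Fin (S.κ n + S.q)) ℝ :=
  Matrix.of fun k l => ∫ t : I, iteratedDeriv S.m (S.ψ n k) t * iteratedDeriv S.m (S.ψ n l) t

/-- Index set of the stacked coefficient vectors, of size `p K_z`. -/
abbrev Idx (p₁ p₂ n : ℕ) := Pred p₁ p₂ × Fin (S.κ n + S.q)

/-- The block-diagonal penalty `R_λ = diag(λ₁ R₁, λ₂ R₂)`, where `R₁` and `R₂` are block-diagonal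
with `p₁`, respectively `p₂`, blocks `R₀`. -/
def Rlam (p₁ p₂ n : ℕ) : Matrix (S.Idx p₁ p₂ n) (S.Idx p₁ p₂ n) ℝ :=
  Matrix.of fun a b =>
    if a.1 = b.1 then
      Sum.elim (fun _ => S.lam₁ n) (fun _ => S.lam₂ n) a.1 * S.R₀ n a.2 b.2
    else 0

/-- `w_{x,n}`, with entries `⟨xⱼ, ψₖ⟩`. -/
def w {p₁ p₂ : ℕ} (x : L2p p₁ p₂) (n : ℕ) : S.Idx p₁ p₂ n → ℝ :=
  fun a => ∫ t : I, x a.1 t * S.ψ n a.2 t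

end Scheme

section Estimator

variable {Ω : Type*} {p₁ p₂ : ℕ} (D : Model Ω p₁ p₂) (S : Scheme)

/-- The response `Y_i = ∑ⱼ ∫ βⱼ(t) Z_{ij}(t) dt + ε_i`. -/
def Model.Y (i : ℕ) (ω : Ω) : ℝ :=
  (∑ j, ∫ t : I, D.β j t * D.Z i ω j t) + D.ε i ω

/-- The exact basis coordinates `⟨Z_{ij}, ψₖ⟩`. -/
def exactCoord (n i : ℕ) (ω : Ω) : S.Idx p₁ p₂ n → ℝ :=
  fun a => ∫ t : I, D.Z i ω a.1 t * S.ψ n a.2 t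

/-- The basis coordinates computed by the pre-smoother from the values on the grid. -/
def coord (n i : ℕ) (ω : Ω) : S.Idx p₁ p₂ n → ℝ :=
  fun a => S.smooth n (fun l => D.Z i ω a.1 (S.grid n l)) a.2

/-- The `n × p K_z` design matrix. -/
def design (n : ℕ) (ω : Ω) : Matrix (Fin n) (S.Idx p₁ p₂ n) ℝ :=
  Matrix.of fun i => coord D S n i ω

/-- The response vector. -/
def yvec (n : ℕ) (ω : Ω) : Fin n → ℝ := fun i => D.Y i ω

open Matrix in
/-- `b̂_n = (ZᵀZ + R_λ)⁻¹ Zᵀ y`. -/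
def bhat (n : ℕ) (ω : Ω) : S.Idx p₁ p₂ n → ℝ :=
  ((design D S n ω)ᵀ * design D S n ω + S.Rlam p₁ p₂ n)⁻¹ *ᵥ
    ((design D S n ω)ᵀ *ᵥ yvec D n ω)

/-- `β̂_{j,n} = ∑ₖ b̂_{jk} ψₖ`. -/
def betahat (n : ℕ) (ω : Ω) (j : Pred p₁ p₂) (t : ℝ) : ℝ :=
  ∑ k, bhat D S n ω (j, k) * S.ψ n k t

/-- The linear functional `Ψ(x) = ∑ⱼ ∫ βⱼ xⱼ`. -/
def Psi (x : L2p p₁ p₂) : ℝ := ∑ j, ∫ t : I, D.β j t * x j t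

/-- Its estimator `Ψ̂_n(x) = ∑ⱼ ∫ β̂_{j,n} xⱼ`. -/
def Psihat (x : L2p p₁ p₂) (n : ℕ) (ω : Ω) : ℝ :=
  ∑ j, ∫ t : I, betahat D S n ω j t * x j t

open Matrix in
/-- `G_n = n⁻¹ ZᵀZ`. -/
def Gn (n : ℕ) (ω : Ω) : Matrix (S.Idx p₁ p₂ n) (S.Idx p₁ p₂ n) ℝ :=
  (n : ℝ)⁻¹ • ((design D S n ω)ᵀ * design D S n ω)

/-- `M_n = G_n + n⁻¹ R_λ`. -/
def Mn (n : ℕ) (ω : Ω) : Matrix (S.Idx p₁ p₂ n) (S.Idx p₁ p₂ n) ℝ :=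
  Gn D S n ω + (n : ℝ)⁻¹ • S.Rlam p₁ p₂ n

/-- `V_n = M_n⁻¹ G_n M_n⁻¹`. -/
def Vn (n : ℕ) (ω : Ω) : Matrix (S.Idx p₁ p₂ n) (S.Idx p₁ p₂ n) ℝ :=
  (Mn D S n ω)⁻¹ * Gn D S n ω * (Mn D S n ω)⁻¹

open Matrix in
/-- `w_{x,n}ᵀ V_n w_{x,n}`. -/
def wVw (x : L2p p₁ p₂) (n : ℕ) (ω : Ω) : ℝ :=
  S.w x n ⬝ᵥ (Vn D S n ω *ᵥ S.w x n)

open Matrix in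
/-- The hat matrix `S_n = Z (ZᵀZ + R_λ)⁻¹ Zᵀ`. -/
def hatMatrix (n : ℕ) (ω : Ω) : Matrix (Fin n) (Fin n) ℝ :=
  design D S n ω * ((design D S n ω)ᵀ * design D S n ω + S.Rlam p₁ p₂ n)⁻¹ *
    (design D S n ω)ᵀ

open Matrix in
/-- `σ̂²_n = (n - tr S_n)⁻¹ ‖y - Z b̂_n‖²`, with the Euclidean norm. -/
def sigma2hat (n : ℕ) (ω : Ω) : ℝ :=
  ((n : ℝ) - (hatMatrix D S n ω).trace)⁻¹ *
    ∑ i, (yvec D n ω i - (design D S n ω *ᵥ bhat D S n ω) i) ^ 2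

/-- The plug-in variance estimator `V̂_n(x) = σ̂²_n w_{x,n}ᵀ V_n w_{x,n}`. -/
def Vhat (x : L2p p₁ p₂) (n : ℕ) (ω : Ω) : ℝ := sigma2hat D S n ω * wVw D S x n ω

end Estimator

/-! ### Regularity conditions -/

section Conditions

variable {Ω : Type*} [MeasurableSpace Ω] {p₁ p₂ : ℕ} (P : Measure Ω)
  (D : Model Ω p₁ p₂) (S : Scheme)

/-- Random sampling: the pairs `(Z_i, ε_i)` are independent and identically distributed. -/
structure RandomSample : Prop where
  measurable_Z : ∀ i, Measurable (D.Z i)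
  measurable_ε : ∀ i, Measurable (D.ε i)
  indep : iIndepFun (fun i ω => (D.Z i ω, D.ε i ω)) P
  identDistrib : ∀ i, IdentDistrib (fun ω => (D.Z i ω, D.ε i ω))
    (fun ω => (D.Z 0 ω, D.ε 0 ω)) P P

/-- (A1) Each `βⱼ` is in the Hölder class of order `s = s' + ν`, and the degree satisfies
`q ≥ s`. -/
structure CondA1 (s' : ℕ) (ν : ℝ≥0) : Prop where
  ν_le_one : ν ≤ 1
  holder : ∀ j, HolderClass s' ν (D.β j)
  degree : (s' : ℝ) + ν ≤ S.q

/-- (A2) The penalty order satisfies `m ≤ s`. -/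
def CondA2 (s' : ℕ) (ν : ℝ≥0) : Prop := (S.m : ℝ) ≤ (s' : ℝ) + ν

/-- (A3) The curves are uniformly bounded, and the total squared pre-smoothing error of the
design, over the sample, tends to zero in probability. -/
structure CondA3 : Prop where
  bounded : ∃ C₁ : ℝ, ∀ i, ∀ᵐ ω ∂P, ∀ j, ‖D.Z i ω j‖ ≤ C₁
  presmoothing : TendstoInMeasure P
    (fun n ω => ∑ i : Fin n, ∑ a, (coord D S n i ω a - exactCoord D S n i ω a) ^ 2)
    atTop (fun _ => (0 : ℝ))

/-- (A4) The grid becomes dense, `K_z → ∞` and `K_z = o(M)`. -/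
structure CondA4 : Prop where
  M_tendsto : Tendsto S.M atTop atTop
  mesh : ∀ δ : ℝ, 0 < δ → ∀ᶠ n in atTop, ∀ l l' : Fin (S.M n), (l' : ℕ) = l + 1 →
    |(S.grid n l' : ℝ) - S.grid n l| < δ
  K_tendsto : Tendsto S.K atTop atTop
  K_isLittleO : (fun n => (S.K n : ℝ)) =o[atTop] fun n => (S.M n : ℝ)

/-- (A5) Moment conditions on the errors, with `σ² = E[ε²]`. -/
structure CondA5 (σ2 : ℝ) : Prop where
  fourth : ∀ i, Integrable (fun ω => D.ε i ω ^ 4) P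
  second : ∀ i, ∫ ω, D.ε i ω ^ 2 ∂P = σ2
  condMean : ∀ i, P[D.ε i | MeasurableSpace.comap (D.Z i) inferInstance] =ᵐ[P] fun _ => 0
  condVar : ∀ i, P[fun ω => D.ε i ω ^ 2 | MeasurableSpace.comap (D.Z i) inferInstance]
    ≤ᵐ[P] fun _ => σ2

/-- (A6) `Γ` is positive definite, with eigenvalues `γ 0 ≥ γ 1 ≥ … > 0` and an orthonormal basis
`v` of eigenfunctions; and the prediction norm of a spline,
`‖f‖₂² = ⟨Γ f, f⟩ = E[(∑ⱼ ⟨fⱼ, Zⱼ⟩)²]`, is uniformly bounded in terms of its coefficients (for an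
orthonormal spline basis this is just the boundedness of `Γ`). -/
structure CondA6 (γ : ℕ → ℝ) (v : HilbertBasis ℕ ℝ (L2p p₁ p₂)) : Prop where
  antitone : Antitone γ
  pos : ∀ k, 0 < γ k
  eigen : ∀ k, covOp P (D.Z 0) (v k) = γ k • v k
  coeffBound : ∃ C : ℝ, ∀ n, ∀ b : S.Idx p₁ p₂ n → ℝ,
    ∫ ω, (∑ a, b a * exactCoord D S n 0 ω a) ^ 2 ∂P ≤ C * ∑ a, b a ^ 2

/-- (A7) The eigenvalues of `n⁻¹ ZᵀZ` are bounded away from zero and infinity, in probability. -/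
def CondA7 : Prop :=
  ∀ δ : ℝ, 0 < δ → ∃ c C : ℝ, 0 < c ∧
    ∀ᶠ n in atTop, P {ω | ¬ spectrum ℝ (Gn D S n ω) ⊆ Set.Icc c C} ≤ ENNReal.ofReal δ

/-- (A9) `liminf w_{x,n}ᵀ V_n w_{x,n} > 0` in probability. -/
def CondA9 (x : L2p p₁ p₂) : Prop :=
  ∀ δ : ℝ, 0 < δ → ∃ c : ℝ, 0 < c ∧
    ∀ᶠ n in atTop, P {ω | wVw D S x n ω < c} ≤ ENNReal.ofReal δ

/-- The undersmoothing conditions (U1)–(U4), with `s = s' + ν`. -/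
structure CondU (s' : ℕ) (ν : ℝ≥0) : Prop where
  u1_tendsto : Tendsto S.K atTop atTop
  u1_isLittleO : (fun n => (S.K n : ℝ)) =o[atTop] fun n : ℕ => (n : ℝ) ^ (1 / 2 : ℝ)
  u2 : S.lam₁ =o[atTop]
    fun n : ℕ => (n : ℝ) ^ (-(1 / 2) : ℝ) * (S.K n : ℝ) ^ (-(2 * (S.m : ℤ) - 1))
  u3 : S.lam₂ =o[atTop]
    fun n : ℕ => (n : ℝ) ^ (-(1 / 2) : ℝ) * (S.K n : ℝ) ^ (-(2 * (S.m : ℤ) - 1))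
  u4 : (fun n => (S.K n : ℝ) ^ (-((s' : ℝ) + ν))) =o[atTop]
    fun n : ℕ => (n : ℝ) ^ (-(1 / 2) : ℝ)

end Conditions

/-- `⟨Γ⁻¹ x, x⟩ = ∑ₖ ⟨x, vₖ⟩² / γₖ`, for an eigensystem `(γ, v)` of `Γ`; it is finite exactly when
the series converges. -/
def invForm {p₁ p₂ : ℕ} (γ : ℕ → ℝ) (v : HilbertBasis ℕ ℝ (L2p p₁ p₂)) (x : L2p p₁ p₂) : ℝ :=
  ∑' k, (inner ℝ x (v k) : ℝ) ^ 2 / γ k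

end FRidge

end

/-! Write w for `S.w x n`, Z for the design, R for the penalty matrix and a = n Z (ZᵀZ + R)⁻¹ w for
the weights `weightOf`. For any spline coefficients b, the normal equations give √n (Ψ̂ - Ψ) =
n^(-1/2) ∑ aᵢ εᵢ plus three remainders: the part of the signal that b does not fit, a pairing of b
with the penalty, and the difference between ⟨x, spline of b⟩ and Ψ(x) (`ridge_functional_error`,
`abs_error_sub_linear_le`). Take b to be a Jackson approximation of β. By
`HolderClass.exists_spline_approx` and (U4) the approximation error is o(n^(-1/2)). By the inverse
inequality for splines the penalty of b is of order (λ₁ + λ₂) K^(2m), which tends to 0 by (U1)–(U3).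
So all the remainders vanish.

The heart of the matter is the limit of the weights. Formally it is ⟨Zᵢ, Γ⁻¹x⟩, but Γ⁻¹x need not
exist in L². Finiteness of ∑ ⟨x, vₖ⟩²/γₖ is exactly what makes the series ∑ (⟨x, vₖ⟩/γₖ) ⟨Z, vₖ⟩
converge in the square integrable functions of the curve. Its sum φ(Z) satisfies E[φ(Z)⟨Z, f⟩] = ⟨x,
f⟩ and E[φ(Z)²] = ⟨Γ⁻¹x, x⟩ (`exists_representer`). Hence the entries of w are the moments of φ(Z)
against the spline coordinates, and a is close to a least squares fit to the values φ(Zᵢ). To prove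
that ‖a - φ(Z)‖/√n tends to 0 (`tendsto_nrm_weight_sub`), replace φ(Z) by ⟨Z, g⟩ with g continuous,
and g by splines. The Gram matrix of growing size then has to be compared with its mean only along
one bounded spline at a time, which costs a mean square of order K/n. The bounds (A7) on its
eigenvalues do the rest.

Given the curves, the errors are centred and uncorrelated, so ∑ (aᵢ - φ(Zᵢ)) εᵢ/√n is negligible
(`CondA5.tendstoInMeasure_sum_mul`). The classical central limit theorem applies to ∑ φ(Zᵢ) εᵢ/√n.
Its variance is exactly σ² E[φ(Z)²], because the bound on the conditional variance in (A5) together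
with E[ε²] = σ² forces equality.

For the variance estimator, wᵀVw = ‖a‖²/n on the event where the design is well conditioned, and
this tends to E[φ(Z)²] by the law of large numbers. The residuals differ from the errors by o(√n) in
Euclidean norm, and 0 ≤ tr S ≤ pK = o(n), so σ̂² tends to σ². Finally (A9) excludes a zero limit,
which permits the division in the last claim. -/

noncomputable section

namespace FRidge

/-! ### Approximation by splines -/

/-- The right-continuous truncated power `t ↦ (t - a)₊ ^ d`, the indicator of `[a, ∞)` for
`d = 0`. -/
def truncPow (d : ℕ) (a t : ℝ) : ℝ := if a ≤ t then (t - a) ^ d else 0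

lemma truncPow_succ (d : ℕ) (a t : ℝ) : truncPow (d + 1) a t = (max (t - a) 0) ^ (d + 1) := by
  unfold truncPow
  split_ifs with h
  · rw [max_eq_left (by linarith)]
  · rw [max_eq_right (by linarith), zero_pow (Nat.succ_ne_zero d)]

lemma continuous_truncPow_succ (d : ℕ) (a : ℝ) : Continuous (truncPow (d + 1) a) := by
  have : truncPow (d + 1) a = fun t => (max (t - a) 0) ^ (d + 1) :=
    funext (truncPow_succ d a)
  rw [this]
  fun_prop

lemma monotone_truncPow (d : ℕ) (a : ℝ) : Monotone (truncPow d a) := by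
  intro t u htu
  unfold truncPow
  split_ifs with h h' h'
  · exact pow_le_pow_left₀ (by linarith) (by linarith) d
  · linarith
  · exact pow_nonneg (by linarith) d
  · exact le_rfl

lemma intervalIntegrable_truncPow (d : ℕ) (a b c : ℝ) :
    IntervalIntegrable (truncPow d a) volume b c :=
  (monotone_truncPow d a).intervalIntegrable

/-- For d = 0 the integrand jumps at a, so the primitive is differentiable there only from the
right. The fundamental theorem for right derivatives treats every d at once, and this is why the
truncated powers are taken right-continuous. -/
lemma integral_truncPow (d : ℕ) (a b c : ℝ) :
    ∫ u in b..c, truncPow d a u = (truncPow (d + 1) a c - truncPow (d + 1) a b) / (d + 1) := by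
  have hd : (d : ℝ) + 1 ≠ 0 := by positivity
  rw [intervalIntegral.integral_eq_sub_of_hasDeriv_right
    (f := fun t => truncPow (d + 1) a t / (d + 1))
    ((continuous_truncPow_succ d a).div_const _).continuousOn ?_
    (intervalIntegrable_truncPow d a b c)]
  · ring
  · intro x _
    by_cases hx : a ≤ x
    · have h1 : HasDerivAt (fun t : ℝ => (t - a) ^ (d + 1) / (d + 1)) ((x - a) ^ d) x := by
        have := (((hasDerivAt_id x).sub_const a).pow (d + 1)).div_const ((d : ℝ) + 1)
        refine this.congr_deriv ?_
        simp
        field_simp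
      have h2 : truncPow d a x = (x - a) ^ d := by simp [truncPow, hx]
      rw [h2]
      refine h1.hasDerivWithinAt.congr ?_ ?_
      · intro y hy
        have : a ≤ y := hx.trans (le_of_lt hy)
        simp [truncPow, this]
      · simp [truncPow, hx]
    · have h2 : truncPow d a x = 0 := by simp [truncPow, hx]
      rw [h2]
      refine (HasDerivAt.congr_of_eventuallyEq (hasDerivAt_const x (0 : ℝ)) ?_).hasDerivWithinAt
      filter_upwards [Iio_mem_nhds (not_le.mp hx)] with y hy
      have : ¬ a ≤ y := not_le.mpr hy
      simp [truncPow, this]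

/-- Span of the truncated powers of degree `d` at the knots `i / κ`, `i ≥ 1`. -/
def truncSpan (d κ : ℕ) : Submodule ℝ (ℝ → ℝ) :=
  Submodule.span ℝ {f | ∃ i : ℕ, 1 ≤ i ∧ f = truncPow d ((i : ℝ) / κ)}

lemma intervalIntegrable_of_mem_truncSpan {d κ : ℕ} {g : ℝ → ℝ} (hg : g ∈ truncSpan d κ)
    (b c : ℝ) : IntervalIntegrable g volume b c := by
  induction hg using Submodule.span_induction with
  | mem f hf => obtain ⟨i, -, rfl⟩ := hf; exact intervalIntegrable_truncPow _ _ _ _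
  | zero => exact intervalIntegrable_const
  | add f g _ _ hf hg => exact hf.add hg
  | smul a f _ hf => exact hf.const_mul a

/-- Steklov means of truncated splines are truncated splines of the next degree. -/
lemma steklov_mem_truncSpan {d κ : ℕ} (hκ : 1 ≤ κ) {g : ℝ → ℝ} (hg : g ∈ truncSpan d κ) :
    (fun t => (κ : ℝ) * ∫ u in (t - 1 / κ)..t, g u) ∈ truncSpan (d + 1) κ := by
  have hκ' : (κ : ℝ) ≠ 0 := by positivity
  induction hg using Submodule.span_induction with
  | mem f hf =>
    obtain ⟨i, hi, rfl⟩ := hf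
    have h1 : truncPow (d + 1) ((i : ℝ) / κ) ∈ truncSpan (d + 1) κ :=
      Submodule.subset_span ⟨i, hi, rfl⟩
    have h2 : truncPow (d + 1) (((i + 1 : ℕ) : ℝ) / κ) ∈ truncSpan (d + 1) κ :=
      Submodule.subset_span ⟨i + 1, by omega, rfl⟩
    have := Submodule.smul_mem _ ((κ : ℝ) / (d + 1)) (Submodule.sub_mem _ h1 h2)
    convert! this using 1
    funext t
    have h3 : truncPow (d + 1) ((i : ℝ) / κ) (t - 1 / κ) =
        truncPow (d + 1) (((i + 1 : ℕ) : ℝ) / κ) t := by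
      rw [truncPow_succ, truncPow_succ]
      push_cast
      congr 2
      field_simp
      ring
    rw [integral_truncPow, h3]
    simp only [Pi.smul_apply, Pi.sub_apply, smul_eq_mul]
    ring
  | zero =>
    simp only [Pi.zero_apply, intervalIntegral.integral_zero, mul_zero]
    exact Submodule.zero_mem _
  | add f g hf hg ihf ihg =>
    convert! Submodule.add_mem _ ihf ihg using 1
    funext t
    simp only [Pi.add_apply]
    rw [intervalIntegral.integral_add (intervalIntegrable_of_mem_truncSpan hf _ _)
      (intervalIntegrable_of_mem_truncSpan hg _ _)]
    ring
  | smul a f _ ih =>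
    convert! Submodule.smul_mem _ a ih using 1
    funext t
    simp only [Pi.smul_apply, smul_eq_mul]
    rw [intervalIntegral.integral_const_mul]
    ring

/-- The mean is taken over [t - 1/κ, t], where g is within E of h and h is within W of h(t). The
window looks only to the left, so g need not be controlled beyond t. -/
lemma steklov_error {κ : ℕ} (hκ : 1 ≤ κ) {g h : ℝ → ℝ} {W E t : ℝ}
    (hg : ∀ b c, IntervalIntegrable g volume b c)
    (hgh : ∀ u ≤ t, |g u - h u| ≤ E) (hh : ∀ u, |u - t| ≤ 1 / κ → |h u - h t| ≤ W) :
    |(κ : ℝ) * (∫ u in (t - 1 / κ)..t, g u) - h t| ≤ E + W := by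
  have hκ' : (0 : ℝ) < κ := by positivity
  have h1 : (κ : ℝ) * (∫ u in (t - 1 / κ)..t, g u) - h t =
      (κ : ℝ) * ∫ u in (t - 1 / κ)..t, (g u - h t) := by
    rw [intervalIntegral.integral_sub (hg _ _) intervalIntegrable_const,
      intervalIntegral.integral_const]
    simp
    field_simp
  have h2 : ‖∫ u in (t - 1 / κ)..t, (g u - h t)‖ ≤ (E + W) * |t - (t - 1 / κ)| := by
    refine intervalIntegral.norm_integral_le_of_norm_le_const fun u hu => ?_
    have hpos : (0 : ℝ) < 1 / κ := by positivity
    rw [Set.uIoc_of_le (by linarith)] at hu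
    have := hgh u hu.2
    have h3 := hh u (by rw [abs_le]; constructor <;> linarith [hu.1, hu.2])
    calc ‖g u - h t‖ = |(g u - h u) + (h u - h t)| := by rw [Real.norm_eq_abs]; ring_nf
      _ ≤ _ := (abs_add_le _ _).trans (add_le_add this h3)
  rw [h1, abs_mul, abs_of_pos hκ']
  rw [Real.norm_eq_abs] at h2
  calc (κ : ℝ) * |∫ u in (t - 1 / κ)..t, (g u - h t)| ≤ κ * ((E + W) * |t - (t - 1 / κ)|) := by
        gcongr
    _ = E + W := by
        rw [show t - (t - 1 / (κ : ℝ)) = 1 / κ by ring, abs_of_pos (by positivity)]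
        field_simp

/-- In degree 0, the step function with the values of h at the knots is within W of h. Each Steklov
mean raises the degree by one and costs a further W. Vanishing of h on the negative half-line
removes the need for polynomial terms and for a knot at 0. -/
lemma exists_truncSpan_near {κ : ℕ} (hκ : 1 ≤ κ) {h : ℝ → ℝ} {W : ℝ}
    (h0 : ∀ t ≤ 0, h t = 0) (hW : ∀ t u : ℝ, |t - u| ≤ 1 / (κ : ℝ) → |h t - h u| ≤ W) (d : ℕ) :
    ∃ g ∈ truncSpan d κ, ∀ t ≤ 1, |g t - h t| ≤ (d + 1) * W := by
  have hκ' : (0 : ℝ) < κ := by positivity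
  induction d with
  | zero =>
    refine ⟨∑ i ∈ Finset.range κ, (h ((i + 1 : ℕ) / κ) - h ((i : ℕ) / κ)) •
      truncPow 0 (((i + 1 : ℕ) : ℝ) / κ), ?_, fun t ht => ?_⟩
    · exact Submodule.sum_mem _ fun i _ => Submodule.smul_mem _ _
        (Submodule.subset_span ⟨i + 1, by omega, rfl⟩)
    · have hsum : (∑ i ∈ Finset.range κ, (h ((i + 1 : ℕ) / κ) - h ((i : ℕ) / κ)) •
          truncPow 0 (((i + 1 : ℕ) : ℝ) / κ)) t = h ((⌊κ * t⌋₊ : ℝ) / κ) := by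
        have hfl : ⌊κ * t⌋₊ ≤ κ := by
          apply Nat.floor_le_of_le
          nlinarith
        rw [Finset.sum_apply]
        have : ∀ i ∈ Finset.range κ, ((h ((i + 1 : ℕ) / κ) - h ((i : ℕ) / κ)) •
            truncPow 0 (((i + 1 : ℕ) : ℝ) / κ)) t =
            if i < ⌊κ * t⌋₊ then (h ((i + 1 : ℕ) / κ) - h ((i : ℕ) / κ)) else 0 := by
          intro i _
          have : (((i + 1 : ℕ) : ℝ) / κ ≤ t) ↔ i < ⌊κ * t⌋₊ := by
            rw [← Nat.succ_le_iff, Nat.le_floor_iff' (by omega), div_le_iff₀ hκ', mul_comm]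
          simp only [Pi.smul_apply, smul_eq_mul, truncPow, this, pow_zero]
          split_ifs <;> simp
        rw [Finset.sum_congr rfl this, ← Finset.sum_filter]
        have hf : (Finset.range κ).filter (fun i => i < ⌊κ * t⌋₊) = Finset.range ⌊κ * t⌋₊ := by
          ext i
          simp only [Finset.mem_filter, Finset.mem_range]
          omega
        rw [hf, Finset.sum_range_sub (fun i : ℕ => h ((i : ℝ) / κ))]
        simp [h0 0 le_rfl]
      rw [hsum]
      simp only [Nat.cast_zero, zero_add, one_mul]
      by_cases ht0 : 0 ≤ t
      · apply hW
        have h1 := Nat.floor_le (show 0 ≤ κ * t by positivity)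
        have h2 := Nat.lt_floor_add_one (κ * t)
        have e : (⌊κ * t⌋₊ : ℝ) / κ - t = ((⌊κ * t⌋₊ : ℝ) - κ * t) / κ := by field_simp
        rw [e, abs_div, abs_of_pos hκ']
        gcongr
        rw [abs_le]; constructor <;> linarith
      · have : ⌊κ * t⌋₊ = 0 := Nat.floor_of_nonpos (by nlinarith)
        rw [this]
        have := hW 0 0 (by simp)
        simpa [h0 0 le_rfl, h0 t (by linarith)] using this
  | succ d ih =>
    obtain ⟨g, hg, hgh⟩ := ih
    refine ⟨_, steklov_mem_truncSpan hκ hg, fun t ht => ?_⟩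
    have := steklov_error (t := t) hκ (intervalIntegrable_of_mem_truncSpan hg)
      (fun u hu => hgh u (hu.trans ht)) (fun u hu => hW u t hu)
    push_cast
    linarith

/-- Averaging shifts knots to the right and may push them past 1, but truncated powers with knots i
≥ κ vanish on [0,1] in positive degree. In degree 0 the generators of `splineSpace` are not step
functions, since 0 ^ 0 = 1. -/
lemma exists_splineSpace_eqOn_of_mem_truncSpan {q κ : ℕ} (hq : 1 ≤ q) (hκ : 1 ≤ κ) {g : ℝ → ℝ}
    (hg : g ∈ truncSpan q κ) : ∃ g' ∈ splineSpace q κ, Set.EqOn g' g (Set.Icc 0 1) := by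
  obtain ⟨d, rfl⟩ : ∃ d, q = d + 1 := ⟨q - 1, by omega⟩
  have hκ' : (0 : ℝ) < κ := by positivity
  induction hg using Submodule.span_induction with
  | mem f hf =>
    obtain ⟨i, hi, rfl⟩ := hf
    by_cases hiκ : i < κ
    · exact ⟨_, Submodule.subset_span (Or.inr ⟨i, hi, hiκ, rfl⟩),
        fun t _ => (truncPow_succ d _ t).symm⟩
    · refine ⟨0, Submodule.zero_mem _, fun t ht => ?_⟩
      have : (1 : ℝ) ≤ i / κ := by
        rw [le_div_iff₀ hκ', one_mul]
        exact_mod_cast not_lt.mp hiκ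
      rw [truncPow_succ, max_eq_right (by linarith [ht.2]), zero_pow (Nat.succ_ne_zero d)]
      rfl
  | zero => exact ⟨0, Submodule.zero_mem _, fun t _ => rfl⟩
  | add f g _ _ hf hg =>
    obtain ⟨f', hf', hf⟩ := hf
    obtain ⟨g', hg', hg⟩ := hg
    exact ⟨f' + g', Submodule.add_mem _ hf' hg', fun t ht => by simp [hf ht, hg ht]⟩
  | smul a f _ hf =>
    obtain ⟨f', hf', hf⟩ := hf
    exact ⟨a • f', Submodule.smul_mem _ a hf', fun t ht => by simp [hf ht]⟩

lemma const_mem_splineSpace (q κ : ℕ) (c : ℝ) : (fun _ => c) ∈ splineSpace q κ := by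
  have : (fun t : ℝ => t ^ 0) ∈ splineSpace q κ :=
    Submodule.subset_span (Or.inl ⟨0, Nat.zero_le _, rfl⟩)
  convert! Submodule.smul_mem _ c this using 1
  funext t
  simp

/-- A function whose oscillation at scale `1 / κ` is at most `W` is within `(q + 1) W` of the splines
of degree `q`. -/
theorem exists_spline_near {q κ : ℕ} (hq : 1 ≤ q) (hκ : 1 ≤ κ) {h : ℝ → ℝ} {W : ℝ}
    (hW : ∀ t ∈ Set.Icc (0 : ℝ) 1, ∀ u ∈ Set.Icc (0 : ℝ) 1, |t - u| ≤ 1 / κ → |h t - h u| ≤ W) :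
    ∃ g ∈ splineSpace q κ, ∀ t ∈ Set.Icc (0 : ℝ) 1, |h t - g t| ≤ (q + 1) * W := by
  -- Extending h by constants outside [0,1] keeps its oscillation bound, and subtracting h(0) makes
  -- it vanish on the negative half-line.
  let pr : ℝ → ℝ := fun t => (Set.projIcc (0 : ℝ) 1 zero_le_one t : ℝ)
  have hpr : ∀ t u, |pr t - pr u| ≤ |t - u| := fun t u =>
    Set.abs_projIcc_sub_projIcc zero_le_one
  obtain ⟨g, hg, hgh⟩ := exists_truncSpan_near hκ (h := fun t => h (pr t) - h 0) (W := W)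
    (fun t ht => by simp [pr, Set.projIcc_of_le_left zero_le_one ht])
    (fun t u htu => by
      simpa using hW (pr t) (Subtype.coe_prop _) (pr u) (Subtype.coe_prop _)
        ((hpr t u).trans htu)) q
  obtain ⟨g', hg', hgg'⟩ := exists_splineSpace_eqOn_of_mem_truncSpan hq hκ hg
  refine ⟨g' + fun _ => h 0, Submodule.add_mem _ hg' (const_mem_splineSpace _ _ _),
    fun t ht => ?_⟩
  have h1 := hgh t ht.2
  have h2 : pr t = t := by simp [pr, Set.projIcc_of_mem zero_le_one ht]
  rw [h2] at h1
  rw [Pi.add_apply, hgg' ht, abs_sub_comm]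
  convert! h1 using 2
  ring

/-- Primitives of splines are splines of the next degree. -/
lemma exists_splineSpace_primitive {q κ : ℕ} {g : ℝ → ℝ}
    (hg : g ∈ splineSpace q κ) :
    Continuous g ∧ ∃ G ∈ splineSpace (q + 1) κ, ∀ t, G t = ∫ u in 0..t, g u := by
  have key : ∀ l ≤ q, ∃ G ∈ splineSpace (q + 1) κ, ∀ t : ℝ, G t = ∫ u in 0..t, u ^ l := by
    intro l hl
    refine ⟨_, Submodule.smul_mem _ ((l : ℝ) + 1)⁻¹
      (Submodule.subset_span (Or.inl ⟨l + 1, by omega, rfl⟩)), fun t => ?_⟩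
    rw [integral_pow]
    simp [div_eq_inv_mul]
  induction hg using Submodule.span_induction with
  | mem f hf =>
    obtain ⟨l, hl, rfl⟩ | ⟨i, hi, hiκ, rfl⟩ := hf
    · exact ⟨by fun_prop, key l hl⟩
    · refine ⟨by fun_prop, ?_⟩
      -- For degree 0 the truncated generator is the constant 1, because 0 ^ 0 = 1, so its primitive
      -- is that of the monomial of degree 0.
      rcases q with _ | q
      · simpa using key 0 le_rfl
      · refine ⟨_, Submodule.smul_mem _ (((q + 1 : ℕ) : ℝ) + 1)⁻¹
          (Submodule.subset_span (Or.inr ⟨i, hi, hiκ, rfl⟩)), fun t => ?_⟩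
        have h0 : max (0 - (i : ℝ) / κ) 0 = 0 := max_eq_right (by simp; positivity)
        simp_rw [← truncPow_succ, integral_truncPow, truncPow_succ, h0]
        simp [div_eq_inv_mul]
  | zero => exact ⟨continuous_zero, 0, Submodule.zero_mem _, by simp⟩
  | add f g _ _ hf hg =>
    obtain ⟨cf, F, hF, hf⟩ := hf
    obtain ⟨cg, G, hG, hg⟩ := hg
    refine ⟨cf.add cg, F + G, Submodule.add_mem _ hF hG, fun t => ?_⟩
    simp only [Pi.add_apply]
    rw [hf, hg, intervalIntegral.integral_add (cf.intervalIntegrable _ _)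
      (cg.intervalIntegrable _ _)]
  | smul a f _ hf =>
    obtain ⟨cf, F, hF, hf⟩ := hf
    refine ⟨cf.const_smul a, a • F, Submodule.smul_mem _ a hF, fun t => ?_⟩
    simp only [Pi.smul_apply, smul_eq_mul]
    rw [hf, intervalIntegral.integral_const_mul]

/-- Jackson's theorem for splines with equispaced knots. -/
theorem HolderClass.exists_spline_approx {s' : ℕ} {ν : ℝ≥0} (hν : ν ≤ 1) {f : ℝ → ℝ} {q : ℕ}
    (hf : HolderClass s' ν f) (hq : (s' : ℝ) + ν ≤ q) :
    ∃ C : ℝ, ∀ κ : ℕ, 1 ≤ κ → ∃ g ∈ splineSpace q κ, ∀ t ∈ Set.Icc (0 : ℝ) 1,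
      |f t - g t| ≤ C * (κ : ℝ) ^ (-((s' : ℝ) + ν)) := by
  induction s' generalizing f q with
  | zero =>
    obtain ⟨-, C, hC⟩ := hf
    rw [iteratedDerivWithin_zero] at hC
    have hosc : ∀ t ∈ Set.Icc (0 : ℝ) 1, ∀ u ∈ Set.Icc (0 : ℝ) 1,
        |f t - f u| ≤ C * |t - u| ^ (ν : ℝ) := by
      intro t ht u hu
      simpa [Real.dist_eq] using hC.dist_le ht hu
    -- Degree 0 forces ν = 0, and then no rate is claimed and a constant is enough.
    rcases Nat.eq_zero_or_pos q with rfl | hq1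
    · have hν0 : ν = 0 := by
        have : (ν : ℝ) ≤ 0 := by simpa using hq
        exact le_antisymm (by exact_mod_cast this) zero_le
      subst hν0
      refine ⟨C, fun κ _ => ⟨_, const_mem_splineSpace 0 κ (f 0), fun t ht => ?_⟩⟩
      simpa using hosc t ht 0 (by simp)
    · refine ⟨(q + 1) * C, fun κ hκ => ?_⟩
      have hκ' : (0 : ℝ) < κ := by positivity
      obtain ⟨g, hg, hfg⟩ := exists_spline_near (h := f) (W := C * (κ : ℝ) ^ (-(ν : ℝ))) hq1 hκ
        (fun t ht u hu htu => (hosc t ht u hu).trans (by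
          gcongr
          rw [Real.rpow_neg hκ'.le, ← Real.inv_rpow hκ'.le]
          gcongr
          simpa using htu))
      refine ⟨g, hg, fun t ht => (hfg t ht).trans (le_of_eq ?_)⟩
      push_cast
      rw [zero_add, mul_assoc]
  | succ s' ih =>
    obtain ⟨q, rfl⟩ : ∃ d, q = d + 1 := by
      refine ⟨q - 1, ?_⟩
      have : 1 ≤ q := by
        have h1 : ((s' + 1 : ℕ) : ℝ) ≤ q := le_trans (by simp) hq
        have : s' + 1 ≤ q := by exact_mod_cast h1
        omega
      omega
    have hud : UniqueDiffOn ℝ (Set.Icc (0 : ℝ) 1) := uniqueDiffOn_Icc zero_lt_one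
    have hdiff : DifferentiableOn ℝ f (Set.Icc 0 1) :=
      hf.1.differentiableOn (by simp)
    have hf' : HolderClass s' ν (derivWithin f (Set.Icc 0 1)) := by
      refine ⟨?_, ?_⟩
      · have := hf.1
        push_cast at this
        exact ((contDiffOn_succ_iff_derivWithin hud).mp this).2.2
      · obtain ⟨C, hC⟩ := hf.2
        refine ⟨C, fun t ht u hu => ?_⟩
        have := hC t ht u hu
        rwa [iteratedDerivWithin_succ'] at this
    obtain ⟨C, hC⟩ := ih (q := q) hf' (by push_cast at hq; linarith)
    refine ⟨((q + 1 : ℕ) + 1) * C, fun κ hκ => ?_⟩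
    have hκ' : (0 : ℝ) < κ := by positivity
    obtain ⟨g, hg, hfg⟩ := hC κ hκ
    obtain ⟨cg, G, hG, hGg⟩ := exists_splineSpace_primitive hg
    have hder : ∀ t ∈ Set.Icc (0 : ℝ) 1, HasDerivWithinAt (fun t => f t - G t)
        (derivWithin f (Set.Icc 0 1) t - g t) (Set.Icc 0 1) t := by
      intro t ht
      have h1 : HasDerivAt G (g t) t := by
        rw [show G = fun t => ∫ u in (0 : ℝ)..t, g u from funext hGg]
        exact cg.deriv_integral g 0 t ▸ (intervalIntegral.integral_hasDerivAt_right
          (cg.intervalIntegrable _ _) (cg.stronglyMeasurableAtFilter _ _)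
          cg.continuousAt).differentiableAt.hasDerivAt
      exact ((hdiff t ht).hasDerivWithinAt).sub h1.hasDerivWithinAt
    -- G integrates a spline approximation of f', so f - G has derivative of order κ^(-(s'+ν)) and
    -- oscillates by 1/κ times that at scale 1/κ. A second approximation, of f - G, therefore gains
    -- the missing power of κ.
    obtain ⟨g₂, hg₂, hfg₂⟩ := exists_spline_near (q := q + 1) (h := fun t => f t - G t)
      (W := C * (κ : ℝ) ^ (-((s' : ℝ) + ν)) * (1 / κ)) (by omega) hκ (by
        intro t ht u hu htu
        have := (convex_Icc (0 : ℝ) 1).norm_image_sub_le_of_norm_hasDerivWithin_le hder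
          (fun x hx => hfg x hx) hu ht
        simp only [Real.norm_eq_abs] at this
        have h0 := (abs_nonneg _).trans (hfg u hu)
        exact this.trans (by gcongr))
    refine ⟨G + g₂, Submodule.add_mem _ hG hg₂, fun t ht => ?_⟩
    have := hfg₂ t ht
    rw [Pi.add_apply, ← sub_sub]
    refine this.trans (le_of_eq ?_)
    have : (κ : ℝ) ^ (-(((s' + 1 : ℕ) : ℝ) + ν)) = (κ : ℝ) ^ (-((s' : ℝ) + ν)) * (1 / κ) := by
      rw [one_div, ← Real.rpow_neg_one, ← Real.rpow_add hκ']
      congr 1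
      push_cast
      ring
    rw [this]
    ring


/-! ### Derivatives of splines -/

section Derivatives

open Polynomial

lemma iteratedDeriv_polynomial_eval (p : ℝ[X]) (m : ℕ) (t : ℝ) :
    iteratedDeriv m (fun t => p.eval t) t = (derivative^[m] p).eval t := by
  induction m generalizing p with
  | zero => simp
  | succ m ih =>
    rw [iteratedDeriv_succ', Function.iterate_succ_apply, ← ih]
    congr 1
    funext t
    simp

lemma iterate_derivative_comp_affine (p : ℝ[X]) (m : ℕ) (a h : ℝ) :
    derivative^[m] (p.comp (C h * X + C a)) =
      C (h ^ m) * (derivative^[m] p).comp (C h * X + C a) := by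
  induction m with
  | zero => simp
  | succ m ih =>
    rw [Function.iterate_succ_apply', ih, Function.iterate_succ_apply', derivative_C_mul,
      derivative_comp]
    simp only [derivative_add, derivative_mul, derivative_C, derivative_X, zero_mul, mul_one,
      zero_add, add_zero]
    rw [pow_succ, C_mul]
    ring

/-- A Markov inequality on the unit interval, with a non-explicit constant. -/
lemma exists_markov_unit (q m : ℕ) : ∃ K : ℝ, 0 ≤ K ∧ ∀ p : ℝ[X], p.natDegree ≤ q → ∀ S : ℝ,
    (∀ t ∈ Set.Ioo (0 : ℝ) 1, |p.eval t| ≤ S) →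
      ∀ t ∈ Set.Icc (0 : ℝ) 1, |(derivative^[m] p).eval t| ≤ K * S := by
  -- These are q + 1 distinct nodes strictly inside (0,1). Lagrange interpolation at them bounds
  -- each derivative by finitely many values. The endpoints are avoided because a spline is compared
  -- with its polynomial pieces only between knots.
  let x : ℕ → ℝ := fun i => (i + 1) / (q + 2)
  let s := Finset.range (q + 1)
  have hx : ∀ i ∈ s, x i ∈ Set.Ioo (0 : ℝ) 1 := by
    intro i hi
    have : (i : ℝ) ≤ q := by exact_mod_cast Nat.lt_succ_iff.mp (Finset.mem_range.mp hi)
    constructor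
    · positivity
    · rw [div_lt_one (by positivity)]
      linarith
  have hinj : Set.InjOn x s := by
    intro i _ j _ hij
    have hq : (q : ℝ) + 2 ≠ 0 := by positivity
    simp only [x] at hij
    field_simp at hij
    exact_mod_cast add_right_cancel hij
  have hbd : ∀ i, ∃ K : ℝ, ∀ t ∈ Set.Icc (0 : ℝ) 1,
      |(derivative^[m] (Lagrange.basis s x i)).eval t| ≤ K := fun i =>
    isCompact_Icc.exists_bound_of_continuousOn (Polynomial.continuous _).continuousOn
  choose K hK using hbd
  have hK0 : ∀ i, 0 ≤ K i := fun i => (abs_nonneg _).trans (hK i 0 (by simp))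
  refine ⟨∑ i ∈ s, K i, Finset.sum_nonneg fun i _ => hK0 i, fun p hp S hS t ht => ?_⟩
  have hS0 : 0 ≤ S := (abs_nonneg _).trans (hS (1 / 2) (by norm_num))
  have hdeg : p.degree < s.card := by
    refine lt_of_le_of_lt degree_le_natDegree ?_
    simp only [s, Finset.card_range]
    exact_mod_cast Nat.lt_succ_of_le hp
  rw [Lagrange.eq_interpolate hinj hdeg, Lagrange.interpolate_apply, iterate_derivative_sum,
    eval_finsetSum, Finset.sum_mul]
  refine (Finset.abs_sum_le_sum_abs _ _).trans (Finset.sum_le_sum fun i hi => ?_)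
  rw [iterate_derivative_C_mul, eval_mul, eval_C, abs_mul, mul_comm]
  exact mul_le_mul (hK i t ht) (hS _ (hx i hi)) (abs_nonneg _) (hK0 i)

/-- Affine rescaling to the unit interval: each derivative costs a factor 1/h, which becomes κ on a
knot interval. -/
lemma exists_markov (q m : ℕ) : ∃ K : ℝ, 0 ≤ K ∧ ∀ p : ℝ[X], p.natDegree ≤ q → ∀ S a h : ℝ, 0 < h →
    (∀ t ∈ Set.Ioo a (a + h), |p.eval t| ≤ S) →
      ∀ t ∈ Set.Ioo a (a + h), |(derivative^[m] p).eval t| ≤ K * (h⁻¹) ^ m * S := by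
  obtain ⟨K, hK0, hK⟩ := exists_markov_unit q m
  refine ⟨K, hK0, fun p hp S a h hh hS t ht => ?_⟩
  have hdeg : (p.comp (C h * X + C a)).natDegree ≤ q := by
    refine natDegree_comp_le.trans ?_
    have : (C h * X + C a).natDegree ≤ 1 := natDegree_linear_le
    nlinarith
  have hu : (t - a) / h ∈ Set.Icc (0 : ℝ) 1 := by
    constructor
    · exact div_nonneg (by linarith [ht.1]) hh.le
    · rw [div_le_one hh]
      linarith [ht.2]
  have := hK _ hdeg S (fun u hu => by
    rw [eval_comp]
    apply hS
    simp only [eval_add, eval_mul, eval_C, eval_X]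
    constructor <;> nlinarith [hu.1, hu.2]) _ hu
  rw [iterate_derivative_comp_affine, eval_mul, eval_C, eval_comp] at this
  simp only [eval_add, eval_mul, eval_C, eval_X] at this
  rw [mul_div_cancel₀ _ hh.ne', sub_add_cancel, abs_mul, abs_of_pos (pow_pos hh m)] at this
  have h2 := mul_le_mul_of_nonneg_left this (pow_nonneg (inv_nonneg.mpr hh.le) m)
  rw [← mul_assoc, ← mul_pow, inv_mul_cancel₀ hh.ne', one_pow, one_mul] at h2
  linarith

lemma exists_polynomial_of_mem_splineSpace {q κ : ℕ} {f : ℝ → ℝ} (hf : f ∈ splineSpace q κ)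
    (i : ℕ) : ∃ p : ℝ[X], p.natDegree ≤ q ∧
      ∀ t ∈ Set.Ioo ((i : ℝ) / κ) ((i : ℝ) / κ + (κ : ℝ)⁻¹), f t = p.eval t := by
  induction hf using Submodule.span_induction with
  | mem f hf =>
    obtain ⟨l, hl, rfl⟩ | ⟨j, hj, hjκ, rfl⟩ := hf
    · exact ⟨X ^ l, by simpa using hl, fun t _ => by simp⟩
    · have hκ : (0 : ℝ) < κ := by exact_mod_cast (by omega : 0 < κ)
      by_cases hji : j ≤ i
      · refine ⟨(X - C ((j : ℝ) / κ)) ^ q, ?_, fun t ht => ?_⟩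
        · rw [natDegree_pow, natDegree_X_sub_C, mul_one]
        · have : (j : ℝ) / κ ≤ i / κ := by gcongr
          simp only [eval_pow, eval_sub, eval_X, eval_C]
          rw [max_eq_left (by linarith [ht.1])]
      -- To the left of its knot the generator equals 0 ^ q, which is 1 when q = 0.
      · refine ⟨C ((0 : ℝ) ^ q), by rw [natDegree_C]; exact Nat.zero_le _, fun t ht => ?_⟩
        have : (i : ℝ) / κ + (κ : ℝ)⁻¹ ≤ j / κ := by
          rw [← one_div, ← add_div]
          gcongr
          exact_mod_cast (by omega : i + 1 ≤ j)
        rw [eval_C]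
        simp only
        rw [max_eq_right (by linarith [ht.2])]
  | zero => exact ⟨0, by simp, by simp⟩
  | add f g _ _ hf hg =>
    obtain ⟨p, hp, hf⟩ := hf
    obtain ⟨r, hr, hg⟩ := hg
    exact ⟨p + r, natDegree_add_le_of_degree_le hp hr, fun t ht => by
      simp [hf t ht, hg t ht]⟩
  | smul a f _ hf =>
    obtain ⟨p, hp, hf⟩ := hf
    exact ⟨a • p, (natDegree_smul_le a p).trans hp, fun t ht => by simp [hf t ht]⟩

/-- Almost every point of `[0,1]` lies strictly between two consecutive knots. -/
lemma ae_mem_Ioo_knots {κ : ℕ} (hκ : 1 ≤ κ) :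
    ∀ᵐ t : I, ∃ i < κ, (t : ℝ) ∈ Set.Ioo ((i : ℝ) / κ) ((i : ℝ) / κ + (κ : ℝ)⁻¹) := by
  have hκ' : (0 : ℝ) < κ := by positivity
  have hcount : (Set.range fun i : ℕ => (i : ℝ) / κ).Countable := Set.countable_range _
  have h1 : ∀ᵐ t : ℝ ∂(volume.restrict (Set.Icc (0 : ℝ) 1)),
      t ∉ Set.range fun i : ℕ => (i : ℝ) / κ := hcount.ae_notMem _
  have h2 : ∀ᵐ t : I, (t : ℝ) ∉ Set.range fun i : ℕ => (i : ℝ) / κ :=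
    (measurePreserving_subtype_coe measurableSet_Icc).quasiMeasurePreserving.ae h1
  filter_upwards [h2] with t ht
  have ht0 : (0 : ℝ) ≤ κ * t := mul_nonneg hκ'.le t.2.1
  have hfl := Nat.floor_le ht0
  have hlt := Nat.lt_floor_add_one (κ * (t : ℝ))
  have hne : ∀ i : ℕ, (i : ℝ) / κ ≠ t := fun i hi => ht ⟨i, hi⟩
  have hle : (⌊κ * (t : ℝ)⌋₊ : ℝ) / κ ≤ t := by
    rw [div_le_iff₀ hκ']
    linarith
  have h3 : (⌊κ * (t : ℝ)⌋₊ : ℝ) / κ < t := lt_of_le_of_ne hle (hne _)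
  refine ⟨⌊κ * (t : ℝ)⌋₊, ?_, h3, ?_⟩
  · have h1 : (t : ℝ) < 1 := by
      refine lt_of_le_of_ne t.2.2 fun h => hne κ ?_
      rw [h, div_self hκ'.ne']
    rw [Nat.floor_lt ht0]
    nlinarith
  · rw [← one_div, ← add_div, lt_div_iff₀ hκ']
    linarith

/-- The inverse inequality for splines. -/
theorem exists_spline_inverse_inequality (q m : ℕ) : ∃ K : ℝ, 0 ≤ K ∧ ∀ κ : ℕ, 1 ≤ κ →
    ∀ f ∈ splineSpace q κ, ∀ S : ℝ, (∀ t ∈ Set.Icc (0 : ℝ) 1, |f t| ≤ S) →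
      ∀ᵐ t : I, |iteratedDeriv m f t| ≤ K * (κ : ℝ) ^ m * S := by
  obtain ⟨K, hK0, hK⟩ := exists_markov q m
  refine ⟨K, hK0, fun κ hκ f hf S hS => ?_⟩
  have hκ' : (0 : ℝ) < κ := by positivity
  filter_upwards [ae_mem_Ioo_knots hκ] with t ht
  obtain ⟨i, hi, hti⟩ := ht
  obtain ⟨p, hp, hfp⟩ := exists_polynomial_of_mem_splineSpace hf i
  have h1 : f =ᶠ[𝓝 (t : ℝ)] fun t => p.eval t := by
    filter_upwards [isOpen_Ioo.mem_nhds hti] with u hu using hfp u hu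
  rw [h1.iteratedDeriv_eq m, iteratedDeriv_polynomial_eval]
  have := hK p hp S ((i : ℝ) / κ) (κ : ℝ)⁻¹ (by positivity) (fun u hu => by
    rw [← hfp u hu]
    apply hS
    have hi' : ((i : ℝ) + 1) / κ ≤ 1 := by
      rw [div_le_one hκ']
      exact_mod_cast hi
    have hi0 : (0 : ℝ) ≤ (i : ℝ) / κ := by positivity
    rw [add_div, one_div] at hi'
    exact ⟨hi0.trans hu.1.le, hu.2.le.trans hi'⟩) t hti
  rwa [inv_inv] at this

/-- Linearity can fail at the knots, where a spline may not be m times differentiable and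
`iteratedDeriv` takes default values. Strictly between knots all the basis functions are locally
polynomials. -/
lemma iteratedDeriv_sum_ae {q m κ : ℕ} (hκ : 1 ≤ κ) {ι : Type*} [Fintype ι] {ψ : ι → ℝ → ℝ}
    (hψ : ∀ k, ψ k ∈ splineSpace q κ) (b : ι → ℝ) :
    ∀ᵐ t : I, iteratedDeriv m (fun t => ∑ k, b k * ψ k t) t =
      ∑ k, b k * iteratedDeriv m (ψ k) t := by
  filter_upwards [ae_mem_Ioo_knots hκ] with t ht
  obtain ⟨i, -, hti⟩ := ht
  choose p hp hfp using fun k => exists_polynomial_of_mem_splineSpace (hψ k) i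
  have hmem := isOpen_Ioo.mem_nhds hti
  have h1 : ∀ k, ψ k =ᶠ[𝓝 (t : ℝ)] fun t => (p k).eval t := fun k => by
    filter_upwards [hmem] with u hu using hfp k u hu
  have h2 : (fun t => ∑ k, b k * ψ k t) =ᶠ[𝓝 (t : ℝ)]
      fun t => (∑ k, C (b k) * p k).eval t := by
    filter_upwards [hmem] with u hu
    simp [eval_finsetSum, hfp _ u hu]
  rw [h2.iteratedDeriv_eq m, iteratedDeriv_polynomial_eval, iterate_derivative_sum,
    eval_finsetSum]
  refine Finset.sum_congr rfl fun k _ => ?_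
  rw [(h1 k).iteratedDeriv_eq m, iteratedDeriv_polynomial_eval, iterate_derivative_C_mul]
  simp

lemma continuous_of_mem_splineSpace {q κ : ℕ} {f : ℝ → ℝ} (hf : f ∈ splineSpace q κ) :
    Continuous f := (exists_splineSpace_primitive hf).1

lemma measurable_iteratedDeriv {f : ℝ → ℝ} (hf : Continuous f) (m : ℕ) :
    Measurable (iteratedDeriv m f) := by
  cases m with
  | zero => simpa using hf.measurable
  | succ m =>
    rw [iteratedDeriv_succ]
    exact measurable_deriv _

lemma memLp_iteratedDeriv {q κ : ℕ} (hκ : 1 ≤ κ) (m : ℕ) {f : ℝ → ℝ} (hf : f ∈ splineSpace q κ) :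
    MemLp (fun t : I => iteratedDeriv m f t) 2 volume := by
  obtain ⟨K, -, hK⟩ := exists_spline_inverse_inequality q m
  have hc := continuous_of_mem_splineSpace hf
  obtain ⟨S, hS⟩ := isCompact_Icc.exists_bound_of_continuousOn (s := Set.Icc (0 : ℝ) 1)
    hc.continuousOn
  exact MemLp.of_bound
    ((measurable_iteratedDeriv hc m).comp measurable_subtype_coe).aestronglyMeasurable _
    (hK κ hκ f hf S hS)

end Derivatives

/-! ### The roughness penalty -/

namespace Scheme

open Matrix

variable (S : Scheme)

lemma ψ_mem (n : ℕ) (k : Fin (S.κ n + S.q)) : S.ψ n k ∈ splineSpace S.q (S.κ n) := by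
  rw [← S.ψ_span n]
  exact Submodule.subset_span ⟨k, rfl⟩

lemma continuous_ψ (n : ℕ) (k : Fin (S.κ n + S.q)) : Continuous (S.ψ n k) :=
  continuous_of_mem_splineSpace (S.ψ_mem n k)

/-- Turns the matrix penalty into a property of the spline alone, independent of the basis. This
gives positivity and lets the inverse inequality act on it. -/
lemma quadForm_R₀ (n : ℕ) (b : Fin (S.κ n + S.q) → ℝ) :
    ∑ k, ∑ l, b k * b l * S.R₀ n k l =
      ∫ t : I, (iteratedDeriv S.m (fun t => ∑ k, b k * S.ψ n k t) t) ^ 2 := by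
  have hint : ∀ k l, Integrable (fun t : I => iteratedDeriv S.m (S.ψ n k) t *
      iteratedDeriv S.m (S.ψ n l) t) volume := fun k l =>
    (memLp_iteratedDeriv (S.κ_pos n) S.m (S.ψ_mem n k)).integrable_mul
      (memLp_iteratedDeriv (S.κ_pos n) S.m (S.ψ_mem n l))
  have h1 : ∀ᵐ t : I, (iteratedDeriv S.m (fun t => ∑ k, b k * S.ψ n k t) t) ^ 2 =
      ∑ k, ∑ l, b k * b l * (iteratedDeriv S.m (S.ψ n k) t * iteratedDeriv S.m (S.ψ n l) t) := by
    filter_upwards [iteratedDeriv_sum_ae (m := S.m) (S.κ_pos n) (S.ψ_mem n) b] with t ht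
    rw [ht, sq, Finset.sum_mul_sum]
    exact Finset.sum_congr rfl fun k _ => Finset.sum_congr rfl fun l _ => by ring
  rw [integral_congr_ae h1, integral_finsetSum _ fun k _ =>
    integrable_finsetSum _ fun l _ => (hint k l).const_mul _]
  refine Finset.sum_congr rfl fun k _ => ?_
  rw [integral_finsetSum _ fun l _ => (hint k l).const_mul _]
  refine Finset.sum_congr rfl fun l _ => ?_
  rw [integral_const_mul]
  rfl

/-- The penalty parameter of the block of a predictor. -/
def lam (p₁ p₂ n : ℕ) (j : Pred p₁ p₂) : ℝ :=
  Sum.elim (fun _ => S.lam₁ n) (fun _ => S.lam₂ n) j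

lemma lam_nonneg (p₁ p₂ n : ℕ) (j : Pred p₁ p₂) : 0 ≤ S.lam p₁ p₂ n j := by
  rcases j with j | j
  · exact S.lam₁_nonneg n
  · exact S.lam₂_nonneg n

lemma quadForm_Rlam (p₁ p₂ n : ℕ) (b : S.Idx p₁ p₂ n → ℝ) :
    b ⬝ᵥ (S.Rlam p₁ p₂ n *ᵥ b) = ∑ j, S.lam p₁ p₂ n j *
      ∫ t : I, (iteratedDeriv S.m (fun t => ∑ k, b (j, k) * S.ψ n k t) t) ^ 2 := by
  simp only [dotProduct, mulVec, Rlam, Matrix.of_apply, Fintype.sum_prod_type, ite_mul, zero_mul]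
  refine Finset.sum_congr rfl fun j _ => ?_
  rw [← quadForm_R₀ S n fun k => b (j, k), Finset.mul_sum]
  refine Finset.sum_congr rfl fun k _ => ?_
  have : ∀ j' : Pred p₁ p₂, (∑ l, if j = j' then Sum.elim (fun _ => S.lam₁ n) (fun _ => S.lam₂ n) j *
      S.R₀ n k l * b (j', l) else 0) = if j = j' then (∑ l, S.lam p₁ p₂ n j *
      S.R₀ n k l * b (j', l)) else 0 := by
    intro j'
    split_ifs <;> simp [lam]
  rw [Finset.sum_congr rfl fun j' _ => this j', Finset.sum_ite_eq]
  simp only [Finset.mem_univ, if_true, Finset.mul_sum]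
  exact Finset.sum_congr rfl fun l _ => by ring

lemma posSemidef_Rlam (p₁ p₂ n : ℕ) : (S.Rlam p₁ p₂ n).PosSemidef := by
  refine PosSemidef.of_dotProduct_mulVec_nonneg ?_ fun b => ?_
  · ext a b
    simp only [conjTranspose_apply, Rlam, Matrix.of_apply, star_trivial, R₀]
    by_cases h : a.1 = b.1
    · rw [if_pos h, if_pos h.symm, h]
      congr 2
      funext t
      ring
    · rw [if_neg h, if_neg (Ne.symm h)]
  · rw [star_trivial, quadForm_Rlam]
    exact Finset.sum_nonneg fun j _ => mul_nonneg (S.lam_nonneg _ _ _ _)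
      (integral_nonneg fun t => sq_nonneg _)

/-- The roughness penalty of a bounded spline, by the inverse inequality. -/
lemma exists_quadForm_Rlam_le : ∃ K : ℝ, 0 ≤ K ∧ ∀ (p₁ p₂ n : ℕ) (b : S.Idx p₁ p₂ n → ℝ) (A : ℝ),
    (∀ j, ∀ t ∈ Set.Icc (0 : ℝ) 1, |∑ k, b (j, k) * S.ψ n k t| ≤ A) →
      b ⬝ᵥ (S.Rlam p₁ p₂ n *ᵥ b) ≤
        ∑ j, S.lam p₁ p₂ n j * (K * (S.κ n : ℝ) ^ (2 * S.m) * A ^ 2) := by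
  obtain ⟨K, hK0, hK⟩ := exists_spline_inverse_inequality S.q S.m
  refine ⟨K ^ 2, by positivity, fun p₁ p₂ n b A hA => ?_⟩
  rw [quadForm_Rlam]
  refine Finset.sum_le_sum fun j _ => mul_le_mul_of_nonneg_left ?_ (S.lam_nonneg _ _ _ _)
  have hmem : (fun t => ∑ k, b (j, k) * S.ψ n k t) ∈ splineSpace S.q (S.κ n) := by
    have := Submodule.sum_mem (splineSpace S.q (S.κ n)) fun k (_ : k ∈ Finset.univ) =>
      Submodule.smul_mem _ (b (j, k)) (S.ψ_mem n k)
    convert! this using 1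
    funext t
    simp
  have h := hK (S.κ n) (S.κ_pos n) _ hmem A (hA j)
  have h2 : (fun t : I => (iteratedDeriv S.m (fun t => ∑ k, b (j, k) * S.ψ n k t) t) ^ 2)
      ≤ᵐ[volume] fun _ => K ^ 2 * (S.κ n : ℝ) ^ (2 * S.m) * A ^ 2 := by
    filter_upwards [h] with t ht
    have := sq_le_sq' (by linarith [neg_abs_le (iteratedDeriv S.m
      (fun t => ∑ k, b (j, k) * S.ψ n k t) t)]) ((le_abs_self _).trans ht)
    refine this.trans (le_of_eq ?_)
    rw [mul_pow, mul_pow, ← pow_mul, mul_comm S.m 2]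
  have h3 := integral_mono_ae (memLp_iteratedDeriv (S.κ_pos n) S.m hmem).integrable_sq
    (integrable_const _) h2
  simpa using h3

end Scheme


/-! ### Euclidean norms and ridge systems -/

section Euclidean

open Matrix

variable {ι J : Type*} [Fintype ι] [Fintype J]

/-- The Euclidean norm of a coordinate vector. -/
def nrm (u : ι → ℝ) : ℝ := ‖WithLp.toLp 2 u‖

lemma nrm_nonneg (u : ι → ℝ) : 0 ≤ nrm u := norm_nonneg _

lemma nrm_sq (u : ι → ℝ) : nrm u ^ 2 = ∑ i, u i ^ 2 := by
  simp [nrm, EuclideanSpace.norm_sq_eq]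

lemma nrm_sq_eq_dotProduct (u : ι → ℝ) : nrm u ^ 2 = u ⬝ᵥ u := by
  rw [nrm_sq, dotProduct]
  exact Finset.sum_congr rfl fun i _ => by ring

lemma nrm_add_le (u v : ι → ℝ) : nrm (u + v) ≤ nrm u + nrm v := by
  simpa [nrm] using norm_add_le (WithLp.toLp 2 u) (WithLp.toLp 2 v)

lemma nrm_sub_le (u v : ι → ℝ) : nrm (u - v) ≤ nrm u + nrm v := by
  simpa [nrm] using norm_sub_le (WithLp.toLp 2 u) (WithLp.toLp 2 v)

lemma abs_nrm_sub_nrm_le (u v : ι → ℝ) : |nrm u - nrm v| ≤ nrm (u - v) := by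
  simpa [nrm] using abs_norm_sub_norm_le (WithLp.toLp 2 u) (WithLp.toLp 2 v)

lemma nrm_smul (c : ℝ) (u : ι → ℝ) : nrm (c • u) = |c| * nrm u := by
  simp [nrm, norm_smul]

lemma abs_dotProduct_le (u v : ι → ℝ) : |u ⬝ᵥ v| ≤ nrm u * nrm v := by
  refine abs_le_of_sq_le_sq ?_ (mul_nonneg (nrm_nonneg u) (nrm_nonneg v))
  rw [mul_pow, nrm_sq, nrm_sq]
  exact Finset.sum_mul_sq_le_sq_mul_sq _ _ _

lemma dotProduct_le (u v : ι → ℝ) : u ⬝ᵥ v ≤ nrm u * nrm v :=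
  (le_abs_self _).trans (abs_dotProduct_le u v)

lemma nrm_le_of_sq_le {u : ι → ℝ} {a : ℝ} (ha : 0 ≤ a) (h : nrm u ^ 2 ≤ a ^ 2) : nrm u ≤ a :=
  (pow_le_pow_iff_left₀ (nrm_nonneg u) ha two_ne_zero).mp h

/-- The Frobenius norm of a matrix. -/
def frob (D : Matrix ι J ℝ) : ℝ := √(∑ i, ∑ a, D i a ^ 2)

lemma frob_nonneg (D : Matrix ι J ℝ) : 0 ≤ frob D := Real.sqrt_nonneg _

lemma frob_sq (D : Matrix ι J ℝ) : frob D ^ 2 = ∑ i, ∑ a, D i a ^ 2 :=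
  Real.sq_sqrt (Finset.sum_nonneg fun _ _ => Finset.sum_nonneg fun _ _ => sq_nonneg _)

lemma frob_transpose (D : Matrix ι J ℝ) : frob Dᵀ = frob D := by
  unfold frob
  rw [Finset.sum_comm]
  rfl

lemma nrm_mulVec_le (D : Matrix ι J ℝ) (b : J → ℝ) : nrm (D *ᵥ b) ≤ frob D * nrm b := by
  refine nrm_le_of_sq_le (mul_nonneg (frob_nonneg D) (nrm_nonneg b)) ?_
  rw [mul_pow, frob_sq, nrm_sq, nrm_sq, Finset.sum_mul]
  exact Finset.sum_le_sum fun i _ => Finset.sum_mul_sq_le_sq_mul_sq _ _ _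

lemma nrm_transpose_mulVec_le_frob (D : Matrix ι J ℝ) (u : ι → ℝ) :
    nrm (Dᵀ *ᵥ u) ≤ frob D * nrm u :=
  frob_transpose D ▸ nrm_mulVec_le Dᵀ u

lemma dotProduct_transpose_mulVec (Z : Matrix ι J ℝ) (v : J → ℝ) (u : ι → ℝ) :
    v ⬝ᵥ (Zᵀ *ᵥ u) = u ⬝ᵥ (Z *ᵥ v) := by
  rw [mulVec_transpose, dotProduct_comm, ← dotProduct_mulVec]

/-- An upper bound on `Z` is an upper bound on its transpose. -/
lemma nrm_transpose_mulVec_sq_le {Z : Matrix ι J ℝ} {L : ℝ} (hL : 0 < L)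
    (hZ : ∀ v, nrm (Z *ᵥ v) ^ 2 ≤ L * nrm v ^ 2) (u : ι → ℝ) :
    nrm (Zᵀ *ᵥ u) ^ 2 ≤ L * nrm u ^ 2 := by
  have h1 : nrm (Zᵀ *ᵥ u) ^ 2 ≤ nrm u * nrm (Z *ᵥ (Zᵀ *ᵥ u)) := by
    rw [nrm_sq_eq_dotProduct, dotProduct_transpose_mulVec]
    exact dotProduct_le _ _
  have h2 := hZ (Zᵀ *ᵥ u)
  -- The arithmetic–geometric inequality lets half of L ‖Zᵀu‖² be absorbed into the left side.
  have h3 : 2 * L * (nrm u * nrm (Z *ᵥ (Zᵀ *ᵥ u))) ≤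
      L ^ 2 * nrm u ^ 2 + nrm (Z *ᵥ (Zᵀ *ᵥ u)) ^ 2 := by
    nlinarith [sq_nonneg (L * nrm u - nrm (Z *ᵥ (Zᵀ *ᵥ u)))]
  have h4 : L * nrm (Zᵀ *ᵥ u) ^ 2 ≤ L * (L * nrm u ^ 2) := by nlinarith
  exact le_of_mul_le_mul_left h4 hL

lemma PosSemidef.quadForm_nonneg {R : Matrix J J ℝ} (hR : R.PosSemidef) (v : J → ℝ) :
    0 ≤ v ⬝ᵥ (R *ᵥ v) := by
  simpa using hR.dotProduct_mulVec_nonneg v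

lemma PosSemidef.dotProduct_mulVec_comm {R : Matrix J J ℝ} (hR : R.PosSemidef) (u v : J → ℝ) :
    u ⬝ᵥ (R *ᵥ v) = v ⬝ᵥ (R *ᵥ u) := by
  have h : Rᵀ = R := by
    rw [← conjTranspose_eq_transpose_of_trivial]
    exact hR.isHermitian
  rw [dotProduct_comm v, dotProduct_mulVec, ← mulVec_transpose, h]

lemma PosSemidef.two_mul_dotProduct_le {R : Matrix J J ℝ} (hR : R.PosSemidef) (u v : J → ℝ) :
    2 * (u ⬝ᵥ (R *ᵥ v)) ≤ u ⬝ᵥ (R *ᵥ u) + v ⬝ᵥ (R *ᵥ v) := by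
  have := PosSemidef.quadForm_nonneg hR (u - v)
  simp only [mulVec_sub, sub_dotProduct, dotProduct_sub] at this
  rw [PosSemidef.dotProduct_mulVec_comm hR v u] at this
  linarith

/-- Cauchy–Schwarz for a positive semidefinite form. -/
lemma PosSemidef.dotProduct_sq_le {R : Matrix J J ℝ} (hR : R.PosSemidef) (u v : J → ℝ) :
    (u ⬝ᵥ (R *ᵥ v)) ^ 2 ≤ (u ⬝ᵥ (R *ᵥ u)) * (v ⬝ᵥ (R *ᵥ v)) := by
  have := discrim_le_zero (a := u ⬝ᵥ (R *ᵥ u)) (b := 2 * (u ⬝ᵥ (R *ᵥ v)))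
    (c := v ⬝ᵥ (R *ᵥ v)) fun t => by
      have := PosSemidef.quadForm_nonneg hR (t • u + v)
      simp only [mulVec_add, mulVec_smul, add_dotProduct, dotProduct_add, smul_dotProduct,
        dotProduct_smul, smul_eq_mul] at this
      rw [PosSemidef.dotProduct_mulVec_comm hR v u] at this
      linarith
  unfold discrim at this
  linarith

section Ridge

variable {Z : Matrix ι J ℝ} {R : Matrix J J ℝ} {c : ℝ}

lemma ridge_energy (Z : Matrix ι J ℝ) (R : Matrix J J ℝ) (h : J → ℝ) :
    nrm (Z *ᵥ h) ^ 2 + h ⬝ᵥ (R *ᵥ h) = h ⬝ᵥ ((Zᵀ * Z + R) *ᵥ h) := by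
  rw [add_mulVec, dotProduct_add, ← mulVec_mulVec, dotProduct_transpose_mulVec,
    nrm_sq_eq_dotProduct]

/-- With E the left side and g = (ZᵀZ + R)h, testing the system against h gives E = h·g ≤ ‖h‖‖g‖,
while c‖h‖² ≤ E since the penalty is nonnegative. Coercivity thus comes from the design alone,
whatever the size of R. -/
lemma ridge_bound (hR : R.PosSemidef) (hc : 0 < c) (hZ : ∀ v, c * nrm v ^ 2 ≤ nrm (Z *ᵥ v) ^ 2)
    (h : J → ℝ) :
    nrm (Z *ᵥ h) ^ 2 + h ⬝ᵥ (R *ᵥ h) ≤ nrm ((Zᵀ * Z + R) *ᵥ h) ^ 2 / c := by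
  have h1 := ridge_energy Z R h
  have h2 := dotProduct_le h ((Zᵀ * Z + R) *ᵥ h)
  have h3 := PosSemidef.quadForm_nonneg hR h
  have h4 := hZ h
  rw [le_div_iff₀ hc]
  nlinarith [sq_nonneg (c * nrm h - nrm ((Zᵀ * Z + R) *ᵥ h)), nrm_nonneg h,
    nrm_nonneg ((Zᵀ * Z + R) *ᵥ h)]

lemma ridge_isUnit_det [DecidableEq J] (hR : R.PosSemidef) (hc : 0 < c)
    (hZ : ∀ v, c * nrm v ^ 2 ≤ nrm (Z *ᵥ v) ^ 2) : IsUnit (Zᵀ * Z + R).det := by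
  rw [← isUnit_iff_isUnit_det, ← mulVec_injective_iff_isUnit]
  intro u v huv
  have h0 : (Zᵀ * Z + R) *ᵥ (u - v) = 0 := by
    rw [mulVec_sub]
    exact sub_eq_zero.mpr huv
  have h1 := ridge_bound hR hc hZ (u - v)
  have h2 := PosSemidef.quadForm_nonneg hR (u - v)
  have h3 := hZ (u - v)
  rw [h0] at h1
  have h4 : nrm (0 : J → ℝ) = 0 := by simp [nrm]
  rw [h4] at h1
  have h5 : nrm (u - v) ^ 2 ≤ 0 := by
    have : c * nrm (u - v) ^ 2 ≤ 0 := by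
      refine h3.trans ?_
      rw [zero_pow two_ne_zero, zero_div] at h1
      linarith
    nlinarith
  have h6 : nrm (u - v) = 0 := pow_eq_zero_iff two_ne_zero |>.mp (le_antisymm h5 (sq_nonneg _))
  simpa [nrm, sub_eq_zero] using h6

lemma ridge_solve [DecidableEq J] (hR : R.PosSemidef) (hc : 0 < c)
    (hZ : ∀ v, c * nrm v ^ 2 ≤ nrm (Z *ᵥ v) ^ 2) (g : J → ℝ) :
    (Zᵀ * Z + R) *ᵥ ((Zᵀ * Z + R)⁻¹ *ᵥ g) = g := by
  rw [mulVec_mulVec, mul_nonsing_inv _ (ridge_isUnit_det hR hc hZ), one_mulVec]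

lemma ridge_fit_le (hR : R.PosSemidef) (hc : 0 < c) (hZ : ∀ v, c * nrm v ^ 2 ≤ nrm (Z *ᵥ v) ^ 2)
    {h g : J → ℝ} (hg : (Zᵀ * Z + R) *ᵥ h = g) : nrm (Z *ᵥ h) ≤ nrm g / √c := by
  refine nrm_le_of_sq_le (div_nonneg (nrm_nonneg _) (Real.sqrt_nonneg _)) ?_
  have := ridge_bound hR hc hZ h
  rw [div_pow, Real.sq_sqrt hc.le, ← hg]
  linarith [PosSemidef.quadForm_nonneg hR h]

/-- For this right-hand side the energy is h·Rb, and Cauchy–Schwarz for R bounds the fit by the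
penalty of b. No lower bound on the design enters, so no power of n is lost. -/
lemma ridge_fit_penalty_le (hR : R.PosSemidef) {h b : J → ℝ}
    (hg : (Zᵀ * Z + R) *ᵥ h = R *ᵥ b) : nrm (Z *ᵥ h) ≤ √(b ⬝ᵥ (R *ᵥ b)) := by
  refine nrm_le_of_sq_le (Real.sqrt_nonneg _) ?_
  rw [Real.sq_sqrt (PosSemidef.quadForm_nonneg hR b)]
  have h1 := ridge_energy Z R h
  rw [hg] at h1
  linarith [PosSemidef.two_mul_dotProduct_le hR h b, PosSemidef.quadForm_nonneg hR h,
    PosSemidef.quadForm_nonneg hR b]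

/-- Ridge smoothing is a contraction of the response, again without any conditioning of the design.
-/
lemma ridge_fit_response_le (hR : R.PosSemidef) {h : J → ℝ} {u : ι → ℝ}
    (hg : (Zᵀ * Z + R) *ᵥ h = Zᵀ *ᵥ u) : nrm (Z *ᵥ h) ≤ nrm u := by
  refine nrm_le_of_sq_le (nrm_nonneg _) ?_
  have h1 := ridge_energy Z R h
  rw [hg, dotProduct_transpose_mulVec] at h1
  nlinarith [dotProduct_le u (Z *ᵥ h), PosSemidef.quadForm_nonneg hR h,
    sq_nonneg (nrm u - nrm (Z *ᵥ h))]

lemma ridge_penalty_pairing_le (hR : R.PosSemidef) (hc : 0 < c)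
    (hZ : ∀ v, c * nrm v ^ 2 ≤ nrm (Z *ᵥ v) ^ 2) {h g : J → ℝ}
    (hg : (Zᵀ * Z + R) *ᵥ h = g) (b : J → ℝ) :
    |h ⬝ᵥ (R *ᵥ b)| ≤ nrm g / √c * √(b ⬝ᵥ (R *ᵥ b)) := by
  have hb := PosSemidef.quadForm_nonneg hR b
  refine abs_le_of_sq_le_sq ?_
    (mul_nonneg (div_nonneg (nrm_nonneg _) (Real.sqrt_nonneg _)) (Real.sqrt_nonneg _))
  rw [mul_pow, div_pow, Real.sq_sqrt hc.le, Real.sq_sqrt hb]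
  refine (PosSemidef.dotProduct_sq_le hR h b).trans (mul_le_mul_of_nonneg_right ?_ hb)
  have := ridge_bound hR hc hZ h
  rw [← hg]
  nlinarith [sq_nonneg (nrm (Z *ᵥ h))]

lemma posSemidef_transpose_mul_self (Z : Matrix ι J ℝ) : (Zᵀ * Z).PosSemidef := by
  simpa only [conjTranspose_eq_transpose_of_trivial] using posSemidef_conjTranspose_mul_self Z

open scoped MatrixOrder in
-- Factor B = C*C and move C cyclically: the trace is that of the positive semidefinite matrix C A
-- C*.
lemma PosSemidef.trace_mul_nonneg [DecidableEq J] {A B : Matrix J J ℝ} (hA : A.PosSemidef)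
    (hB : B.PosSemidef) : 0 ≤ (A * B).trace := by
  obtain ⟨C, hC⟩ := CStarAlgebra.nonneg_iff_eq_star_mul_self.mp (Matrix.nonneg_iff_posSemidef.mpr hB)
  rw [hC, star_eq_conjTranspose, ← mul_assoc, trace_mul_comm, ← mul_assoc]
  exact (hA.mul_mul_conjTranspose_same C).trace_nonneg

lemma ridge_trace_nonneg [DecidableEq J] (hR : R.PosSemidef) :
    0 ≤ (Z * (Zᵀ * Z + R)⁻¹ * Zᵀ).trace := by
  have := ((posSemidef_transpose_mul_self Z).add hR).inv.mul_mul_conjTranspose_same Z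
  simpa only [conjTranspose_eq_transpose_of_trivial] using this.trace_nonneg

/-- By cyclicity the trace is tr(1) - tr((ZᵀZ + R)⁻¹ R), and the subtracted term is nonnegative. In
the singular case the inverse is 0 by convention, so the bound holds at every sample point, with no
exceptional event. -/
lemma ridge_trace_le [DecidableEq J] (hR : R.PosSemidef) :
    (Z * (Zᵀ * Z + R)⁻¹ * Zᵀ).trace ≤ Fintype.card J := by
  by_cases h : IsUnit (Zᵀ * Z + R).det
  · have hB := ((posSemidef_transpose_mul_self Z).add hR).inv
    have h1 := PosSemidef.trace_mul_nonneg hB hR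
    have h2 : (Zᵀ * Z + R)⁻¹ * (Zᵀ * Z) + (Zᵀ * Z + R)⁻¹ * R = 1 := by
      rw [← mul_add, nonsing_inv_mul _ h]
    have h3 := congrArg trace h2
    rw [trace_add, trace_one] at h3
    rw [Matrix.mul_assoc, trace_mul_comm, Matrix.mul_assoc]
    linarith
  · rw [nonsing_inv_apply_not_isUnit _ h]
    simp

end Ridge

/-- Spectral bounds are bounds on the quadratic form. -/
lemma quadForm_mem_Icc_of_spectrum [DecidableEq J] {A : Matrix J J ℝ} (hA : A.IsHermitian)
    {c C : ℝ} (h : spectrum ℝ A ⊆ Set.Icc c C) (v : J → ℝ) :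
    c * nrm v ^ 2 ≤ v ⬝ᵥ (A *ᵥ v) ∧ v ⬝ᵥ (A *ᵥ v) ≤ C * nrm v ^ 2 := by
  have hsc : ∀ r : ℝ, (algebraMap ℝ (Matrix J J ℝ) r).IsHermitian := fun r => by
    rw [Algebra.algebraMap_eq_smul_one]
    simp [IsHermitian]
  have hv : ∀ r : ℝ, v ⬝ᵥ (algebraMap ℝ (Matrix J J ℝ) r *ᵥ v) = r * nrm v ^ 2 := fun r => by
    rw [Algebra.algebraMap_eq_smul_one, smul_mulVec, one_mulVec, dotProduct_smul,
      nrm_sq_eq_dotProduct, smul_eq_mul]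
  constructor
  · have : (A - algebraMap ℝ _ c).PosSemidef := by
      refine posSemidef_iff_isHermitian_and_spectrum_nonneg.mpr ⟨hA.sub (hsc c), ?_⟩
      rw [← spectrum.sub_singleton_eq]
      rintro _ ⟨x, hx, y, rfl, rfl⟩
      exact sub_nonneg.mpr (h hx).1
    have := PosSemidef.quadForm_nonneg this v
    rw [sub_mulVec, dotProduct_sub, hv] at this
    linarith
  · have : (algebraMap ℝ _ C - A).PosSemidef := by
      refine posSemidef_iff_isHermitian_and_spectrum_nonneg.mpr ⟨(hsc C).sub hA, ?_⟩
      rw [← spectrum.singleton_sub_eq]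
      rintro _ ⟨x, rfl, y, hy, rfl⟩
      exact sub_nonneg.mpr (h hy).2
    have := PosSemidef.quadForm_nonneg this v
    rw [sub_mulVec, dotProduct_sub, hv] at this
    linarith

end Euclidean


/-! ### Convergence in probability -/

section InProbability

variable {Ω : Type*} [MeasurableSpace Ω] {P : Measure Ω}

lemma tendstoInMeasure_const_iff {X : ℕ → Ω → ℝ} {c : ℝ} :
    TendstoInMeasure P X atTop (fun _ => c) ↔ ∀ η : ℝ, 0 < η → ∀ δ : ℝ, 0 < δ →
      ∀ᶠ n in atTop, P {ω | η ≤ |X n ω - c|} ≤ ENNReal.ofReal δ := by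
  rw [tendstoInMeasure_iff_norm]
  simp only [Real.norm_eq_abs, ENNReal.tendsto_nhds_zero]
  refine forall_congr' fun η => forall_congr' fun _ => ⟨fun h δ hδ => h _ (by simpa using hδ),
    fun h ε hε => ?_⟩
  by_cases hε' : ε = ∞
  · simp [hε']
  · filter_upwards [h ε.toReal (ENNReal.toReal_pos hε.ne' hε')] with n hn
    rwa [ENNReal.ofReal_toReal hε'] at hn

lemma tendstoInMeasure_zero_iff {X : ℕ → Ω → ℝ} :
    TendstoInMeasure P X atTop (fun _ => (0 : ℝ)) ↔ ∀ η : ℝ, 0 < η → ∀ δ : ℝ, 0 < δ →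
      ∀ᶠ n in atTop, P {ω | η ≤ |X n ω|} ≤ ENNReal.ofReal δ := by
  simp [tendstoInMeasure_const_iff]

lemma measure_union_le_ofReal {A B E : Set Ω} {a b : ℝ} (ha : 0 ≤ a) (hb : 0 ≤ b)
    (hE : E ⊆ A ∪ B) (hA : P A ≤ ENNReal.ofReal a) (hB : P B ≤ ENNReal.ofReal b) :
    P E ≤ ENNReal.ofReal (a + b) := by
  rw [ENNReal.ofReal_add ha hb]
  exact (measure_mono hE).trans ((measure_union_le A B).trans (add_le_add hA hB))

/-- Convergence to zero in probability through approximate bounds on events of large probability. -/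
lemma tendstoInMeasure_zero_of_forall_approx {X : ℕ → Ω → ℝ}
    (h : ∀ δ : ℝ, 0 < δ → ∃ C : ℝ, 0 ≤ C ∧ ∀ ρ : ℝ, 0 < ρ → ∃ Y : ℕ → Ω → ℝ,
      (∀ᶠ n in atTop, P {ω | ¬ |X n ω| ≤ C * Y n ω} ≤ ENNReal.ofReal δ) ∧
      ∀ᶠ n in atTop, P {ω | ρ ≤ Y n ω} ≤ ENNReal.ofReal δ) :
    TendstoInMeasure P X atTop (fun _ => (0 : ℝ)) := by
  rw [tendstoInMeasure_zero_iff]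
  intro η hη δ hδ
  -- C depends on δ alone and is fixed before the accuracy ρ, whereas Y may change with ρ. This
  -- freedom lets the approximating spline sequence depend on the accuracy.
  obtain ⟨C, hC, h⟩ := h (δ / 2) (by positivity)
  obtain ⟨Y, h1, h2⟩ := h (η / (C + 1)) (by positivity)
  filter_upwards [h1, h2] with n h1 h2
  rw [← add_halves δ]
  refine measure_union_le_ofReal (by positivity) (by positivity) (fun ω hω => ?_) h1 h2
  by_contra hcon
  simp only [Set.mem_union, Set.mem_ofPred_eq, not_or, not_le] at hcon hω
  have h3 : C * Y n ω ≤ C * (η / (C + 1)) := mul_le_mul_of_nonneg_left hcon.2.le hC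
  have h4 : C * (η / (C + 1)) < η := by
    rw [mul_div_assoc', div_lt_iff₀ (by positivity)]
    nlinarith
  linarith [hcon.1]

/-- Domination on events of large probability. -/
lemma tendstoInMeasure_zero_of_forall_le {X Y : ℕ → Ω → ℝ}
    (hY : TendstoInMeasure P Y atTop (fun _ => (0 : ℝ)))
    (h : ∀ δ : ℝ, 0 < δ → ∃ C : ℝ, 0 ≤ C ∧
      ∀ᶠ n in atTop, P {ω | ¬ |X n ω| ≤ C * Y n ω} ≤ ENNReal.ofReal δ) :
    TendstoInMeasure P X atTop (fun _ => (0 : ℝ)) := by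
  refine tendstoInMeasure_zero_of_forall_approx fun δ hδ => ?_
  obtain ⟨C, hC, h⟩ := h δ hδ
  refine ⟨C, hC, fun ρ hρ => ⟨Y, h, ?_⟩⟩
  filter_upwards [tendstoInMeasure_zero_iff.mp hY ρ hρ δ hδ] with n hn
  exact (measure_mono fun ω hω => le_trans (Set.mem_ofPred_eq ▸ hω) (le_abs_self _)).trans hn

lemma tendstoInMeasure_of_tendsto {y : ℕ → ℝ} {c : ℝ} (hy : Tendsto y atTop (𝓝 c)) :
    TendstoInMeasure P (fun n _ => y n) atTop (fun _ => c) := by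
  rw [tendstoInMeasure_const_iff]
  intro η hη δ _
  filter_upwards [Metric.tendsto_nhds.mp hy η hη] with n hn
  rw [Real.dist_eq] at hn
  simp [not_le.mpr hn]

/-- The continuous mapping theorem at a constant limit. -/
lemma TendstoInMeasure.comp₂ {X Y : ℕ → Ω → ℝ} {a b : ℝ}
    (hX : TendstoInMeasure P X atTop (fun _ => a)) (hY : TendstoInMeasure P Y atTop (fun _ => b))
    {g : ℝ × ℝ → ℝ} (hg : ContinuousAt g (a, b)) :
    TendstoInMeasure P (fun n ω => g (X n ω, Y n ω)) atTop (fun _ => g (a, b)) := by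
  rw [tendstoInMeasure_const_iff] at *
  intro η hη δ hδ
  obtain ⟨r, hr, hg⟩ := Metric.continuousAt_iff.mp hg η hη
  filter_upwards [hX r hr (δ / 2) (by positivity), hY r hr (δ / 2) (by positivity)] with n h1 h2
  rw [← add_halves δ]
  refine measure_union_le_ofReal (by positivity) (by positivity) (fun ω hω => ?_) h1 h2
  by_contra hcon
  simp only [Set.mem_union, Set.mem_ofPred_eq, not_or, not_le] at hcon hω
  have := hg (x := (X n ω, Y n ω)) (by
    rw [Prod.dist_eq, max_lt_iff, Real.dist_eq, Real.dist_eq]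
    exact hcon)
  rw [Real.dist_eq] at this
  linarith

lemma TendstoInMeasure.comp_continuousAt {X : ℕ → Ω → ℝ} {a : ℝ}
    (hX : TendstoInMeasure P X atTop (fun _ => a)) {g : ℝ → ℝ} (hg : ContinuousAt g a) :
    TendstoInMeasure P (fun n ω => g (X n ω)) atTop (fun _ => g a) :=
  TendstoInMeasure.comp₂ hX hX (g := fun p => g p.1)
    (ContinuousAt.comp (f := Prod.fst) (x := (a, a)) hg continuousAt_fst)

lemma TendstoInMeasure.add_const_limit {X Y : ℕ → Ω → ℝ} {a b : ℝ}
    (hX : TendstoInMeasure P X atTop (fun _ => a)) (hY : TendstoInMeasure P Y atTop (fun _ => b)) :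
    TendstoInMeasure P (fun n ω => X n ω + Y n ω) atTop (fun _ => a + b) :=
  TendstoInMeasure.comp₂ hX hY (g := fun p => p.1 + p.2) (by fun_prop)

lemma TendstoInMeasure.mul_const_limit {X Y : ℕ → Ω → ℝ} {a b : ℝ}
    (hX : TendstoInMeasure P X atTop (fun _ => a)) (hY : TendstoInMeasure P Y atTop (fun _ => b)) :
    TendstoInMeasure P (fun n ω => X n ω * Y n ω) atTop (fun _ => a * b) :=
  TendstoInMeasure.comp₂ hX hY (g := fun p => p.1 * p.2) (by fun_prop)

lemma TendstoInMeasure.add_zero_limit {X Y : ℕ → Ω → ℝ}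
    (hX : TendstoInMeasure P X atTop (fun _ => (0 : ℝ)))
    (hY : TendstoInMeasure P Y atTop (fun _ => (0 : ℝ))) :
    TendstoInMeasure P (fun n ω => X n ω + Y n ω) atTop (fun _ => (0 : ℝ)) := by
  simpa using TendstoInMeasure.add_const_limit hX hY

lemma measure_ge_le_ofReal [IsFiniteMeasure P] {X : Ω → ℝ} (h0 : 0 ≤ᵐ[P] X) (hX : Integrable X P)
    {ρ e : ℝ} (hρ : 0 < ρ) (he : ∫ ω, X ω ∂P ≤ e) :
    P {ω | ρ ≤ X ω} ≤ ENNReal.ofReal (e / ρ) := by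
  have := mul_meas_ge_le_integral_of_nonneg h0 hX ρ
  rw [← ENNReal.ofReal_toReal (measure_ne_top P {ω | ρ ≤ X ω})]
  apply ENNReal.ofReal_le_ofReal
  rw [le_div_iff₀ hρ, mul_comm]
  exact this.trans he

/-- Markov's inequality. Integrability is asked only eventually, since the moment bounds divide by
n. -/
lemma tendstoInMeasure_zero_of_integral [IsFiniteMeasure P] {X : ℕ → Ω → ℝ}
    (h0 : ∀ n, 0 ≤ᵐ[P] X n) {e : ℕ → ℝ}
    (he : ∀ᶠ n in atTop, Integrable (X n) P ∧ ∫ ω, X n ω ∂P ≤ e n) (hlim : Tendsto e atTop (𝓝 0)) :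
    TendstoInMeasure P X atTop (fun _ => (0 : ℝ)) := by
  rw [tendstoInMeasure_zero_iff]
  intro η hη δ hδ
  filter_upwards [he, hlim.eventually (gt_mem_nhds (show 0 < δ * η by positivity))] with n ⟨hX, hn⟩ hn'
  have hae : ∀ᵐ ω ∂P, |X n ω| = X n ω := by
    filter_upwards [h0 n] with ω hω using abs_of_nonneg hω
  have h1 : ∫ ω, |X n ω| ∂P ≤ e n := (integral_congr_ae hae).trans_le hn
  refine measure_ge_le_ofReal (Eventually.of_forall fun ω => abs_nonneg _) hX.abs hη h1 |>.trans
    (ENNReal.ofReal_le_ofReal ?_)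
  rw [div_le_iff₀ hη]
  exact hn'.le

/-- Empirical norms converge together when their difference is negligible. -/
lemma tendstoInMeasure_nrm_of_sub {u v : (n : ℕ) → Ω → Fin n → ℝ} {ℓ : ℝ}
    (hv : TendstoInMeasure P (fun n ω => nrm (v n ω) ^ 2 / (n : ℝ)) atTop (fun _ => ℓ))
    (huv : TendstoInMeasure P (fun n ω => nrm (u n ω - v n ω) / √(n : ℝ)) atTop
      (fun _ => (0 : ℝ))) :
    TendstoInMeasure P (fun n ω => nrm (u n ω) ^ 2 / (n : ℝ)) atTop (fun _ => max ℓ 0) := by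
  have hsq : ∀ (n : ℕ) (x : Fin n → ℝ), (nrm x / √(n : ℝ)) ^ 2 = nrm x ^ 2 / n := fun n x => by
    rw [div_pow, Real.sq_sqrt (Nat.cast_nonneg n)]
  have h1 : TendstoInMeasure P (fun n ω => nrm (v n ω) / √(n : ℝ)) atTop (fun _ => √ℓ) := by
    have := TendstoInMeasure.comp_continuousAt hv Real.continuous_sqrt.continuousAt
    convert! this using 3 with n ω
    rw [← hsq, Real.sqrt_sq (div_nonneg (nrm_nonneg _) (Real.sqrt_nonneg _))]
  have h2 : TendstoInMeasure P (fun n ω => nrm (u n ω) / √(n : ℝ) - nrm (v n ω) / √(n : ℝ)) atTop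
      (fun _ => (0 : ℝ)) := by
    refine tendstoInMeasure_zero_of_forall_le huv fun δ _ => ⟨1, zero_le_one, ?_⟩
    refine Eventually.of_forall fun n => ?_
    have : {ω | ¬ |nrm (u n ω) / √(n : ℝ) - nrm (v n ω) / √(n : ℝ)| ≤
        1 * (nrm (u n ω - v n ω) / √(n : ℝ))} = ∅ := by
      rw [Set.eq_empty_iff_forall_notMem]
      intro ω hω
      apply hω
      rw [← sub_div, abs_div, abs_of_nonneg (Real.sqrt_nonneg _), one_mul]
      exact div_le_div_of_nonneg_right (abs_nrm_sub_nrm_le _ _) (Real.sqrt_nonneg _)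
    rw [this]
    simp
  have h3 := TendstoInMeasure.comp_continuousAt (TendstoInMeasure.add_const_limit h2 h1)
    (g := fun x => x ^ 2) (by fun_prop)
  convert! h3 using 3 with n ω
  · rw [sub_add_cancel, hsq]
  -- The limit is (√ℓ)², which equals max ℓ 0 because the square root of a negative number is 0.
  · rw [zero_add, Real.sq_sqrt']

lemma tendstoInMeasure_mean [IsFiniteMeasure P] {X : ℕ → Ω → ℝ} (hint : Integrable (X 0) P)
    (hindep : Pairwise fun i j => X i ⟂ᵢ[P] X j) (hident : ∀ i, IdentDistrib (X i) (X 0) P P) :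
    TendstoInMeasure P (fun n ω => (∑ i : Fin n, X i ω) / (n : ℝ)) atTop
      (fun _ => ∫ ω, X 0 ω ∂P) := by
  refine tendstoInMeasure_of_tendsto_ae (fun n => ?_) ?_
  · have : ∀ i, AEStronglyMeasurable (X i) P := fun i =>
      ((hident i).integrable_iff.mpr hint).aestronglyMeasurable
    have h2 := Finset.aestronglyMeasurable_fun_sum (μ := P) Finset.univ
      (f := fun (i : Fin n) => X i) fun i _ => this i
    simp_rw [div_eq_mul_inv]
    exact h2.mul_const _
  · filter_upwards [strong_law_ae_real X hint hindep hident] with ω hω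
    refine hω.congr fun n => ?_
    rw [Finset.sum_range]

end InProbability

/-! ### Conditionally centred errors -/

section Conditional

variable {Ω : Type*} [MeasurableSpace Ω] {P : Measure Ω} [IsProbabilityMeasure P]

/-- A variable with zero conditional mean given `Z` is orthogonal to functions of `Z` and of an
independent variable. -/
lemma integral_mul_eq_zero_of_indepFun {A B : Type*} [MeasurableSpace A] [MeasurableSpace B]
    {Z : Ω → A} {R : Ω → B} {η : Ω → ℝ} (hZ : Measurable Z) (hR : Measurable R)
    (hη : Measurable η) (hηi : Integrable η P)
    (hind : (fun ω => (Z ω, η ω)) ⟂ᵢ[P] R)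
    (hc : P[η | MeasurableSpace.comap Z inferInstance] =ᵐ[P] fun _ => 0)
    {H : A × B → ℝ} (hH : Measurable H) (hint : Integrable (fun ω => H (Z ω, R ω) * η ω) P) :
    ∫ ω, H (Z ω, R ω) * η ω ∂P = 0 := by
  have hZη : Measurable fun ω => (Z ω, η ω) := hZ.prodMk hη
  have hmap := (indepFun_iff_map_prod_eq_prod_map_map hZη.aemeasurable hR.aemeasurable).mp hind
  let F : (A × ℝ) × B → ℝ := fun p => H (p.1.1, p.2) * p.1.2
  have hF : Measurable F := by fun_prop
  have hpair : Measurable fun ω => ((Z ω, η ω), R ω) := hZη.prodMk hR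
  have hFint : Integrable F ((P.map fun ω => (Z ω, η ω)).prod (P.map R)) := by
    rw [← hmap, integrable_map_measure hF.aestronglyMeasurable hpair.aemeasurable]
    exact hint
  have h1 : ∫ ω, H (Z ω, R ω) * η ω ∂P =
      ∫ p, F p ∂((P.map fun ω => (Z ω, η ω)).prod (P.map R)) := by
    rw [← hmap, integral_map hpair.aemeasurable hF.aestronglyMeasurable]
  have : IsProbabilityMeasure (P.map R) := Measure.isProbabilityMeasure_map hR.aemeasurable
  have : IsProbabilityMeasure (P.map fun ω => (Z ω, η ω)) :=
    Measure.isProbabilityMeasure_map hZη.aemeasurable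
  -- By independence and Fubini the variable R can be frozen at a value r. Then H(Z, r) is a
  -- function of Z and is pulled out of the conditional expectation of η.
  rw [h1, integral_prod_symm F hFint]
  refine integral_eq_zero_of_ae ?_
  filter_upwards [hFint.prod_left_ae] with r hr
  have hFr : Measurable fun p : A × ℝ => F (p, r) := by fun_prop
  have hr' : Integrable (fun ω => H (Z ω, r) * η ω) P := by
    rw [integrable_map_measure hFr.aestronglyMeasurable hZη.aemeasurable] at hr
    exact hr
  rw [integral_map hZη.aemeasurable hFr.aestronglyMeasurable]
  have hHr : StronglyMeasurable[MeasurableSpace.comap Z inferInstance] fun ω => H (Z ω, r) := by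
    refine Measurable.stronglyMeasurable ?_
    have : Measurable fun a => H (a, r) := by fun_prop
    exact this.comp (comap_measurable Z)
  have h2 := condExp_mul_of_stronglyMeasurable_left (μ := P) hHr hr' hηi
  have h3 : ∫ ω, H (Z ω, r) * η ω ∂P =
      ∫ ω, (P[(fun ω => H (Z ω, r)) * η | MeasurableSpace.comap Z inferInstance]) ω ∂P :=
    (integral_condExp hZ.comap_le).symm
  change ∫ ω, H (Z ω, r) * η ω ∂P = 0
  rw [h3, integral_congr_ae h2]
  refine integral_eq_zero_of_ae ?_
  filter_upwards [hc] with ω hω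
  simp [hω]

variable {p₁ p₂ : ℕ} {D : Model Ω p₁ p₂} {σ2 : ℝ}

set_option linter.unusedSectionVars false

lemma CondA5.memLp_sq (h5 : CondA5 P D σ2) (hs : RandomSample P D) (i : ℕ) :
    MemLp (fun ω => D.ε i ω ^ 2) 2 P := by
  rw [memLp_two_iff_integrable_sq ((hs.measurable_ε i).pow_const 2).aestronglyMeasurable]
  refine (h5.fourth i).congr (Eventually.of_forall fun ω => ?_)
  ring

lemma CondA5.integrable_sq (h5 : CondA5 P D σ2) (hs : RandomSample P D) (i : ℕ) :
    Integrable (fun ω => D.ε i ω ^ 2) P :=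
  (h5.memLp_sq hs i).integrable one_le_two

lemma CondA5.memLp (h5 : CondA5 P D σ2) (hs : RandomSample P D) (i : ℕ) :
    MemLp (D.ε i) 2 P :=
  (memLp_two_iff_integrable_sq (hs.measurable_ε i).aestronglyMeasurable).mpr
    (h5.integrable_sq hs i)

lemma CondA5.nonneg (h5 : CondA5 P D σ2) : 0 ≤ σ2 := by
  rw [← h5.second 0]
  exact integral_nonneg fun ω => sq_nonneg _

/-- The errors are conditionally homoscedastic. -/
lemma CondA5.condVar_eq (h5 : CondA5 P D σ2) (hs : RandomSample P D) (i : ℕ) :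
    P[fun ω => D.ε i ω ^ 2 | MeasurableSpace.comap (D.Z i) inferInstance] =ᵐ[P] fun _ => σ2 := by
  -- The conditional second moment is at most σ² and has mean σ², so the two agree almost
  -- everywhere.
  refine (integral_eq_iff_of_ae_le integrable_condExp (integrable_const _) (h5.condVar i)).mp ?_
  rw [integral_condExp (hs.measurable_Z i).comap_le, h5.second i]
  simp

lemma CondA5.condVar_sub (h5 : CondA5 P D σ2) (hs : RandomSample P D) (i : ℕ) :
    P[fun ω => D.ε i ω ^ 2 - σ2 | MeasurableSpace.comap (D.Z i) inferInstance] =ᵐ[P]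
      fun _ => 0 := by
  have h1 := condExp_sub (h5.integrable_sq hs i) (integrable_const (μ := P) σ2)
    (MeasurableSpace.comap (D.Z i) inferInstance)
  rw [condExp_const (hs.measurable_Z i).comap_le] at h1
  filter_upwards [h1, h5.condVar_eq hs i] with ω h1 h2
  refine (show _ = _ from h1).trans ?_
  simp [h2]

/-- In extended nonnegative form this needs no integrability of f(Z) ε². It is what later proves
that φ(Z) ε is square integrable for an unbounded φ. Indicators are handled by the definition of
conditional expectation, the rest by monotone limits. -/
lemma CondA5.lintegral_mul_sq (h5 : CondA5 P D σ2) (hs : RandomSample P D) (i : ℕ)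
    {f : Paths p₁ p₂ → ℝ≥0∞} (hf : Measurable f) :
    ∫⁻ ω, f (D.Z i ω) * ENNReal.ofReal (D.ε i ω ^ 2) ∂P =
      ENNReal.ofReal σ2 * ∫⁻ ω, f (D.Z i ω) ∂P := by
  have hZ := hs.measurable_Z i
  have hε : Measurable fun ω => ENNReal.ofReal (D.ε i ω ^ 2) :=
    ((hs.measurable_ε i).pow_const 2).ennreal_ofReal
  have hfZ : ∀ f : Paths p₁ p₂ → ℝ≥0∞, Measurable f → Measurable fun ω => f (D.Z i ω) :=
    fun f hf => hf.comp hZ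
  have hfε : ∀ f : Paths p₁ p₂ → ℝ≥0∞, Measurable f →
      Measurable fun ω => f (D.Z i ω) * ENNReal.ofReal (D.ε i ω ^ 2) :=
    fun f hf => (hfZ f hf).mul hε
  refine Measurable.ennreal_induction (motive := fun f => ∫⁻ ω, f (D.Z i ω) *
    ENNReal.ofReal (D.ε i ω ^ 2) ∂P = ENNReal.ofReal σ2 * ∫⁻ ω, f (D.Z i ω) ∂P) ?_ ?_ ?_ hf
  · intro c s hs'
    have h1 : ∀ ω, s.indicator (fun _ => c) (D.Z i ω) * ENNReal.ofReal (D.ε i ω ^ 2) =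
        (D.Z i ⁻¹' s).indicator (fun ω => c * ENNReal.ofReal (D.ε i ω ^ 2)) ω := fun ω => by
      by_cases h : D.Z i ω ∈ s <;> simp [h]
    have h2 : ∀ ω, s.indicator (fun _ => c) (D.Z i ω) = (D.Z i ⁻¹' s).indicator (fun _ => c) ω :=
      fun ω => by by_cases h : D.Z i ω ∈ s <;> simp [h]
    simp_rw [h1, h2]
    rw [lintegral_indicator (hZ hs'), lintegral_indicator (hZ hs'), lintegral_const_mul _ hε,
      setLIntegral_const]
    have h3 : ∫⁻ ω in D.Z i ⁻¹' s, ENNReal.ofReal (D.ε i ω ^ 2) ∂P =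
        ENNReal.ofReal (∫ ω in D.Z i ⁻¹' s, D.ε i ω ^ 2 ∂P) :=
      (ofReal_integral_eq_lintegral_ofReal (h5.integrable_sq hs i).integrableOn
        (Eventually.of_forall fun ω => sq_nonneg _)).symm
    have h4 : ∫ ω in D.Z i ⁻¹' s, D.ε i ω ^ 2 ∂P = P.real (D.Z i ⁻¹' s) * σ2 := by
      rw [← setIntegral_condExp hZ.comap_le (h5.integrable_sq hs i) ⟨s, hs', rfl⟩,
        integral_congr_ae (ae_restrict_of_ae (h5.condVar_eq hs i))]
      simp
    rw [h3, h4, ENNReal.ofReal_mul measureReal_nonneg, ofReal_measureReal]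
    ring
  · intro f g _ hf hg hf' hg'
    simp only [Pi.add_apply, add_mul]
    rw [lintegral_add_left (hfε f hf), lintegral_add_left (hfZ f hf), hf', hg', mul_add]
  · intro f hf hmono ih
    simp only [ENNReal.iSup_mul]
    rw [lintegral_iSup (fun n => hfε _ (hf n)) fun a b hab ω => by
        exact mul_le_mul_left (hmono hab _) _,
      lintegral_iSup (fun n => hfZ _ (hf n)) fun a b hab ω => hmono hab _, ENNReal.mul_iSup]
    exact iSup_congr ih

/-- The law of a curve. -/
abbrev Model.law (D : Model Ω p₁ p₂) (P : Measure Ω) : Measure (Paths p₁ p₂) := P.map (D.Z 0)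

/-- Products of a square integrable function of the curve with the error. -/
lemma CondA5.memLp_mul (h5 : CondA5 P D σ2) (hs : RandomSample P D) {φ : Paths p₁ p₂ → ℝ}
    (hφm : Measurable φ) (hφ : MemLp φ 2 (D.law P)) :
    MemLp (fun ω => φ (D.Z 0 ω) * D.ε 0 ω) 2 P ∧ ∫ ω, φ (D.Z 0 ω) * D.ε 0 ω ∂P = 0 ∧
      ∫ ω, (φ (D.Z 0 ω) * D.ε 0 ω) ^ 2 ∂P = σ2 * ∫ ω, φ (D.Z 0 ω) ^ 2 ∂P := by
  have hZ := hs.measurable_Z 0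
  have hφZ : MemLp (fun ω => φ (D.Z 0 ω)) 2 P := hφ.comp_of_map hZ.aemeasurable
  have hsq : Integrable (fun ω => φ (D.Z 0 ω) ^ 2) P := hφZ.integrable_sq
  have key : ∫⁻ ω, ENNReal.ofReal ((φ (D.Z 0 ω) * D.ε 0 ω) ^ 2) ∂P =
      ENNReal.ofReal (σ2 * ∫ ω, φ (D.Z 0 ω) ^ 2 ∂P) := by
    rw [ENNReal.ofReal_mul h5.nonneg, ofReal_integral_eq_lintegral_ofReal hsq
      (Eventually.of_forall fun ω => sq_nonneg _),
      ← h5.lintegral_mul_sq hs 0 ((hφm.pow_const 2).ennreal_ofReal)]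
    refine lintegral_congr fun ω => ?_
    rw [mul_pow, ENNReal.ofReal_mul (sq_nonneg _)]
  have hmeas : Measurable fun ω => φ (D.Z 0 ω) * D.ε 0 ω :=
    (hφm.comp hZ).mul (hs.measurable_ε 0)
  have hint2 : Integrable (fun ω => (φ (D.Z 0 ω) * D.ε 0 ω) ^ 2) P := by
    refine ⟨(hmeas.pow_const 2).aestronglyMeasurable, ?_⟩
    rw [hasFiniteIntegral_iff_ofReal (Eventually.of_forall fun ω => sq_nonneg _), key]
    exact ENNReal.ofReal_lt_top
  have hL2 := (memLp_two_iff_integrable_sq hmeas.aestronglyMeasurable).mpr hint2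
  refine ⟨hL2, ?_, ?_⟩
  · exact integral_mul_eq_zero_of_indepFun (R := fun _ : Ω => ()) (H := fun p => φ p.1) hZ
      measurable_const (hs.measurable_ε 0) ((h5.memLp hs 0).integrable one_le_two)
      (indepFun_const_right _ _) (h5.condMean 0) (hφm.comp measurable_fst)
      (hL2.integrable one_le_two)
  · rw [integral_eq_lintegral_of_nonneg_ae (Eventually.of_forall fun ω => sq_nonneg _)
      hint2.aestronglyMeasurable, key, ENNReal.toReal_ofReal]
    exact mul_nonneg h5.nonneg (integral_nonneg fun ω => sq_nonneg _)

/-- The vector of the first `n` curves. -/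
def Model.Zvec (D : Model Ω p₁ p₂) (n : ℕ) (ω : Ω) : Fin n → Paths p₁ p₂ := fun i => D.Z i ω

lemma RandomSample.measurable_Zvec (hs : RandomSample P D) (n : ℕ) : Measurable (D.Zvec n) :=
  measurable_pi_lambda _ fun i => hs.measurable_Z i

/-- Functions of the whole sample which depend on the `i`-th pair only through the curve are
orthogonal to a conditionally centred function of the `i`-th pair. -/
lemma RandomSample.integral_mul_eq_zero (hs : RandomSample P D) {n : ℕ} (i : Fin n)
    {e : ℝ → ℝ} (he : Measurable e) (hei : Integrable (fun ω => e (D.ε i ω)) P)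
    (hc : P[fun ω => e (D.ε i ω) | MeasurableSpace.comap (D.Z i) inferInstance] =ᵐ[P] fun _ => 0)
    {H : Paths p₁ p₂ × (({i}ᶜ : Finset (Fin n)) → Paths p₁ p₂ × ℝ) → ℝ} (hH : Measurable H)
    (hint : Integrable (fun ω => H (D.Z i ω, fun k => (D.Z k ω, D.ε k ω)) * e (D.ε i ω)) P) :
    ∫ ω, H (D.Z i ω, fun k => (D.Z k ω, D.ε k ω)) * e (D.ε i ω) ∂P = 0 := by
  -- The i-th pair is independent of the family of all the other pairs, so that family plays the
  -- role of the independent variable.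
  have hm : ∀ k, Measurable fun ω => (D.Z k ω, D.ε k ω) := fun k =>
    (hs.measurable_Z k).prodMk (hs.measurable_ε k)
  have h1 := (hs.indep.precomp (g := fun k : Fin n => (k : ℕ)) Fin.val_injective).indepFun_finset
    {i} {i}ᶜ disjoint_compl_right fun k => hm k
  have h2 := h1.comp (φ := fun f => ((f ⟨i, Finset.mem_singleton_self i⟩).1,
    e (f ⟨i, Finset.mem_singleton_self i⟩).2)) (ψ := id)
    (by fun_prop) measurable_id
  exact integral_mul_eq_zero_of_indepFun
    (R := fun ω (k : ({i}ᶜ : Finset (Fin n))) => (D.Z k ω, D.ε k ω)) (hs.measurable_Z i)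
    (measurable_pi_lambda _ fun k => hm k) (he.comp (hs.measurable_ε i)) hei h2 hc hH hint

/-- The second moment of a linear form in the errors with coefficients depending on the curves. -/
lemma CondA5.integral_sum_mul_sq (h5 : CondA5 P D σ2) (hs : RandomSample P D) {n : ℕ}
    {d : Fin n → (Fin n → Paths p₁ p₂) → ℝ} (hd : ∀ i, Measurable (d i)) {b : ℝ}
    (hb : ∀ᵐ ω ∂P, ∀ i, |d i (D.Zvec n ω)| ≤ b) :
    Integrable (fun ω => (∑ i, d i (D.Zvec n ω) * D.ε i ω) ^ 2) P ∧
    ∫ ω, (∑ i, d i (D.Zvec n ω) * D.ε i ω) ^ 2 ∂P =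
      σ2 * ∫ ω, ∑ i, d i (D.Zvec n ω) ^ 2 ∂P := by
  have hdm : ∀ i, Measurable fun ω => d i (D.Zvec n ω) := fun i =>
    (hd i).comp (hs.measurable_Zvec n)
  have hbd : ∀ i j, ∀ᵐ ω ∂P, ‖d i (D.Zvec n ω) * d j (D.Zvec n ω)‖ ≤ b * b := fun i j => by
    filter_upwards [hb] with ω hω
    rw [norm_mul]
    exact mul_le_mul (hω i) (hω j) (norm_nonneg _) ((abs_nonneg _).trans (hω i))
  have hint : ∀ i j, Integrable (fun ω => (d i (D.Zvec n ω) * d j (D.Zvec n ω)) *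
      (D.ε i ω * D.ε j ω)) P := fun i j =>
    ((h5.memLp hs i).integrable_mul (h5.memLp hs j)).bdd_mul
      ((hdm i).mul (hdm j)).aestronglyMeasurable (hbd i j)
  have hdd : ∀ i j, Integrable (fun ω => d i (D.Zvec n ω) * d j (D.Zvec n ω)) P := fun i j =>
    Integrable.of_bound ((hdm i).mul (hdm j)).aestronglyMeasurable _ (hbd i j)
  have hexp : ∀ ω, (∑ i, d i (D.Zvec n ω) * D.ε i ω) ^ 2 =
      ∑ i, ∑ j, (d i (D.Zvec n ω) * d j (D.Zvec n ω)) * (D.ε i ω * D.ε j ω) := fun ω => by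
    rw [sq, Finset.sum_mul_sum]
    exact Finset.sum_congr rfl fun i _ => Finset.sum_congr rfl fun j _ => by ring
  -- Each coefficient depends on all the curves, including the i-th. Reassembling the sample of
  -- curves from curve i and the other pairs brings it to the form H(Zᵢ, rest).
  have hrec : ∀ i : Fin n, Measurable fun p : Paths p₁ p₂ ×
      (({i}ᶜ : Finset (Fin n)) → Paths p₁ p₂ × ℝ) => fun k : Fin n =>
        if h : k = i then p.1 else (p.2 ⟨k, by simpa using h⟩).1 := fun i => by
    refine measurable_pi_lambda _ fun k => ?_
    by_cases h : k = i
    · simp only [h, dif_pos]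
      exact measurable_fst
    · simp only [h, dif_neg, not_false_eq_true]
      fun_prop
  have hZrec : ∀ (i : Fin n) ω, (fun k : Fin n => if h : k = i then D.Z i ω else D.Z k ω) =
      D.Zvec n ω := fun i ω => by
    funext k
    by_cases h : k = i
    · simp [h, Model.Zvec]
    · simp [h, Model.Zvec]
  have hterm : ∀ i j, ∫ ω, (d i (D.Zvec n ω) * d j (D.Zvec n ω)) * (D.ε i ω * D.ε j ω) ∂P =
      if i = j then σ2 * ∫ ω, d i (D.Zvec n ω) ^ 2 ∂P else 0 := by
    intro i j
    -- On the diagonal the centred variable is εᵢ² - σ²; off the diagonal it is εᵢ, with εⱼ counted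
    -- among the other pairs.
    by_cases hij : i = j
    · subst hij
      rw [if_pos rfl]
      have hint' : Integrable (fun ω => (d i (D.Zvec n ω) * d i (D.Zvec n ω)) *
          (D.ε i ω ^ 2 - σ2)) P := by
        refine ((hint i i).sub ((hdd i i).mul_const σ2)).congr (Eventually.of_forall fun ω => ?_)
        simp only [Pi.sub_apply]
        ring
      have h0 := hs.integral_mul_eq_zero i (e := fun x => x ^ 2 - σ2) (by fun_prop)
        ((h5.integrable_sq hs i).sub (integrable_const _)) (h5.condVar_sub hs i)
        (H := fun p => d i (fun k => if h : k = i then p.1 else (p.2 ⟨k, by simpa using h⟩).1) *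
          d i (fun k => if h : k = i then p.1 else (p.2 ⟨k, by simpa using h⟩).1))
        (((hd i).comp (hrec i)).mul ((hd i).comp (hrec i)))
        (by simpa only [hZrec] using hint')
      simp only [hZrec] at h0
      have h1 : ∀ ω, (d i (D.Zvec n ω) * d i (D.Zvec n ω)) * (D.ε i ω * D.ε i ω) =
          (d i (D.Zvec n ω) * d i (D.Zvec n ω)) * (D.ε i ω ^ 2 - σ2) +
            σ2 * d i (D.Zvec n ω) ^ 2 := fun ω => by ring
      have hsq : Integrable (fun ω => d i (D.Zvec n ω) ^ 2) P := by
        simpa only [sq] using hdd i i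
      simp_rw [h1]
      rw [integral_add hint' (hsq.const_mul σ2), h0, zero_add, integral_const_mul]
    · rw [if_neg hij]
      have hji : j ∈ ({i}ᶜ : Finset (Fin n)) := by simpa using Ne.symm hij
      have h1 : ∀ ω, (d i (D.Zvec n ω) * d j (D.Zvec n ω)) * (D.ε i ω * D.ε j ω) =
          (d i (D.Zvec n ω) * d j (D.Zvec n ω) * D.ε j ω) * D.ε i ω := fun ω => by ring
      have hint' := hint i j
      simp_rw [h1] at hint' ⊢
      have h0 := hs.integral_mul_eq_zero i (e := id) measurable_id
        ((h5.memLp hs i).integrable one_le_two) (h5.condMean i)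
        (H := fun p => d i (fun k => if h : k = i then p.1 else (p.2 ⟨k, by simpa using h⟩).1) *
          d j (fun k => if h : k = i then p.1 else (p.2 ⟨k, by simpa using h⟩).1) *
            (p.2 ⟨j, hji⟩).2)
        ((((hd i).comp (hrec i)).mul ((hd j).comp (hrec i))).mul (by fun_prop))
        (by simpa only [hZrec, id] using hint')
      simpa only [hZrec, id] using h0
  constructor
  · simp_rw [hexp]
    exact integrable_finsetSum _ fun i _ => integrable_finsetSum _ fun j _ => hint i j
  · simp_rw [hexp]
    rw [integral_finsetSum _ fun i _ => integrable_finsetSum _ fun j _ => hint i j,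
      integral_finsetSum _ fun i _ => by simpa only [sq] using hdd i i, Finset.mul_sum]
    refine Finset.sum_congr rfl fun i _ => ?_
    rw [integral_finsetSum _ fun j _ => hint i j]
    simp [hterm]

/-- Linear forms in the errors whose coefficients, functions of the curves, are negligible in
empirical norm. -/
lemma CondA5.tendstoInMeasure_sum_mul (h5 : CondA5 P D σ2) (hs : RandomSample P D)
    {d : (n : ℕ) → Fin n → (Fin n → Paths p₁ p₂) → ℝ} (hd : ∀ n i, Measurable (d n i))
    (hlim : TendstoInMeasure P
      (fun n ω => nrm (fun i => d n i (D.Zvec n ω)) / √(n : ℝ)) atTop (fun _ => (0 : ℝ))) :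
    TendstoInMeasure P (fun (n : ℕ) ω => (√(n : ℝ))⁻¹ * ∑ i, d n i (D.Zvec n ω) * D.ε i ω) atTop
      (fun _ => (0 : ℝ)) := by
  rw [tendstoInMeasure_zero_iff] at hlim ⊢
  intro η hη δ hδ
  have hσ := h5.nonneg
  -- The ratio is the Chebyshev bound used below, after the factors n cancel; the + 1 in the witness
  -- covers σ² = 0.
  obtain ⟨ρ, hρ, hρ'⟩ : ∃ ρ : ℝ, 0 < ρ ∧ σ2 * ρ ^ 2 / η ^ 2 ≤ δ / 2 := by
    refine ⟨√(δ * η ^ 2 / (2 * (σ2 + 1))), by positivity, ?_⟩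
    rw [Real.sq_sqrt (by positivity), div_le_iff₀ (by positivity), mul_div_assoc',
      div_le_iff₀ (by positivity)]
    nlinarith [mul_pos hδ (pow_pos hη 2)]
  filter_upwards [hlim ρ hρ (δ / 2) (by positivity), eventually_gt_atTop 0] with n hn hn0
  have hn0' : (0 : ℝ) < n := by exact_mod_cast hn0
  -- Truncation by an event of the curves alone: the truncated coefficients are bounded and still
  -- functions of the curves, so the second moment formula applies even if the original ones have no
  -- moments.
  let T : Set (Fin n → Paths p₁ p₂) := {z | ∑ i, d n i z ^ 2 ≤ (n : ℝ) * ρ ^ 2}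
  have hT : MeasurableSet T := measurableSet_le
    (Finset.measurable_fun_sum _ fun i _ => (hd n i).pow_const 2) measurable_const
  let d' : Fin n → (Fin n → Paths p₁ p₂) → ℝ := fun i => T.indicator (d n i)
  have hd' : ∀ i, Measurable (d' i) := fun i => (hd n i).indicator hT
  have hsum' : ∀ z, ∑ i, d' i z ^ 2 ≤ n * ρ ^ 2 := fun z => by
    by_cases hz : z ∈ T
    · simp only [d', Set.indicator_of_mem hz]
      exact hz
    · simp only [d', Set.indicator_of_notMem hz]
      simp
      positivity
  have hb : ∀ᵐ ω ∂P, ∀ i, |d' i (D.Zvec n ω)| ≤ √(n * ρ ^ 2) :=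
    Eventually.of_forall fun ω i => Real.abs_le_sqrt
      ((Finset.single_le_sum (f := fun i => d' i (D.Zvec n ω) ^ 2) (fun j _ => sq_nonneg _)
        (Finset.mem_univ i)).trans (hsum' _))
  obtain ⟨hI, hE⟩ := h5.integral_sum_mul_sq hs hd' hb
  have hE' : ∫ ω, (∑ i, d' i (D.Zvec n ω) * D.ε i ω) ^ 2 ∂P ≤ σ2 * (n * ρ ^ 2) := by
    rw [hE]
    refine mul_le_mul_of_nonneg_left ?_ hσ
    have : ∫ ω, ∑ i, d' i (D.Zvec n ω) ^ 2 ∂P ≤ ∫ _, n * ρ ^ 2 ∂P := by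
      refine integral_mono_of_nonneg (Eventually.of_forall fun ω =>
        Finset.sum_nonneg fun i _ => sq_nonneg _) (integrable_const _)
        (Eventually.of_forall fun ω => hsum' _)
    simpa using this
  have hM := measure_ge_le_ofReal (Eventually.of_forall fun ω => sq_nonneg _) hI
    (show 0 < n * η ^ 2 by positivity) hE'
  have hM' : P {ω | n * η ^ 2 ≤ (∑ i, d' i (D.Zvec n ω) * D.ε i ω) ^ 2} ≤
      ENNReal.ofReal (δ / 2) := by
    refine hM.trans (ENNReal.ofReal_le_ofReal (le_trans (le_of_eq ?_) hρ'))
    field_simp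
  rw [← add_halves δ]
  refine measure_union_le_ofReal (by positivity) (by positivity) (fun ω hω => ?_) hn hM'
  by_contra hcon
  simp only [Set.mem_union, Set.mem_ofPred_eq, not_or, not_le] at hcon hω
  obtain ⟨h1, h2⟩ := hcon
  have hsq : √(n : ℝ) ^ 2 = n := Real.sq_sqrt hn0'.le
  have hsp : 0 < √(n : ℝ) := Real.sqrt_pos.mpr hn0'
  have hz : D.Zvec n ω ∈ T := by
    rw [abs_of_nonneg (div_nonneg (nrm_nonneg _) (Real.sqrt_nonneg _)), div_lt_iff₀ hsp] at h1
    have := pow_le_pow_left₀ (nrm_nonneg _) h1.le 2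
    rw [nrm_sq, mul_pow, hsq] at this
    change ∑ i, d n i (D.Zvec n ω) ^ 2 ≤ (n : ℝ) * ρ ^ 2
    linarith
  simp only [d', Set.indicator_of_mem hz] at h2
  have h3 := pow_le_pow_left₀ hη.le hω 2
  rw [sq_abs, mul_pow, inv_pow, hsq, inv_mul_eq_div, le_div_iff₀ hn0'] at h3
  linarith

end Conditional


/-! ### Paths as elements of `L²([0,1])^p` -/

section PathSpace

variable {p₁ p₂ : ℕ}

lemma inner_toL2p (z : Paths p₁ p₂) (x : L2p p₁ p₂) :
    inner ℝ (toL2p z) x = ∑ j, ∫ t : I, z j t * x j t := by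
  rw [PiLp.inner_apply]
  refine Finset.sum_congr rfl fun j => fun _ => ?_
  rw [L2.inner_def]
  refine integral_congr_ae ?_
  filter_upwards [ContinuousMap.coeFn_toLp (p := 2) (𝕜 := ℝ) (volume : Measure I) (z j)] with t ht
  have h : (toL2p z) j t = z j t := ht
  rw [h]
  simp [mul_comm]

lemma inner_toL2p_toL2p (z f : Paths p₁ p₂) :
    inner ℝ (toL2p z) (toL2p f) = ∑ j, ∫ t : I, z j t * f j t := by
  rw [inner_toL2p]
  refine Finset.sum_congr rfl fun j => fun _ => integral_congr_ae ?_
  filter_upwards [ContinuousMap.coeFn_toLp (p := 2) (𝕜 := ℝ) (volume : Measure I) (f j)] with t ht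
  have h : (toL2p f) j t = f j t := ht
  rw [h]

lemma continuous_toL2p : Continuous (toL2p : Paths p₁ p₂ → L2p p₁ p₂) := by
  refine (PiLp.continuous_toLp 2 _).comp (continuous_pi fun j => ?_)
  exact (ContinuousLinearMap.continuous _).comp (continuous_apply j)

lemma toL2p_sub (z f : Paths p₁ p₂) : toL2p (z - f) = toL2p z - toL2p f := by
  unfold toL2p
  rw [← WithLp.toLp_sub]
  congr 1

/-- The norm of the embedding of `C([0,1])^p` into `L²([0,1])^p`. -/
def embConst (p₁ p₂ : ℕ) : ℝ := √(Fintype.card (Pred p₁ p₂))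

lemma embConst_nonneg (p₁ p₂ : ℕ) : 0 ≤ embConst p₁ p₂ := Real.sqrt_nonneg _

lemma norm_toL2p_le {z : Paths p₁ p₂} {A : ℝ} (hz : ∀ j, ‖z j‖ ≤ A) :
    ‖toL2p z‖ ≤ embConst p₁ p₂ * |A| := by
  refine abs_le_of_sq_le_sq' ?_ (mul_nonneg (embConst_nonneg _ _) (abs_nonneg _)) |>.2
  rw [mul_pow, embConst, Real.sq_sqrt (Nat.cast_nonneg _), PiLp.norm_sq_eq_of_L2, sq_abs]
  have : ∀ j, ‖(toL2p z) j‖ ^ 2 ≤ A ^ 2 := fun j => by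
    have h1 : ‖(toL2p z) j‖ ≤ ‖z j‖ := by
      have := (ContinuousMap.toLp 2 (volume : Measure I) ℝ).le_opNorm (z j)
      have h2 := ContinuousMap.toLp_norm_le (p := 2) (volume : Measure I) (E := ℝ) (𝕜 := ℝ)
      have h3 : (measureUnivNNReal (volume : Measure I) : ℝ) = 1 := by
        simp [measureUnivNNReal]
      rw [h3, Real.one_rpow] at h2
      calc ‖(toL2p z) j‖ ≤ _ := this
        _ ≤ 1 * ‖z j‖ := by gcongr
        _ = _ := one_mul _
    have h3 := h1.trans (hz j)
    exact pow_le_pow_left₀ (norm_nonneg _) h3 2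
  calc ∑ j, ‖(toL2p z) j‖ ^ 2 ≤ ∑ _j : Pred p₁ p₂, A ^ 2 := Finset.sum_le_sum fun j _ => this j
    _ = _ := by simp

lemma exists_toL2p_near (f : L2p p₁ p₂) {ρ : ℝ} (hρ : 0 < ρ) :
    ∃ g : Paths p₁ p₂, ‖f - toL2p g‖ < ρ := by
  have hd : ∀ j, ∃ g : C(I, ℝ), ‖f j - ContinuousMap.toLp 2 (volume : Measure I) ℝ g‖ <
      ρ / (embConst p₁ p₂ + 1) := fun j => by
    have := ContinuousMap.toLp_denseRange (p := 2) ℝ (volume : Measure I) ℝ (by simp)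
    obtain ⟨g, hg⟩ := this.exists_dist_lt (f j)
      (show 0 < ρ / (embConst p₁ p₂ + 1) by have := embConst_nonneg p₁ p₂; positivity)
    exact ⟨g, by rwa [← dist_eq_norm]⟩
  choose g hg using hd
  refine ⟨g, ?_⟩
  have h0 := embConst_nonneg p₁ p₂
  have h1 : ‖f - toL2p g‖ ≤ embConst p₁ p₂ * (ρ / (embConst p₁ p₂ + 1)) := by
    refine abs_le_of_sq_le_sq' ?_ (by positivity) |>.2
    rw [mul_pow, embConst, Real.sq_sqrt (Nat.cast_nonneg _), PiLp.norm_sq_eq_of_L2]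
    calc ∑ j, ‖(f - toL2p g) j‖ ^ 2 ≤ ∑ _j : Pred p₁ p₂, (ρ / (embConst p₁ p₂ + 1)) ^ 2 :=
          Finset.sum_le_sum fun j _ => pow_le_pow_left₀ (norm_nonneg _) (hg j).le 2
      _ = _ := by simp [embConst]
  refine h1.trans_lt ?_
  rw [mul_div_assoc', div_lt_iff₀ (by positivity)]
  nlinarith

end PathSpace

/-! ### The covariance operator and the representer of `Γ⁻¹ x` -/

section Representer

variable {Ω : Type*} [MeasurableSpace Ω] {P : Measure Ω} [IsProbabilityMeasure P] {p₁ p₂ : ℕ}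
  {Z : Ω → Paths p₁ p₂} {B : ℝ}

lemma integrable_inner_smul (hZ : Measurable Z) (hB : ∀ᵐ ω ∂P, ‖toL2p (Z ω)‖ ≤ B)
    (g : L2p p₁ p₂) :
    Integrable (fun ω => (inner ℝ (toL2p (Z ω)) g : ℝ) • toL2p (Z ω)) P := by
  have hc : Continuous fun z : Paths p₁ p₂ => (inner ℝ (toL2p z) g : ℝ) • toL2p z :=
    by
    exact Continuous.smul (f := fun z : Paths p₁ p₂ => (inner ℝ (toL2p z) g : ℝ))
      (continuous_toL2p.inner continuous_const) continuous_toL2p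
  have hZs : StronglyMeasurable Z := hZ.stronglyMeasurable
  refine Integrable.of_bound (hc.comp_stronglyMeasurable hZs).aestronglyMeasurable
    (B * ‖g‖ * B) ?_
  filter_upwards [hB] with ω hω
  rw [norm_smul]
  have h0 := (norm_nonneg _).trans hω
  refine mul_le_mul ((norm_inner_le_norm _ _).trans ?_) hω (norm_nonneg _) (by positivity)
  gcongr

lemma integral_inner_mul_inner (hZ : Measurable Z) (hB : ∀ᵐ ω ∂P, ‖toL2p (Z ω)‖ ≤ B)
    (f g : L2p p₁ p₂) :
    ∫ ω, inner ℝ (toL2p (Z ω)) f * inner ℝ (toL2p (Z ω)) g ∂P = inner ℝ f (covOp P Z g) := by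
  rw [covOp, ← integral_inner (integrable_inner_smul hZ hB g) f]
  refine integral_congr_ae (Eventually.of_forall fun ω => ?_)
  simp only [inner_smul_right, real_inner_comm f]
  ring

lemma measurable_inner_toL2p (f : L2p p₁ p₂) :
    Measurable fun z : Paths p₁ p₂ => (inner ℝ (toL2p z) f : ℝ) :=
  (continuous_toL2p.inner continuous_const).measurable

lemma memLp_inner_toL2p (hZ : Measurable Z) (hB : ∀ᵐ ω ∂P, ‖toL2p (Z ω)‖ ≤ B)
    (f : L2p p₁ p₂) : MemLp (fun z => (inner ℝ (toL2p z) f : ℝ)) 2 (P.map Z) := by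
  have : IsProbabilityMeasure (P.map Z) := Measure.isProbabilityMeasure_map hZ.aemeasurable
  refine MemLp.of_bound (measurable_inner_toL2p f).aestronglyMeasurable (B * ‖f‖) ?_
  have hm : MeasurableSet {z : Paths p₁ p₂ | ‖(inner ℝ (toL2p z) f : ℝ)‖ ≤ B * ‖f‖} :=
    measurableSet_le (measurable_inner_toL2p f).norm measurable_const
  rw [ae_map_iff hZ.aemeasurable hm]
  filter_upwards [hB] with ω hω
  exact (norm_inner_le_norm _ _).trans (by gcongr)

/-- The map `f ↦ ⟨Z, f⟩` into the square integrable functions of the curve. -/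
def obs (hZ : Measurable Z) (hB : ∀ᵐ ω ∂P, ‖toL2p (Z ω)‖ ≤ B) :
    L2p p₁ p₂ →ₗ[ℝ] Lp ℝ 2 (P.map Z) where
  toFun f := (memLp_inner_toL2p hZ hB f).toLp _
  map_add' f g := by
    rw [← MemLp.toLp_add]
    congr 1
    funext z
    simp [inner_add_right]
  map_smul' c f := by
    rw [RingHom.id_apply, ← MemLp.toLp_const_smul]
    congr 1
    funext z
    simp [inner_smul_right]

lemma coeFn_obs (hZ : Measurable Z) (hB : ∀ᵐ ω ∂P, ‖toL2p (Z ω)‖ ≤ B) (f : L2p p₁ p₂) :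
    (obs hZ hB f : Paths p₁ p₂ → ℝ) =ᵐ[P.map Z] fun z => (inner ℝ (toL2p z) f : ℝ) :=
  MemLp.coeFn_toLp (memLp_inner_toL2p hZ hB f)

/-- The covariance form becomes an honest inner product on functions of the curve. There the
eigenfunctions have orthogonal images, with squared norms γₖ. -/
lemma inner_obs (hZ : Measurable Z) (hB : ∀ᵐ ω ∂P, ‖toL2p (Z ω)‖ ≤ B) (f g : L2p p₁ p₂) :
    inner ℝ (obs hZ hB f) (obs hZ hB g) = (inner ℝ f (covOp P Z g) : ℝ) := by
  rw [L2.inner_def, ← integral_inner_mul_inner hZ hB,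
    ← integral_map (φ := Z) hZ.aemeasurable (f := fun z => inner ℝ (toL2p z) f * inner ℝ (toL2p z) g)
    ((measurable_inner_toL2p f).mul (measurable_inner_toL2p g)).aestronglyMeasurable]
  refine integral_congr_ae ?_
  filter_upwards [coeFn_obs hZ hB f, coeFn_obs hZ hB g] with z h1 h2
  rw [h1, h2]
  simp [mul_comm]

/-- The representer `ξ = ∑ₖ ⟨x, vₖ⟩ / γₖ ⟨Z, vₖ⟩` of `x` in the closed span of the linear functionals
of the curve. -/
theorem exists_representer (hZ : Measurable Z) (hB : ∀ᵐ ω ∂P, ‖toL2p (Z ω)‖ ≤ B) {γ : ℕ → ℝ}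
    {v : HilbertBasis ℕ ℝ (L2p p₁ p₂)} (hγ : ∀ k, 0 < γ k) (hv : ∀ k, covOp P Z (v k) = γ k • v k)
    {x : L2p p₁ p₂} (hx : Summable fun k => (inner ℝ x (v k) : ℝ) ^ 2 / γ k) :
    ∃ φ : Paths p₁ p₂ → ℝ, Measurable φ ∧ MemLp φ 2 (P.map Z) ∧
      (∀ f : L2p p₁ p₂, ∫ ω, φ (Z ω) * inner ℝ (toL2p (Z ω)) f ∂P = inner ℝ x f) ∧
      ∫ ω, φ (Z ω) ^ 2 ∂P = invForm γ v x ∧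
      ∀ ρ : ℝ, 0 < ρ → ∃ g : Paths p₁ p₂,
        ∫ ω, (φ (Z ω) - inner ℝ (toL2p (Z ω)) (toL2p g)) ^ 2 ∂P < ρ := by
  let T := obs hZ hB
  have hs : ∀ k, √(γ k) ≠ 0 := fun k => (Real.sqrt_pos.mpr (hγ k)).ne'
  have hss : ∀ k, √(γ k) * √(γ k) = γ k := fun k => Real.mul_self_sqrt (hγ k).le
  -- The normalisation by √γₖ makes the images of the eigenfunctions orthonormal.
  let e : ℕ → Lp ℝ 2 (P.map Z) := fun k => T ((√(γ k))⁻¹ • v k)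
  have hTe : ∀ k f, inner ℝ (e k) (T f) = √(γ k) * (inner ℝ (v k) f : ℝ) := fun k f => by
    have h1 : inner ℝ (T (v k)) (T f) = γ k * (inner ℝ (v k) f : ℝ) := by
      rw [real_inner_comm, inner_obs, hv, inner_smul_right, real_inner_comm]
    simp only [e, map_smul, inner_smul_left, h1]
    rw [← hss k]
    have := hs k
    simp
    field_simp
  have hon : Orthonormal ℝ e := by
    rw [orthonormal_iff_ite]
    intro k l
    have h1 := orthonormal_iff_ite.mp v.orthonormal k l
    change inner ℝ (e k) (T ((√(γ l))⁻¹ • v l)) = _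
    rw [hTe, inner_smul_right, h1]
    split_ifs with h
    · subst h
      rw [mul_one, mul_inv_cancel₀ (hs k)]
    · simp
  -- Formally the coordinates of Γ^(-1/2) x. Their square-summability is the hypothesis on x, and it
  -- gives convergence of the orthonormal series.
  let c : ℕ → ℝ := fun k => inner ℝ x (v k) / √(γ k)
  have hc : ∀ k, c k ^ 2 = inner ℝ x (v k) ^ 2 / γ k := fun k => by
    simp only [c]
    rw [div_pow, Real.sq_sqrt (hγ k).le]
  have hsum : Summable fun k => c k • e k := by
    have h1 := hon.orthogonalFamily.summable_iff_norm_sq_summable c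
    simp only [LinearIsometry.toSpanSingleton_apply, Real.norm_eq_abs, sq_abs] at h1
    rw [h1]
    simpa only [hc] using hx
  obtain ⟨ξ, hξ⟩ := hsum
  have hξT : ∀ f, inner ℝ ξ (T f) = (inner ℝ x f : ℝ) := fun f => by
    have h1 := hξ.mapL (innerSL ℝ (T f))
    have h2 := v.hasSum_inner_mul_inner x f
    have h3 : ∀ k, innerSL ℝ (T f) (c k • e k) = inner ℝ x (v k) * (inner ℝ (v k) f : ℝ) := by
      intro k
      rw [innerSL_apply_apply, inner_smul_right, real_inner_comm, hTe]
      simp only [c]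
      have := hs k
      field_simp
    simp only [h3] at h1
    have h4 := h1.unique h2
    rwa [innerSL_apply_apply, real_inner_comm] at h4
  have hξsq : inner ℝ ξ ξ = invForm γ v x := by
    have h1 := hξ.mapL (innerSL ℝ ξ)
    have h3 : ∀ k, innerSL ℝ ξ (c k • e k) = inner ℝ x (v k) ^ 2 / γ k := by
      intro k
      rw [innerSL_apply_apply, inner_smul_right, hξT, inner_smul_right, ← hc]
      simp only [c]
      ring
    simp only [h3] at h1
    exact h1.tsum_eq.symm
  have hφ : StronglyMeasurable (ξ : Paths p₁ p₂ → ℝ) := Lp.stronglyMeasurable ξ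
  have hφm : Measurable (ξ : Paths p₁ p₂ → ℝ) := hφ.measurable
  refine ⟨ξ, hφm, Lp.memLp ξ, fun f => ?_, ?_, fun ρ hρ => ?_⟩
  · rw [← hξT f, L2.inner_def, ← integral_map (φ := Z) hZ.aemeasurable
      (f := fun z => ξ z * inner ℝ (toL2p z) f)
      (hφm.mul (measurable_inner_toL2p f)).aestronglyMeasurable]
    refine integral_congr_ae ?_
    filter_upwards [coeFn_obs hZ hB f] with z h1
    simp only [T]
    rw [h1]
    simp [mul_comm]
  · rw [← hξsq, L2.inner_def, ← integral_map (φ := Z) hZ.aemeasurable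
      (f := fun z => ξ z ^ 2) (hφm.pow_const 2).aestronglyMeasurable]
    refine integral_congr_ae (Eventually.of_forall fun z => ?_)
    simp [sq]
  · have hB0 : 0 ≤ B := by
      obtain ⟨ω, hω⟩ := hB.exists
      exact (norm_nonneg _).trans hω
    -- ξ itself need not be of the form ⟨Z, f⟩, but its partial sums are. Continuous paths are dense
    -- and T is bounded by B, so f can then be replaced by a continuous g.
    obtain ⟨F, hF⟩ : ∃ F : Finset ℕ, dist (∑ k ∈ F, c k • e k) ξ < √ρ / 2 := by
      have := Metric.tendsto_nhds.mp (show Tendsto _ _ _ from hξ) (√ρ / 2) (by positivity)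
      exact this.exists
    let f : L2p p₁ p₂ := ∑ k ∈ F, c k • ((√(γ k))⁻¹ • v k)
    have hf : ∑ k ∈ F, c k • e k = T f := by simp [f, e, map_sum]
    obtain ⟨g, hg⟩ := exists_toL2p_near f (show 0 < √ρ / (2 * (B + 1)) by positivity)
    have hnorm : ‖ξ - T (toL2p g)‖ < √ρ := by
      have h1 : ‖T (f - toL2p g)‖ ≤ B * ‖f - toL2p g‖ := by
        refine abs_le_of_sq_le_sq' ?_ (by positivity) |>.2
        rw [← real_inner_self_eq_norm_sq, inner_obs, ← integral_inner_mul_inner hZ hB]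
        have : ∫ ω, inner ℝ (toL2p (Z ω)) (f - toL2p g) * inner ℝ (toL2p (Z ω)) (f - toL2p g) ∂P ≤
            ∫ _, (B * ‖f - toL2p g‖) ^ 2 ∂P := by
          refine integral_mono_of_nonneg (Eventually.of_forall fun ω => mul_self_nonneg _)
            (integrable_const _) ?_
          filter_upwards [hB] with ω hω
          rw [← sq, ← sq_abs]
          refine pow_le_pow_left₀ (abs_nonneg _) ((abs_real_inner_le_norm _ _).trans ?_) 2
          gcongr
        simpa using this
      have h2 : ‖ξ - T f‖ < √ρ / 2 := by rwa [← hf, ← dist_eq_norm, dist_comm]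
      have h3 : B * ‖f - toL2p g‖ ≤ √ρ / 2 := by
        calc B * ‖f - toL2p g‖ ≤ (B + 1) * (√ρ / (2 * (B + 1))) := by gcongr; linarith
          _ = √ρ / 2 := by field_simp
      calc ‖ξ - T (toL2p g)‖ = ‖(ξ - T f) + T (f - toL2p g)‖ := by rw [map_sub]; congr 1; abel
        _ ≤ ‖ξ - T f‖ + ‖T (f - toL2p g)‖ := norm_add_le _ _
        _ < √ρ := by linarith
    refine ⟨g, ?_⟩
    have h4 : ∫ ω, (ξ (Z ω) - inner ℝ (toL2p (Z ω)) (toL2p g)) ^ 2 ∂P =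
        ‖ξ - T (toL2p g)‖ ^ 2 := by
      rw [← real_inner_self_eq_norm_sq, L2.inner_def, ← integral_map (φ := Z) hZ.aemeasurable
        (f := fun z => (ξ z - inner ℝ (toL2p z) (toL2p g)) ^ 2)
        ((hφm.sub (measurable_inner_toL2p _)).pow_const 2).aestronglyMeasurable]
      refine integral_congr_ae ?_
      filter_upwards [coeFn_obs hZ hB (toL2p g), Lp.coeFn_sub ξ (T (toL2p g))] with z h1 h2
      rw [h2, Pi.sub_apply]
      simp only [T]
      rw [h1]
      simp [sq]
    rw [h4]
    calc ‖ξ - T (toL2p g)‖ ^ 2 < √ρ ^ 2 := pow_lt_pow_left₀ hnorm (norm_nonneg _) two_ne_zero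
      _ = ρ := Real.sq_sqrt hρ.le

end Representer


/-! ### The regression model in coordinates -/

section Coordinates

open Matrix

variable {Ω : Type*} {p₁ p₂ : ℕ} (D : Model Ω p₁ p₂) (S : Scheme)

/-- The vector of splines with given coefficients. -/
def splinePath (n : ℕ) (b : S.Idx p₁ p₂ n → ℝ) : Paths p₁ p₂ := fun j =>
  ⟨fun t => ∑ k, b (j, k) * S.ψ n k t, continuous_finsetSum _ fun k _ =>
    continuous_const.mul ((S.continuous_ψ n k).comp continuous_subtype_val)⟩

lemma splinePath_apply (n : ℕ) (b : S.Idx p₁ p₂ n → ℝ) (j : Pred p₁ p₂) (t : I) :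
    splinePath S n b j t = ∑ k, b (j, k) * S.ψ n k t := rfl

lemma integrable_mul_path {f : I → ℝ} (hf : Integrable f) (g : C(I, ℝ)) :
    Integrable fun t => f t * g t := by
  obtain ⟨A, hA⟩ := isCompact_univ.exists_bound_of_continuousOn (s := Set.univ) g.continuous.continuousOn
  exact hf.mul_bdd g.continuous.aestronglyMeasurable (Eventually.of_forall fun t => hA t trivial)

lemma integrable_path (z : C(I, ℝ)) : Integrable z (volume : Measure I) :=
  z.continuous.integrable_of_hasCompactSupport (HasCompactSupport.of_compactSpace z)

lemma integrable_L2p (x : L2p p₁ p₂) (j : Pred p₁ p₂) : Integrable (x j) (volume : Measure I) :=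
  (Lp.memLp (x j)).integrable one_le_two

/-- The integral of a function against a spline. -/
lemma sum_integral_mul_spline {n : ℕ} {f : Pred p₁ p₂ → I → ℝ} (hf : ∀ j, Integrable (f j))
    (b : S.Idx p₁ p₂ n → ℝ) :
    ∑ a : S.Idx p₁ p₂ n, b a * ∫ t : I, f a.1 t * S.ψ n a.2 t =
      ∑ j, ∫ t : I, f j t * splinePath S n b j t := by
  rw [Fintype.sum_prod_type]
  refine Finset.sum_congr rfl fun j _ => ?_
  have hint : ∀ k, Integrable fun t : I => f j t * S.ψ n k t := fun k =>
    integrable_mul_path (hf j) ⟨fun t : I => S.ψ n k t,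
      (S.continuous_ψ n k).comp continuous_subtype_val⟩
  simp_rw [splinePath_apply, Finset.mul_sum]
  rw [integral_finsetSum _ fun k _ => by
    simpa only [mul_left_comm] using (hint k).const_mul (b (j, k))]
  refine Finset.sum_congr rfl fun k _ => ?_
  rw [← integral_const_mul]
  refine integral_congr_ae (Eventually.of_forall fun t => ?_)
  simp only
  ring

/-- The exact design matrix. -/
def exactDesign (n : ℕ) (ω : Ω) : Matrix (Fin n) (S.Idx p₁ p₂ n) ℝ :=
  Matrix.of fun i => exactCoord D S n i ω

/-- Linear forms in the coordinates depend on b only through the spline it represents. The arguments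
can thus be carried out in L², without reference to the basis. -/
lemma sum_mul_exactCoord (n i : ℕ) (ω : Ω) (b : S.Idx p₁ p₂ n → ℝ) :
    ∑ a, b a * exactCoord D S n i ω a =
      inner ℝ (toL2p (D.Z i ω)) (toL2p (splinePath S n b)) := by
  rw [inner_toL2p_toL2p]
  exact sum_integral_mul_spline S (fun j => integrable_path (D.Z i ω j)) b

lemma exactDesign_mulVec (n : ℕ) (ω : Ω) (b : S.Idx p₁ p₂ n → ℝ) (i : Fin n) :
    (exactDesign D S n ω *ᵥ b) i =
      inner ℝ (toL2p (D.Z i ω)) (toL2p (splinePath S n b)) := by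
  rw [← sum_mul_exactCoord, mulVec, dotProduct]
  exact Finset.sum_congr rfl fun a _ => mul_comm _ _

lemma inner_L2p_toL2p (x : L2p p₁ p₂) (f : Paths p₁ p₂) :
    inner ℝ x (toL2p f) = ∑ j, ∫ t : I, x j t * f j t := by
  rw [real_inner_comm, inner_toL2p]
  simp_rw [mul_comm]

lemma dotProduct_w (x : L2p p₁ p₂) (n : ℕ) (b : S.Idx p₁ p₂ n → ℝ) :
    b ⬝ᵥ S.w x n = inner ℝ x (toL2p (splinePath S n b)) := by
  rw [inner_L2p_toL2p]
  exact sum_integral_mul_spline S (fun j => integrable_L2p x j) b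

lemma Psihat_eq (x : L2p p₁ p₂) (n : ℕ) (ω : Ω) :
    Psihat D S x n ω = bhat D S n ω ⬝ᵥ S.w x n := by
  rw [dotProduct_w, inner_L2p_toL2p, Psihat]
  simp_rw [mul_comm (x _ _)]
  rfl

/-- The coefficient functions as a vector of paths. -/
def betaPath (hβ : ∀ j, ContinuousOn (D.β j) (Set.Icc 0 1)) : Paths p₁ p₂ := fun j =>
  ⟨fun t => D.β j t, continuousOn_iff_continuous_domRestrict.mp (hβ j)⟩

lemma Psi_eq (hβ : ∀ j, ContinuousOn (D.β j) (Set.Icc 0 1)) (x : L2p p₁ p₂) :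
    Psi D x = inner ℝ x (toL2p (betaPath D hβ)) := by
  rw [inner_L2p_toL2p, Psi]
  simp_rw [mul_comm (x _ _)]
  rfl

lemma Y_eq (hβ : ∀ j, ContinuousOn (D.β j) (Set.Icc 0 1)) (i : ℕ) (ω : Ω) :
    D.Y i ω = inner ℝ (toL2p (D.Z i ω)) (toL2p (betaPath D hβ)) + D.ε i ω := by
  rw [inner_toL2p_toL2p, Model.Y]
  simp_rw [mul_comm (D.Z _ _ _ _)]
  rfl

/-! ### Coefficients of spline approximants -/

lemma exists_coeff_of_mem_splineSpace {n : ℕ} {g : Pred p₁ p₂ → ℝ → ℝ}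
    (hg : ∀ j, g j ∈ splineSpace S.q (S.κ n)) :
    ∃ b : S.Idx p₁ p₂ n → ℝ, ∀ j (t : I), splinePath S n b j t = g j t := by
  have : ∀ j, ∃ c : Fin (S.κ n + S.q) → ℝ, ∑ k, c k • S.ψ n k = g j := fun j => by
    have := hg j
    rw [← S.ψ_span n] at this
    exact (Submodule.mem_span_range_iff_exists_fun ℝ).mp this
  choose c hc using this
  refine ⟨fun a => c a.1 a.2, fun j t => ?_⟩
  rw [splinePath_apply, ← hc j]
  simp

lemma exists_splinePath_near {n : ℕ} {f : Paths p₁ p₂} {e : ℝ} (he : 0 ≤ e)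
    (h : ∀ j, ∃ g ∈ splineSpace S.q (S.κ n), ∀ t : I, |f j t - g t| ≤ e) :
    ∃ b : S.Idx p₁ p₂ n → ℝ, ‖f - splinePath S n b‖ ≤ e := by
  choose g hg hfg using h
  obtain ⟨b, hb⟩ := exists_coeff_of_mem_splineSpace S hg
  refine ⟨b, (pi_norm_le_iff_of_nonneg he).mpr fun j => (ContinuousMap.norm_le _ he).mpr fun t => ?_⟩
  simpa [hb] using hfg j t

lemma tendsto_κ (hK : Tendsto S.K atTop atTop) : Tendsto S.κ atTop atTop := by
  refine tendsto_atTop.mpr fun N => ?_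
  filter_upwards [tendsto_atTop.mp hK (N + S.q)] with n hn
  have : S.K n = S.κ n + S.q := rfl
  omega

/-- Every continuous path is a uniform limit of splines. -/
lemma exists_splinePath_tendsto (hq : 1 ≤ S.q) (hK : Tendsto S.K atTop atTop) (f : Paths p₁ p₂) :
    ∃ b : (n : ℕ) → S.Idx p₁ p₂ n → ℝ,
      Tendsto (fun n => ‖f - splinePath S n (b n)‖) atTop (𝓝 0) := by
  -- Near-best approximants give one sequence valid for every accuracy: for each ρ it is enough to
  -- exhibit some competitor b' for large n.
  have hbest : ∀ n, ∃ b : S.Idx p₁ p₂ n → ℝ, ∀ b' : S.Idx p₁ p₂ n → ℝ,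
      ‖f - splinePath S n b‖ ≤ ‖f - splinePath S n b'‖ + 1 / (n + 1) := fun n => by
    have hbdd : BddBelow (Set.range fun b' : S.Idx p₁ p₂ n → ℝ => ‖f - splinePath S n b'‖) :=
      ⟨0, by rintro _ ⟨b, rfl⟩; exact norm_nonneg _⟩
    obtain ⟨b, hb⟩ := exists_lt_of_ciInf_lt (show (⨅ b' : S.Idx p₁ p₂ n → ℝ,
      ‖f - splinePath S n b'‖) < (⨅ b' : S.Idx p₁ p₂ n → ℝ, ‖f - splinePath S n b'‖) +
        1 / ((n : ℝ) + 1) by linarith [Nat.one_div_pos_of_nat (α := ℝ) (n := n)])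
    exact ⟨b, fun b' => by linarith [ciInf_le hbdd b']⟩
  choose b hb using hbest
  refine ⟨b, ?_⟩
  rw [Metric.tendsto_atTop]
  intro ρ hρ
  -- An oscillation r leads to a spline error (q + 1) r = ρ/2, leaving ρ/2 for the defect 1/(n + 1).
  let r : ℝ := ρ / (2 * (S.q + 1))
  have hr : 0 < r := by positivity
  have hunif : ∃ d : ℝ, 0 < d ∧ ∀ j (t u : I), |(t : ℝ) - u| < d → |f j t - f j u| ≤ r := by
    have : ∀ j, ∃ d : ℝ, 0 < d ∧ ∀ t u : I, |(t : ℝ) - u| < d → |f j t - f j u| ≤ r := fun j => by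
      have h1 := CompactSpace.uniformContinuous_of_continuous (f j).continuous
      obtain ⟨d, hd, h⟩ := Metric.uniformContinuous_iff.mp h1 r hr
      exact ⟨d, hd, fun t u htu => (h (a := t) (b := u) htu).le⟩
    choose d hd h using this
    rcases isEmpty_or_nonempty (Pred p₁ p₂) with hE | hE
    · exact ⟨1, one_pos, fun j => hE.elim j⟩
    · refine ⟨Finset.univ.inf' Finset.univ_nonempty d, ?_, fun j t u htu => h j t u (htu.trans_le
        (Finset.inf'_le d (Finset.mem_univ j)))⟩
      rw [Finset.lt_inf'_iff]
      exact fun j _ => hd j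
  obtain ⟨d, hd, hunif⟩ := hunif
  have h1 : ∀ᶠ n in atTop, 1 / (S.κ n : ℝ) < d := by
    have := tendsto_one_div_atTop_nhds_zero_nat (𝕜 := ℝ) |>.comp (tendsto_κ S hK)
    exact this.eventually (gt_mem_nhds hd)
  have h2 : ∀ᶠ n : ℕ in atTop, 1 / ((n : ℝ) + 1) < ρ / 2 :=
    tendsto_one_div_add_atTop_nhds_zero_nat.eventually (gt_mem_nhds (by positivity))
  obtain ⟨N, hN⟩ := eventually_atTop.mp (h1.and h2)
  refine ⟨N, fun n hn => ?_⟩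
  obtain ⟨h1, h2⟩ := hN n hn
  obtain ⟨b', hb'⟩ := exists_splinePath_near S (n := n) (f := f) (e := ρ / 2) (by positivity)
    fun j => by
      obtain ⟨g, hg, hfg⟩ := exists_spline_near hq (S.κ_pos n) (W := r)
        (h := fun t => f j (Set.projIcc 0 1 zero_le_one t)) (fun t ht u hu htu => by
          rw [Set.projIcc_of_mem _ ht, Set.projIcc_of_mem _ hu]
          exact hunif j _ _ (htu.trans_lt h1))
      refine ⟨g, hg, fun t => ?_⟩
      have := hfg t t.2
      rw [Set.projIcc_val] at this
      refine this.trans (le_of_eq ?_)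
      simp only [r]
      field_simp
  rw [dist_zero_right, norm_norm]
  linarith [hb n b']

/-- Degree 0 would force s = 0, and then K^(-s) = 1 could not be o(n^(-1/2)). -/
lemma one_le_degree {s' : ℕ} {ν : ℝ≥0} (h1 : CondA1 D S s' ν) (hU : CondU S s' ν) : 1 ≤ S.q := by
  by_contra h
  have hq : S.q = 0 := by omega
  have hs : (s' : ℝ) + ν = 0 := by
    have := h1.degree
    rw [hq] at this
    have h2 : (0 : ℝ) ≤ (s' : ℝ) + ν := by positivity
    push_cast at this
    linarith
  have h4 := hU.u4
  simp only [hs, neg_zero, Real.rpow_zero] at h4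
  have h5 : Tendsto (fun n : ℕ => (n : ℝ) ^ (-(1 / 2) : ℝ)) atTop (𝓝 0) :=
    (tendsto_rpow_neg_atTop (by norm_num)).comp tendsto_natCast_atTop_atTop
  have h6 : Tendsto (fun _ : ℕ => (1 : ℝ)) atTop (𝓝 0) := h4.trans_tendsto h5
  exact one_ne_zero (tendsto_nhds_unique tendsto_const_nhds h6)

lemma continuousOn_beta {s' : ℕ} {ν : ℝ≥0} (h1 : CondA1 D S s' ν) (j : Pred p₁ p₂) :
    ContinuousOn (D.β j) (Set.Icc 0 1) := (h1.holder j).1.continuousOn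

/-- Undersmoothed spline approximation of the coefficient functions. -/
lemma exists_splinePath_beta {s' : ℕ} {ν : ℝ≥0} (h1 : CondA1 D S s' ν) (hU : CondU S s' ν) :
    ∃ b : (n : ℕ) → S.Idx p₁ p₂ n → ℝ, Tendsto (fun n : ℕ => √(n : ℝ) *
      ‖betaPath D (continuousOn_beta D S h1) - splinePath S n (b n)‖) atTop (𝓝 0) := by
  have hC : ∀ j, ∃ C : ℝ, ∀ κ : ℕ, 1 ≤ κ → ∃ g ∈ splineSpace S.q κ, ∀ t ∈ Set.Icc (0 : ℝ) 1,
      |D.β j t - g t| ≤ C * (κ : ℝ) ^ (-((s' : ℝ) + ν)) := fun j =>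
    (h1.holder j).exists_spline_approx h1.ν_le_one h1.degree
  choose C hC using hC
  let C' : ℝ := ∑ j, |C j|
  have hCC' : ∀ j, C j ≤ C' := fun j => (le_abs_self _).trans
    (Finset.single_le_sum (f := fun j => |C j|) (fun j _ => abs_nonneg _) (Finset.mem_univ j))
  have hC'0 : 0 ≤ C' := Finset.sum_nonneg fun j _ => abs_nonneg _
  have hb : ∀ n, ∃ b : S.Idx p₁ p₂ n → ℝ,
      ‖betaPath D (continuousOn_beta D S h1) - splinePath S n b‖ ≤
        C' * (S.κ n : ℝ) ^ (-((s' : ℝ) + ν)) := fun n => by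
    refine exists_splinePath_near S (by positivity) fun j => ?_
    obtain ⟨g, hg, hfg⟩ := hC j (S.κ n) (S.κ_pos n)
    exact ⟨g, hg, fun t => (hfg t t.2).trans (by gcongr; exact hCC' j)⟩
  choose b hb using hb
  refine ⟨b, ?_⟩
  -- The approximation rate is in the number κ of knot intervals, while (U4) is in K = κ + q ≤ (1 +
  -- q) κ.
  let A : ℝ := (1 + S.q : ℝ) ^ ((s' : ℝ) + ν)
  have hκK : ∀ n, (S.κ n : ℝ) ^ (-((s' : ℝ) + ν)) ≤ A * (S.K n : ℝ) ^ (-((s' : ℝ) + ν)) := fun n => by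
    have hκ : (1 : ℝ) ≤ S.κ n := by exact_mod_cast S.κ_pos n
    have hK : (S.K n : ℝ) ≤ (1 + S.q) * S.κ n := by
      have : (S.K n : ℝ) = S.κ n + S.q := by simp [Scheme.K]
      rw [this]
      nlinarith [Nat.cast_nonneg (α := ℝ) S.q]
    have hK0 : (0 : ℝ) < S.K n := by
      have : (S.K n : ℝ) = S.κ n + S.q := by simp [Scheme.K]
      rw [this]
      positivity
    have h2 : (S.K n : ℝ) ^ ((s' : ℝ) + ν) ≤ A * (S.κ n : ℝ) ^ ((s' : ℝ) + ν) := by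
      rw [← Real.mul_rpow (by positivity) (by positivity)]
      exact Real.rpow_le_rpow hK0.le hK (by positivity)
    rw [Real.rpow_neg (by positivity), Real.rpow_neg hK0.le, ← div_eq_mul_inv, inv_eq_one_div,
      div_le_div_iff₀ (by positivity) (by positivity)]
    linarith
  have h4 : Tendsto (fun n : ℕ => √(n : ℝ) * (S.K n : ℝ) ^ (-((s' : ℝ) + ν))) atTop (𝓝 0) := by
    have h5 := hU.u4.tendsto_div_nhds_zero
    refine h5.congr fun n => ?_
    rw [Real.sqrt_eq_rpow, Real.rpow_neg (Nat.cast_nonneg n) (1 / 2), div_inv_eq_mul, mul_comm]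
  have h5 := h4.const_mul (C' * A)
  rw [mul_zero] at h5
  refine squeeze_zero (fun n => by positivity) (fun n => ?_) h5
  calc √(n : ℝ) * ‖betaPath D (continuousOn_beta D S h1) - splinePath S n (b n)‖
      ≤ √(n : ℝ) * (C' * (A * (S.K n : ℝ) ^ (-((s' : ℝ) + ν)))) := by
        gcongr
        exact (hb n).trans (by gcongr; exact hκK n)
    _ = _ := by ring

lemma tendsto_K_div {s' : ℕ} {ν : ℝ≥0} (hU : CondU S s' ν) :
    Tendsto (fun n : ℕ => (S.K n : ℝ) / n) atTop (𝓝 0) := by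
  have h1 := hU.u1_isLittleO.tendsto_div_nhds_zero
  have h2 : Tendsto (fun n : ℕ => (n : ℝ) ^ (-(1 / 2) : ℝ)) atTop (𝓝 0) :=
    (tendsto_rpow_neg_atTop (by norm_num)).comp tendsto_natCast_atTop_atTop
  have h3 := h1.mul h2
  rw [mul_zero] at h3
  refine h3.congr' ?_
  filter_upwards [eventually_gt_atTop 0] with n hn
  have hn' : (0 : ℝ) < n := by exact_mod_cast hn
  have h4 : (n : ℝ) ^ (-(1 / 2) : ℝ) = ((n : ℝ) ^ (1 / 2 : ℝ))⁻¹ := Real.rpow_neg hn'.le _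
  rw [h4, ← div_eq_mul_inv, div_div, ← Real.rpow_add hn']
  norm_num

/-- λ K^(2m) is the product of λ / (n^(-1/2) K^(1-2m)) and K / n^(1/2), both of which tend to 0. The
exponent is an integer because 1 - 2m may have either sign. -/
lemma tendsto_lam {lam : ℕ → ℝ} {s' : ℕ} {ν : ℝ≥0} (hU : CondU S s' ν)
    (hlam : lam =o[atTop] fun n : ℕ => (n : ℝ) ^ (-(1 / 2) : ℝ) *
      (S.K n : ℝ) ^ (-(2 * (S.m : ℤ) - 1))) :
    Tendsto (fun n => lam n * (S.K n : ℝ) ^ (2 * S.m)) atTop (𝓝 0) := by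
  have h1 := hU.u1_isLittleO.tendsto_div_nhds_zero
  have h2 := hlam.tendsto_div_nhds_zero
  have h3 := h2.mul h1
  rw [mul_zero] at h3
  refine h3.congr' ?_
  filter_upwards [eventually_gt_atTop 0] with n hn
  have hn' : (0 : ℝ) < n := by exact_mod_cast hn
  have hK0 : (0 : ℝ) < S.K n := by
    have : (S.K n : ℝ) = S.κ n + S.q := by simp [Scheme.K]
    rw [this]
    have := S.κ_pos n
    positivity
  have h4 : (n : ℝ) ^ (-(1 / 2) : ℝ) = ((n : ℝ) ^ (1 / 2 : ℝ))⁻¹ := Real.rpow_neg hn'.le _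
  have h5 : (S.K n : ℝ) ^ (-(2 * (S.m : ℤ) - 1)) = S.K n / (S.K n : ℝ) ^ (2 * S.m) := by
    rw [show -(2 * (S.m : ℤ) - 1) = 1 - ((2 * S.m : ℕ) : ℤ) by push_cast; ring,
      zpow_sub₀ hK0.ne', zpow_one, zpow_natCast]
  have h6 : (n : ℝ) ^ (1 / 2 : ℝ) ≠ 0 := (Real.rpow_pos_of_pos hn' _).ne'
  rw [h4, h5]
  field_simp

/-- The roughness penalty of spline approximants vanishes. -/
lemma tendsto_penalty {s' : ℕ} {ν : ℝ≥0} (hU : CondU S s' ν) {f : Paths p₁ p₂}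
    {b : (n : ℕ) → S.Idx p₁ p₂ n → ℝ}
    (hb : Tendsto (fun n => ‖f - splinePath S n (b n)‖) atTop (𝓝 0)) :
    Tendsto (fun n => b n ⬝ᵥ (S.Rlam p₁ p₂ n *ᵥ b n)) atTop (𝓝 0) := by
  obtain ⟨C, hC0, hC⟩ := S.exists_quadForm_Rlam_le
  have hlam : ∀ j, Tendsto (fun n => S.lam p₁ p₂ n j * (S.K n : ℝ) ^ (2 * S.m)) atTop (𝓝 0) := by
    rintro (j | j)
    · exact tendsto_lam S hU hU.u2
    · exact tendsto_lam S hU hU.u3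
  have hlim : Tendsto (fun n => ∑ j : Pred p₁ p₂, (S.lam p₁ p₂ n j * (S.K n : ℝ) ^ (2 * S.m)) *
      (C * (‖f‖ + 1) ^ 2)) atTop (𝓝 0) := by
    have := tendsto_finsetSum Finset.univ fun (j : Pred p₁ p₂) _ =>
      (hlam j).mul_const (C * (‖f‖ + 1) ^ 2)
    simpa using this
  refine squeeze_zero' (Eventually.of_forall fun n =>
    PosSemidef.quadForm_nonneg (S.posSemidef_Rlam p₁ p₂ n) _) ?_ hlim
  filter_upwards [hb.eventually (gt_mem_nhds one_pos)] with n hn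
  refine (hC p₁ p₂ n (b n) (‖f‖ + 1) fun j t ht => ?_).trans
    (Finset.sum_le_sum fun j _ => ?_)
  · have h1 : ‖splinePath S n (b n)‖ ≤ ‖f‖ + 1 := by
      calc ‖splinePath S n (b n)‖ = ‖f - (f - splinePath S n (b n))‖ := by rw [sub_sub_cancel]
        _ ≤ _ := (norm_sub_le _ _).trans (by linarith)
    exact ((splinePath S n (b n) j).norm_coe_le_norm ⟨t, ht⟩).trans
      ((norm_le_pi_norm _ j).trans h1)
  · have hκK : (S.κ n : ℝ) ≤ S.K n := by simp [Scheme.K]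
    have := S.lam_nonneg p₁ p₂ n j
    calc S.lam p₁ p₂ n j * (C * (S.κ n : ℝ) ^ (2 * S.m) * (‖f‖ + 1) ^ 2)
        ≤ S.lam p₁ p₂ n j * (C * (S.K n : ℝ) ^ (2 * S.m) * (‖f‖ + 1) ^ 2) := by gcongr
      _ = _ := by ring

end Coordinates


/-! ### Events of large probability and moments of the design -/

section Moments

open Matrix

variable {Ω : Type*} [MeasurableSpace Ω] {p₁ p₂ : ℕ} {P : Measure Ω} [IsProbabilityMeasure P]
  {D : Model Ω p₁ p₂} {S : Scheme}

set_option linter.unusedSectionVars false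

/-- Two-sided bounds for the design as a quadratic form. -/
def GoodDesign (D : Model Ω p₁ p₂) (S : Scheme) (c C : ℝ) (n : ℕ) (ω : Ω) : Prop :=
  ∀ v : S.Idx p₁ p₂ n → ℝ, n * c * nrm v ^ 2 ≤ nrm (design D S n ω *ᵥ v) ^ 2 ∧
    nrm (design D S n ω *ᵥ v) ^ 2 ≤ n * C * nrm v ^ 2

lemma goodDesign_of_spectrum {c C : ℝ} {n : ℕ} (hn : 0 < n) {ω : Ω}
    (h : spectrum ℝ (Gn D S n ω) ⊆ Set.Icc c C) : GoodDesign D S c C n ω := by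
  have hn' : (0 : ℝ) < n := by exact_mod_cast hn
  intro v
  have hG : (Gn D S n ω).IsHermitian :=
    ((posSemidef_transpose_mul_self (design D S n ω)).smul (inv_nonneg.mpr hn'.le)).isHermitian
  obtain ⟨h1, h2⟩ := quadForm_mem_Icc_of_spectrum hG h v
  have h3 : v ⬝ᵥ (Gn D S n ω *ᵥ v) = (n : ℝ)⁻¹ * nrm (design D S n ω *ᵥ v) ^ 2 := by
    rw [Gn, smul_mulVec, dotProduct_smul, ← mulVec_mulVec, dotProduct_transpose_mulVec,
      nrm_sq_eq_dotProduct, smul_eq_mul]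
  rw [h3, inv_mul_eq_div] at h1 h2
  rw [le_div_iff₀ hn'] at h1
  rw [div_le_iff₀ hn'] at h2
  constructor <;> linarith

lemma GoodDesign.mono {c C C' : ℝ} (hC : C ≤ C') {n : ℕ} {ω : Ω} (h : GoodDesign D S c C n ω) :
    GoodDesign D S c C' n ω := fun v => ⟨(h v).1, (h v).2.trans (by gcongr)⟩

lemma CondA7.exists_good (h7 : CondA7 P D S) {δ : ℝ} (hδ : 0 < δ) :
    ∃ c C : ℝ, 0 < c ∧ 0 < C ∧
      ∀ᶠ n in atTop, P {ω | ¬ GoodDesign D S c C n ω} ≤ ENNReal.ofReal δ := by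
  obtain ⟨c, C, hc, h⟩ := h7 δ hδ
  refine ⟨c, max C 1, hc, by positivity, ?_⟩
  filter_upwards [h, eventually_gt_atTop 0] with n hn hn0
  refine (measure_mono fun ω hω => ?_).trans hn
  exact fun hsp => hω ((goodDesign_of_spectrum hn0 hsp).mono (le_max_left _ _))

lemma CondA3.exists_bound (h3 : CondA3 P D S) :
    ∃ B : ℝ, 0 ≤ B ∧ ∀ᵐ ω ∂P, ∀ i, ‖toL2p (D.Z i ω)‖ ≤ B := by
  obtain ⟨C, hC⟩ := h3.bounded
  refine ⟨embConst p₁ p₂ * |C|, mul_nonneg (embConst_nonneg _ _) (abs_nonneg _), ?_⟩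
  rw [ae_all_iff]
  intro i
  filter_upwards [hC i] with ω hω using norm_toL2p_le hω

/-- The pre-smoothing error. -/
def smoothErr (D : Model Ω p₁ p₂) (S : Scheme) (n : ℕ) (ω : Ω) : ℝ :=
  frob (design D S n ω - exactDesign D S n ω)

lemma smoothErr_nonneg (n : ℕ) (ω : Ω) : 0 ≤ smoothErr D S n ω := frob_nonneg _

lemma CondA3.tendsto_smoothErr (h3 : CondA3 P D S) :
    TendstoInMeasure P (smoothErr D S) atTop (fun _ => (0 : ℝ)) := by
  have := TendstoInMeasure.comp_continuousAt h3.presmoothing Real.continuous_sqrt.continuousAt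
  rw [Real.sqrt_zero] at this
  exact this

lemma nrm_le_sqrt_mul {n : ℕ} {u : Fin n → ℝ} {A : ℝ} (hA : 0 ≤ A) (hu : ∀ i, |u i| ≤ A) :
    nrm u ≤ √(n : ℝ) * A := by
  refine nrm_le_of_sq_le (by positivity) ?_
  rw [nrm_sq, mul_pow, Real.sq_sqrt (Nat.cast_nonneg n)]
  calc ∑ i, u i ^ 2 ≤ ∑ _i : Fin n, A ^ 2 := Finset.sum_le_sum fun i _ => by
        rw [← sq_abs]
        exact pow_le_pow_left₀ (abs_nonneg _) (hu i) 2
    _ = _ := by simp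

lemma norm_toL2p_le_norm (z : Paths p₁ p₂) : ‖toL2p z‖ ≤ embConst p₁ p₂ * ‖z‖ := by
  simpa using norm_toL2p_le (z := z) (A := ‖z‖) fun j => norm_le_pi_norm z j

/-- Coefficient vectors of convergent splines stay bounded. -/
lemma exists_coeff_bound (h3 : CondA3 P D S) (h7 : CondA7 P D S) {f : Paths p₁ p₂}
    {b : (n : ℕ) → S.Idx p₁ p₂ n → ℝ}
    (hb : Tendsto (fun n => ‖f - splinePath S n (b n)‖) atTop (𝓝 0)) :
    ∃ A L : ℝ, 0 ≤ A ∧ 0 ≤ L ∧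
      ∀ᶠ n in atTop, ‖toL2p (splinePath S n (b n))‖ ≤ A ∧ nrm (b n) ≤ L := by
  obtain ⟨c, C, hc, -, hgood⟩ := h7.exists_good (show (0 : ℝ) < 1 / 4 by norm_num)
  obtain ⟨B, hB0, hB⟩ := h3.exists_bound
  let A : ℝ := embConst p₁ p₂ * (‖f‖ + 1)
  have hA0 : 0 ≤ A := mul_nonneg (embConst_nonneg _ _) (by positivity)
  refine ⟨A, √(4 * (B * A) ^ 2 / c), hA0, Real.sqrt_nonneg _, ?_⟩
  filter_upwards [hgood, tendstoInMeasure_zero_iff.mp h3.tendsto_smoothErr (√c / 2) (by positivity)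
    (1 / 4) (by norm_num), eventually_gt_atTop 0, hb.eventually (gt_mem_nhds one_pos)] with
    n hn1 hn2 hn0 hn3
  have hn' : (1 : ℝ) ≤ n := by exact_mod_cast hn0
  have hA : ‖toL2p (splinePath S n (b n))‖ ≤ A := by
    refine (norm_toL2p_le_norm _).trans (mul_le_mul_of_nonneg_left ?_ (embConst_nonneg _ _))
    calc ‖splinePath S n (b n)‖ = ‖f - (f - splinePath S n (b n))‖ := by rw [sub_sub_cancel]
      _ ≤ _ := (norm_sub_le _ _).trans (by linarith)
  refine ⟨hA, ?_⟩
  -- The claim on b is deterministic, so a single favourable sample point is enough. It exists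
  -- because the bad events have total probability at most 1/4 + 1/4 < 1.
  obtain ⟨ω, h1, h2, h4⟩ : ∃ ω, GoodDesign D S c C n ω ∧ |smoothErr D S n ω| < √c / 2 ∧
      ∀ i, ‖toL2p (D.Z i ω)‖ ≤ B := by
    by_contra hcon
    push Not at hcon
    have h0 : P {ω | ¬ ∀ i, ‖toL2p (D.Z i ω)‖ ≤ B} ≤ ENNReal.ofReal 0 := by
      rw [ENNReal.ofReal_zero]
      exact (ae_iff.mp hB).le
    have h5 := measure_union_le_ofReal (by norm_num) (by norm_num) (subset_refl _) hn1 hn2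
    have h6 := measure_union_le_ofReal (E := Set.univ) (by norm_num) (by norm_num)
      (fun ω _ => by
        by_cases hg : GoodDesign D S c C n ω
        · by_cases hs : |smoothErr D S n ω| < √c / 2
          · right
            obtain ⟨i, hi⟩ := hcon ω hg hs
            exact fun hall => absurd (hall i) (not_le.mpr hi)
          · left; right
            exact not_lt.mp hs
        · left; left
          exact hg) h5 h0
    rw [measure_univ, ENNReal.one_le_ofReal] at h6
    norm_num at h6
  have h5 : nrm (exactDesign D S n ω *ᵥ b n) ≤ √(n : ℝ) * (B * A) := by
    refine nrm_le_sqrt_mul (by positivity) fun i => ?_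
    rw [exactDesign_mulVec]
    refine (abs_real_inner_le_norm _ _).trans ?_
    gcongr
    exact h4 i
  have h6 : nrm (design D S n ω *ᵥ b n) ≤
      √(n : ℝ) * (B * A) + smoothErr D S n ω * nrm (b n) := by
    have : design D S n ω *ᵥ b n = exactDesign D S n ω *ᵥ b n +
        (design D S n ω - exactDesign D S n ω) *ᵥ b n := by
      rw [sub_mulVec]
      abel
    rw [this]
    exact (nrm_add_le _ _).trans (add_le_add h5 (nrm_mulVec_le _ _))
  have h7 := (h1 (b n)).1
  rw [abs_of_nonneg (smoothErr_nonneg n ω)] at h2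
  have hsn : √(n : ℝ) ^ 2 = n := Real.sq_sqrt (by linarith)
  have hsc : √c ^ 2 = c := Real.sq_sqrt hc.le
  have hx : smoothErr D S n ω * nrm (b n) ≤ √c / 2 * nrm (b n) :=
    mul_le_mul_of_nonneg_right h2.le (nrm_nonneg _)
  have h8 : nrm (design D S n ω *ᵥ b n) ^ 2 ≤ 2 * (n * (B * A) ^ 2) + c / 2 * nrm (b n) ^ 2 := by
    have h9 : nrm (design D S n ω *ᵥ b n) ≤ √(n : ℝ) * (B * A) + √c / 2 * nrm (b n) := by linarith
    have h10 := pow_le_pow_left₀ (nrm_nonneg _) h9 2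
    -- The threshold √c / 2 leaves only c/2 times ‖b‖² from the pre-smoothing error, which is
    -- absorbed by the lower bound n c ‖b‖².
    have h11 : (√(n : ℝ) * (B * A) + √c / 2 * nrm (b n)) ^ 2 ≤
        2 * (√(n : ℝ) * (B * A)) ^ 2 + 2 * (√c / 2 * nrm (b n)) ^ 2 := by
      nlinarith [sq_nonneg (√(n : ℝ) * (B * A) - √c / 2 * nrm (b n))]
    rw [mul_pow (√(n : ℝ)), hsn, mul_pow (√c / 2), div_pow, hsc] at h11
    linarith
  refine nrm_le_of_sq_le (Real.sqrt_nonneg _) ?_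
  rw [Real.sq_sqrt (by positivity), le_div_iff₀ hc]
  have h12 : c / 2 * nrm (b n) ^ 2 ≤ n * (c / 2 * nrm (b n) ^ 2) :=
    le_mul_of_one_le_left (by positivity) hn'
  have h13 : (n : ℝ) * (nrm (b n) ^ 2 * c) ≤ n * (4 * (B * A) ^ 2) := by nlinarith
  exact le_of_mul_le_mul_left h13 (by linarith)

lemma exactCoord_eq (n i : ℕ) (ω : Ω) (a : S.Idx p₁ p₂ n) :
    exactCoord D S n i ω a =
      inner ℝ (toL2p (D.Z i ω)) (toL2p (splinePath S n (Pi.single a 1))) := by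
  rw [← sum_mul_exactCoord]
  simp [Pi.single_apply]

variable {B : ℝ}

lemma memLp_inner_Z (hs : RandomSample P D) (hB : ∀ᵐ ω ∂P, ∀ i, ‖toL2p (D.Z i ω)‖ ≤ B)
    (i : ℕ) (f : L2p p₁ p₂) : MemLp (fun ω => (inner ℝ (toL2p (D.Z i ω)) f : ℝ)) 2 P :=
  (memLp_inner_toL2p (hs.measurable_Z i) (by filter_upwards [hB] with ω hω using hω i)
    f).comp_of_map (hs.measurable_Z i).aemeasurable

lemma memLp_exactCoord (hs : RandomSample P D) (hB : ∀ᵐ ω ∂P, ∀ i, ‖toL2p (D.Z i ω)‖ ≤ B)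
    (n i : ℕ) (a : S.Idx p₁ p₂ n) : MemLp (fun ω => exactCoord D S n i ω a) 2 P := by
  simp_rw [exactCoord_eq]
  exact memLp_inner_Z hs hB i _

lemma identDistrib_Z (hs : RandomSample P D) (i : ℕ) :
    IdentDistrib (D.Z i) (D.Z 0) P P :=
  (hs.identDistrib i).comp measurable_fst

lemma integral_comp_Z (hs : RandomSample P D) {h : Paths p₁ p₂ → ℝ} (hh : Measurable h) (i : ℕ) :
    ∫ ω, h (D.Z i ω) ∂P = ∫ ω, h (D.Z 0 ω) ∂P :=
  ((identDistrib_Z hs i).comp hh).integral_eq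

/-- A vector of moments against the exact coordinates. -/
lemma nrm_moment_sq_le (hs : RandomSample P D) (hB : ∀ᵐ ω ∂P, ∀ i, ‖toL2p (D.Z i ω)‖ ≤ B)
    {n : ℕ} {C : ℝ} (hC0 : 0 < C) (hC : ∀ b : S.Idx p₁ p₂ n → ℝ,
      ∫ ω, (∑ a, b a * exactCoord D S n 0 ω a) ^ 2 ∂P ≤ C * ∑ a, b a ^ 2)
    {ψ : Ω → ℝ} (hψ : MemLp ψ 2 P) {u : S.Idx p₁ p₂ n → ℝ}
    (hu : ∀ a, u a = ∫ ω, exactCoord D S n 0 ω a * ψ ω ∂P) :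
    nrm u ^ 2 ≤ C * ∫ ω, ψ ω ^ 2 ∂P := by
  have hL : MemLp (fun ω => ∑ a, u a * exactCoord D S n 0 ω a) 2 P := by
    simp_rw [sum_mul_exactCoord]
    exact memLp_inner_Z hs hB 0 _
  have h1 : nrm u ^ 2 = ∫ ω, (∑ a, u a * exactCoord D S n 0 ω a) * ψ ω ∂P := by
    simp_rw [Finset.sum_mul]
    rw [integral_finsetSum _ fun a _ => ?_]
    · rw [nrm_sq]
      refine Finset.sum_congr rfl fun a _ => ?_
      simp_rw [mul_assoc]
      rw [integral_const_mul, ← hu a, sq]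
    · simp_rw [mul_assoc]
      exact ((memLp_exactCoord hs hB n 0 a).integrable_mul hψ).const_mul _
  -- Duality: u is tested against itself. The weights in Young's inequality are chosen so that the
  -- bound C‖u‖² on the quadratic form contributes exactly half of ‖u‖².
  have h2 : ∫ ω, (∑ a, u a * exactCoord D S n 0 ω a) * ψ ω ∂P ≤
      ∫ ω, ((2 * C)⁻¹ * (∑ a, u a * exactCoord D S n 0 ω a) ^ 2 + C / 2 * ψ ω ^ 2) ∂P := by
    refine integral_mono (hL.integrable_mul hψ) ((hL.integrable_sq.const_mul _).add
      (hψ.integrable_sq.const_mul _)) fun ω => ?_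
    set s := ∑ a, u a * exactCoord D S n 0 ω a
    have : 0 ≤ (2 * C)⁻¹ * (s - C * ψ ω) ^ 2 := by positivity
    have h3 : (2 * C)⁻¹ * (s - C * ψ ω) ^ 2 =
        (2 * C)⁻¹ * s ^ 2 + C / 2 * ψ ω ^ 2 - s * ψ ω := by
      field_simp
      ring
    simp only
    linarith
  rw [integral_add (hL.integrable_sq.const_mul _) (hψ.integrable_sq.const_mul _),
    integral_const_mul, integral_const_mul] at h2
  have h3 := hC u
  rw [← nrm_sq] at h3
  have h4 : (2 * C)⁻¹ * ∫ ω, (∑ a, u a * exactCoord D S n 0 ω a) ^ 2 ∂P ≤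
      (2 * C)⁻¹ * (C * nrm u ^ 2) := by gcongr
  have h5 : (2 * C)⁻¹ * (C * nrm u ^ 2) = nrm u ^ 2 / 2 := by field_simp
  linarith

lemma integral_exactCoord_sq_le {n : ℕ} {C : ℝ} (hC : ∀ b : S.Idx p₁ p₂ n → ℝ,
      ∫ ω, (∑ a, b a * exactCoord D S n 0 ω a) ^ 2 ∂P ≤ C * ∑ a, b a ^ 2) (a : S.Idx p₁ p₂ n) :
    ∫ ω, exactCoord D S n 0 ω a ^ 2 ∂P ≤ C := by
  have := hC (Pi.single a 1)
  have h1 : ∑ a', (Pi.single a 1 : S.Idx p₁ p₂ n → ℝ) a' ^ 2 = 1 := by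
    simp [Pi.single_apply, ite_pow]
  simp_rw [sum_mul_exactCoord] at this
  simp_rw [exactCoord_eq]
  rwa [h1, mul_one] at this

/-- Mean squared deviation of an empirical mean. -/
lemma integral_mean_sub_sq_le (hs : RandomSample P D) {h : Paths p₁ p₂ → ℝ} (hh : Measurable h)
    (hL : ∀ i, MemLp (fun ω => h (D.Z i ω)) 2 P) {n : ℕ} (hn : 0 < n) :
    Integrable (fun ω => ((n : ℝ)⁻¹ * ∑ i : Fin n, h (D.Z i ω) - ∫ ω, h (D.Z 0 ω) ∂P) ^ 2) P ∧
    ∫ ω, ((n : ℝ)⁻¹ * ∑ i : Fin n, h (D.Z i ω) - ∫ ω, h (D.Z 0 ω) ∂P) ^ 2 ∂P ≤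
      (n : ℝ)⁻¹ * ∫ ω, h (D.Z 0 ω) ^ 2 ∂P := by
  have hn' : (0 : ℝ) < n := by exact_mod_cast hn
  have hX : MemLp (fun ω => (n : ℝ)⁻¹ * ∑ i : Fin n, h (D.Z i ω)) 2 P :=
    (memLp_finsetSum _ fun (i : Fin n) _ => hL i).const_mul _
  have hmean : ∫ ω, (n : ℝ)⁻¹ * ∑ i : Fin n, h (D.Z i ω) ∂P = ∫ ω, h (D.Z 0 ω) ∂P := by
    rw [integral_const_mul, integral_finsetSum _ fun (i : Fin n) _ => (hL i).integrable one_le_two]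
    simp_rw [integral_comp_Z hs hh]
    simp
    field_simp
  have hvar : ∫ ω, ((n : ℝ)⁻¹ * ∑ i : Fin n, h (D.Z i ω) - ∫ ω, h (D.Z 0 ω) ∂P) ^ 2 ∂P =
      Var[fun ω => (n : ℝ)⁻¹ * ∑ i : Fin n, h (D.Z i ω); P] := by
    rw [variance_eq_integral hX.aemeasurable, hmean]
  refine ⟨(hX.sub (memLp_const _)).integrable_sq, ?_⟩
  rw [hvar, variance_const_mul]
  have hind : iIndepFun (fun i ω => h (D.Z i ω)) P :=
    hs.indep.comp (fun _ p => h p.1) fun _ => hh.comp measurable_fst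
  have hsum : Var[fun ω => ∑ i : Fin n, h (D.Z i ω); P] = ∑ i : Fin n, Var[fun ω => h (D.Z i ω); P] := by
    have := IndepFun.variance_sum (X := fun (i : Fin n) ω => h (D.Z i ω)) (s := Finset.univ) (μ := P)
      (fun i _ => hL i) fun i _ j _ hij => hind.indepFun (Fin.val_injective.ne hij)
    convert! this using 2
    funext ω
    simp
  have heq : ∀ i : Fin n, Var[fun ω => h (D.Z i ω); P] = Var[fun ω => h (D.Z 0 ω); P] := fun i =>
    ((identDistrib_Z hs i).comp hh).variance_eq
  have hle : Var[fun ω => h (D.Z 0 ω); P] ≤ ∫ ω, h (D.Z 0 ω) ^ 2 ∂P :=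
    variance_le_expectation_sq (hL 0).aestronglyMeasurable
  rw [hsum]
  simp_rw [heq]
  simp only [Finset.sum_const, Finset.card_univ, Fintype.card_fin, nsmul_eq_mul]
  calc (n : ℝ)⁻¹ ^ 2 * (n * Var[fun ω => h (D.Z 0 ω); P])
      = (n : ℝ)⁻¹ * Var[fun ω => h (D.Z 0 ω); P] := by field_simp
    _ ≤ _ := by gcongr

lemma card_idx (n : ℕ) : (Fintype.card (S.Idx p₁ p₂ n) : ℝ) = ((p₁ + p₂ : ℕ) : ℝ) * S.K n := by
  simp [Scheme.Idx, Scheme.K]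

/-- The empirical covariance of the coordinates along a fixed spline. -/
lemma integral_empirical_cov_sub_sq_le (hs : RandomSample P D)
    (hB : ∀ᵐ ω ∂P, ∀ i, ‖toL2p (D.Z i ω)‖ ≤ B)
    {n : ℕ} (hn : 0 < n) {C : ℝ} (hC : ∀ b : S.Idx p₁ p₂ n → ℝ,
      ∫ ω, (∑ a, b a * exactCoord D S n 0 ω a) ^ 2 ∂P ≤ C * ∑ a, b a ^ 2)
    {b : S.Idx p₁ p₂ n → ℝ} {A : ℝ} (hA : ‖toL2p (splinePath S n b)‖ ≤ A)
    {u : S.Idx p₁ p₂ n → ℝ} (hu : ∀ a, u a = ∫ ω, exactCoord D S n 0 ω a *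
      inner ℝ (toL2p (D.Z 0 ω)) (toL2p (splinePath S n b)) ∂P) :
    Integrable (fun ω => nrm ((n : ℝ)⁻¹ • ((exactDesign D S n ω)ᵀ *ᵥ (exactDesign D S n ω *ᵥ b)) - u)
      ^ 2) P ∧
    ∫ ω, nrm ((n : ℝ)⁻¹ • ((exactDesign D S n ω)ᵀ *ᵥ (exactDesign D S n ω *ᵥ b)) - u) ^ 2 ∂P ≤
      (B * A) ^ 2 * C * (((p₁ + p₂ : ℕ) : ℝ) * (S.K n / n)) := by
  have hn' : (0 : ℝ) < n := by exact_mod_cast hn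
  let h : S.Idx p₁ p₂ n → Paths p₁ p₂ → ℝ := fun a z =>
    inner ℝ (toL2p z) (toL2p (splinePath S n (Pi.single a 1))) *
      inner ℝ (toL2p z) (toL2p (splinePath S n b))
  have hh : ∀ a, Measurable (h a) := fun a =>
    (measurable_inner_toL2p _).mul (measurable_inner_toL2p _)
  have hbd : ∀ i, ∀ᵐ ω ∂P, |(inner ℝ (toL2p (D.Z i ω)) (toL2p (splinePath S n b)) : ℝ)| ≤ B * A :=
    fun i => by
      filter_upwards [hB] with ω hω
      have h0 := (norm_nonneg _).trans (hω i)
      exact (abs_real_inner_le_norm _ _).trans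
        (mul_le_mul (hω i) hA (norm_nonneg _) h0)
  have hL : ∀ a i, MemLp (fun ω => h a (D.Z i ω)) 2 P := fun a i => by
    refine MemLp.of_bound ((hh a).comp (hs.measurable_Z i)).aestronglyMeasurable
      (B * ‖toL2p (splinePath S n (Pi.single a 1 : S.Idx p₁ p₂ n → ℝ))‖ * (B * A)) ?_
    filter_upwards [hbd i, hB] with ω h1 h2
    have h0 := (norm_nonneg _).trans (h2 i)
    rw [Real.norm_eq_abs, abs_mul]
    refine mul_le_mul ((abs_real_inner_le_norm _ _).trans ?_) h1 (abs_nonneg _) (by positivity)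
    gcongr
    exact h2 i
  have hexp : ∀ ω, nrm ((n : ℝ)⁻¹ • ((exactDesign D S n ω)ᵀ *ᵥ (exactDesign D S n ω *ᵥ b)) - u) ^ 2 =
      ∑ a, ((n : ℝ)⁻¹ * ∑ i : Fin n, h a (D.Z i ω) - ∫ ω, h a (D.Z 0 ω) ∂P) ^ 2 := fun ω => by
    rw [nrm_sq]
    refine Finset.sum_congr rfl fun a _ => ?_
    have h1 : u a = ∫ ω, h a (D.Z 0 ω) ∂P := by
      rw [hu a]
      simp_rw [exactCoord_eq]
      rfl
    have h2 : ((exactDesign D S n ω)ᵀ *ᵥ (exactDesign D S n ω *ᵥ b)) a =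
        ∑ i : Fin n, h a (D.Z i ω) := by
      rw [mulVec, dotProduct]
      refine Finset.sum_congr rfl fun i _ => ?_
      rw [exactDesign_mulVec, transpose_apply]
      change exactCoord D S n i ω a * _ = _
      rw [exactCoord_eq]
    rw [Pi.sub_apply, Pi.smul_apply, h1, h2, smul_eq_mul]
  simp_rw [hexp]
  have key := fun a => integral_mean_sub_sq_le hs (hh a) (hL a) hn
  refine ⟨integrable_finsetSum _ fun a _ => (key a).1, ?_⟩
  rw [integral_finsetSum _ fun a _ => (key a).1]
  -- The factor along the fixed spline is bounded almost surely by BA, and the coordinate has second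
  -- moment at most C. Summing the variances of pK empirical means gives the rate K/n.
  have hterm : ∀ a, ∫ ω, h a (D.Z 0 ω) ^ 2 ∂P ≤ (B * A) ^ 2 * C := fun a => by
    calc ∫ ω, h a (D.Z 0 ω) ^ 2 ∂P ≤ ∫ ω, (B * A) ^ 2 * exactCoord D S n 0 ω a ^ 2 ∂P := by
          refine integral_mono_ae (hL a 0).integrable_sq
            ((memLp_exactCoord hs hB n 0 a).integrable_sq.const_mul _) ?_
          filter_upwards [hbd 0] with ω hω
          simp only [h, exactCoord_eq]
          rw [mul_pow, mul_comm]
          refine mul_le_mul_of_nonneg_right ?_ (sq_nonneg _)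
          rw [← sq_abs]
          exact pow_le_pow_left₀ (abs_nonneg _) hω 2
      _ ≤ _ := by
          rw [integral_const_mul]
          exact mul_le_mul_of_nonneg_left (integral_exactCoord_sq_le hC a) (sq_nonneg _)
  calc ∑ a, ∫ ω, ((n : ℝ)⁻¹ * ∑ i : Fin n, h a (D.Z i ω) - ∫ ω, h a (D.Z 0 ω) ∂P) ^ 2 ∂P
      ≤ ∑ _a : S.Idx p₁ p₂ n, (n : ℝ)⁻¹ * ((B * A) ^ 2 * C) :=
        Finset.sum_le_sum fun a _ => (key a).2.trans (by gcongr; exact hterm a)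
    _ = _ := by
        rw [Finset.sum_const, Finset.card_univ, nsmul_eq_mul, card_idx]
        field_simp

variable {σ2 : ℝ}

/-- The score of the exact design. -/
lemma integral_score_sq_le (hs : RandomSample P D) (h5 : CondA5 P D σ2)
    (hB : ∀ᵐ ω ∂P, ∀ i, ‖toL2p (D.Z i ω)‖ ≤ B)
    {n : ℕ} {C : ℝ} (hC : ∀ b : S.Idx p₁ p₂ n → ℝ,
      ∫ ω, (∑ a, b a * exactCoord D S n 0 ω a) ^ 2 ∂P ≤ C * ∑ a, b a ^ 2) :
    Integrable (fun ω => nrm ((exactDesign D S n ω)ᵀ *ᵥ fun i => D.ε i ω) ^ 2) P ∧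
    ∫ ω, nrm ((exactDesign D S n ω)ᵀ *ᵥ fun i => D.ε i ω) ^ 2 ∂P ≤
      σ2 * (n * C * (((p₁ + p₂ : ℕ) : ℝ) * S.K n)) := by
  let d : S.Idx p₁ p₂ n → Fin n → (Fin n → Paths p₁ p₂) → ℝ := fun a i z =>
    inner ℝ (toL2p (z i)) (toL2p (splinePath S n (Pi.single a 1)))
  have hd : ∀ a i, Measurable (d a i) := fun a i =>
    (measurable_inner_toL2p _).comp (measurable_pi_apply i)
  have hdU : ∀ a i ω, d a i (D.Zvec n ω) = exactCoord D S n i ω a := fun a i ω =>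
    (exactCoord_eq n i ω a).symm
  have hb : ∀ a, ∀ᵐ ω ∂P, ∀ i, |d a i (D.Zvec n ω)| ≤
      B * ‖toL2p (splinePath S n (Pi.single a 1 : S.Idx p₁ p₂ n → ℝ))‖ := fun a => by
    filter_upwards [hB] with ω hω i
    refine (abs_real_inner_le_norm _ _).trans ?_
    gcongr
    exact hω i
  have key := fun a => h5.integral_sum_mul_sq hs (hd a) (hb a)
  have hexp : ∀ ω, nrm ((exactDesign D S n ω)ᵀ *ᵥ fun i => D.ε i ω) ^ 2 =
      ∑ a, (∑ i, d a i (D.Zvec n ω) * D.ε i ω) ^ 2 := fun ω => by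
    rw [nrm_sq]
    refine Finset.sum_congr rfl fun a _ => ?_
    simp_rw [hdU]
    rfl
  simp_rw [hexp]
  refine ⟨integrable_finsetSum _ fun a _ => (key a).1, ?_⟩
  rw [integral_finsetSum _ fun a _ => (key a).1]
  have hterm : ∀ a, ∫ ω, ∑ i, d a i (D.Zvec n ω) ^ 2 ∂P ≤ n * C := fun a => by
    simp_rw [hdU]
    rw [integral_finsetSum _ fun (i : Fin n) _ => (memLp_exactCoord hs hB n i a).integrable_sq]
    have : ∀ i : Fin n, ∫ ω, exactCoord D S n i ω a ^ 2 ∂P ≤ C := fun i => by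
      have h1 := integral_comp_Z hs (h := fun z => (inner ℝ (toL2p z) (toL2p (splinePath S n
        (Pi.single a 1 : S.Idx p₁ p₂ n → ℝ)))) ^ 2)
        ((measurable_inner_toL2p _).pow_const 2) i
      have h2 := integral_exactCoord_sq_le hC a
      simp_rw [exactCoord_eq] at h2 ⊢
      exact h1.trans_le h2
    calc _ ≤ ∑ _i : Fin n, C := Finset.sum_le_sum fun i _ => this i
      _ = n * C := by simp
  calc ∑ a, ∫ ω, (∑ i, d a i (D.Zvec n ω) * D.ε i ω) ^ 2 ∂P
      ≤ ∑ _a : S.Idx p₁ p₂ n, σ2 * (n * C) := Finset.sum_le_sum fun a _ => by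
        rw [(key a).2]
        exact mul_le_mul_of_nonneg_left (hterm a) h5.nonneg
    _ = _ := by
        rw [Finset.sum_const, Finset.card_univ, nsmul_eq_mul, card_idx]
        ring

end Moments


/-! ### Measurability of the estimator -/

section Measurability

open Matrix

variable {α J ι : Type*} [MeasurableSpace α] [Fintype J]

lemma measurable_mulVec_entry {A : α → Matrix ι J ℝ} (hA : ∀ i j, Measurable fun z => A z i j)
    {v : α → J → ℝ} (hv : ∀ j, Measurable fun z => v z j) (i : ι) :
    Measurable fun z => (A z *ᵥ v z) i :=
  Finset.measurable_fun_sum _ fun j _ => (hA i j).mul (hv j)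

lemma measurable_mul_entry {κ : Type*} {A : α → Matrix ι J ℝ} {B : α → Matrix J κ ℝ}
    (hA : ∀ i j, Measurable fun z => A z i j) (hB : ∀ i j, Measurable fun z => B z i j)
    (i : ι) (k : κ) : Measurable fun z => (A z * B z) i k :=
  Finset.measurable_fun_sum _ fun j _ => (hA i j).mul (hB j k)

variable [DecidableEq J]

lemma measurable_det {A : α → Matrix J J ℝ} (hA : ∀ i j, Measurable fun z => A z i j) :
    Measurable fun z => (A z).det := by
  simp_rw [det_apply]
  exact Finset.measurable_fun_sum _ fun τ _ =>
    (Finset.measurable_fun_prod _ fun i _ => hA _ _).const_smul _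

/-- The adjugate formula, with the convention for the inverse of 0, is measurable also on the set of
singular matrices. -/
lemma measurable_inv_entry {A : α → Matrix J J ℝ} (hA : ∀ i j, Measurable fun z => A z i j)
    (i j : J) : Measurable fun z => (A z)⁻¹ i j := by
  simp_rw [inv_def, Matrix.smul_apply, Ring.inverse_eq_inv', adjugate_apply]
  refine (measurable_det hA).inv.mul (measurable_det fun k l => ?_)
  simp_rw [updateRow_apply]
  split_ifs
  · exact measurable_const
  · exact hA k l

variable {Ω : Type*} {p₁ p₂ : ℕ} (D : Model Ω p₁ p₂) (S : Scheme)

/-- The design matrix as a function of the curves. -/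
def designOf (n : ℕ) (z : Fin n → Paths p₁ p₂) : Matrix (Fin n) (S.Idx p₁ p₂ n) ℝ :=
  Matrix.of fun i a => S.smooth n (fun l => z i a.1 (S.grid n l)) a.2

lemma measurable_designOf (n : ℕ) (i : Fin n) (a : S.Idx p₁ p₂ n) :
    Measurable fun z => designOf S n z i a := by
  refine (measurable_pi_apply a.2).comp ((S.smooth_measurable n).comp
    (measurable_pi_lambda _ fun l => ?_))
  have h1 : Measurable fun f : C(I, ℝ) => f (S.grid n l) :=
    (ContinuousEvalConst.continuous_eval_const _).measurable
  exact h1.comp ((measurable_pi_apply a.1).comp (measurable_pi_apply i))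

lemma measurable_ridge_entry (n : ℕ) (a b : S.Idx p₁ p₂ n) :
    Measurable fun z : Fin n → Paths p₁ p₂ =>
      ((designOf S n z)ᵀ * designOf S n z + S.Rlam p₁ p₂ n)⁻¹ a b :=
  measurable_inv_entry (A := fun z : Fin n → Paths p₁ p₂ =>
      (designOf S n z)ᵀ * designOf S n z + S.Rlam p₁ p₂ n)
    (fun k l => (measurable_mul_entry (A := fun z => (designOf S n z)ᵀ)
      (fun i j => measurable_designOf S n j i) (measurable_designOf S n) k l).add
      (measurable_const (a := S.Rlam p₁ p₂ n k l))) a b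

/-- The weights of the errors in `n (Ψ̂_n(x) - Ψ(x))`, as functions of the curves. -/
def weightOf (x : L2p p₁ p₂) (n : ℕ) (z : Fin n → Paths p₁ p₂) : Fin n → ℝ :=
  (n : ℝ) • (designOf S n z *ᵥ
    (((designOf S n z)ᵀ * designOf S n z + S.Rlam p₁ p₂ n)⁻¹ *ᵥ S.w x n))

lemma measurable_weightOf (x : L2p p₁ p₂) (n : ℕ) (i : Fin n) :
    Measurable fun z => weightOf S x n z i :=
  (measurable_mulVec_entry (measurable_designOf S n) (fun a => measurable_mulVec_entry
    (measurable_ridge_entry S n) (v := fun _ => S.w x n) (fun _ => measurable_const) a)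
    i).const_mul (n : ℝ)

variable {D S}

lemma measurable_Psihat [MeasurableSpace Ω] {P : Measure Ω} [IsProbabilityMeasure P] (hs : RandomSample P D)
    (hβ : ∀ j, ContinuousOn (D.β j) (Set.Icc 0 1)) (x : L2p p₁ p₂) (n : ℕ) :
    Measurable (Psihat D S x n) := by
  have hY : ∀ i, Measurable (D.Y i) := fun i => by
    have : D.Y i = fun ω => inner ℝ (toL2p (D.Z i ω)) (toL2p (betaPath D hβ)) + D.ε i ω :=
      funext (Y_eq D hβ i)
    rw [this]
    exact ((measurable_inner_toL2p _).comp (hs.measurable_Z i)).add (hs.measurable_ε i)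
  have hZ : ∀ i a, Measurable fun ω => design D S n ω i a := fun i a =>
    (measurable_designOf S n i a).comp (hs.measurable_Zvec n)
  have hb : ∀ a, Measurable fun ω => bhat D S n ω a := fun a =>
    measurable_mulVec_entry
      (A := fun ω => ((design D S n ω)ᵀ * design D S n ω + S.Rlam p₁ p₂ n)⁻¹)
      (v := fun ω => (design D S n ω)ᵀ *ᵥ yvec D n ω)
      (fun k l => (measurable_ridge_entry S n k l).comp (hs.measurable_Zvec n))
      (fun k => measurable_mulVec_entry (A := fun ω => (design D S n ω)ᵀ)
        (v := fun ω => yvec D n ω) (fun i j => hZ j i) (fun i => hY i) k) a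
  have : Psihat D S x n = fun ω => ∑ a, bhat D S n ω a * S.w x n a :=
    funext fun ω => Psihat_eq D S x n ω
  rw [this]
  exact Finset.measurable_fun_sum _ fun a _ => (hb a).mul measurable_const

end Measurability

/-! ### Error decompositions of ridge estimators -/

section Decomposition

open Matrix

variable {ι J : Type*} [Fintype ι] [Fintype J] [DecidableEq J] {Z : Matrix ι J ℝ}
  {R : Matrix J J ℝ} {c : ℝ}

lemma ridge_left_solve (hR : R.PosSemidef) (hc : 0 < c)
    (hZ : ∀ v, c * nrm v ^ 2 ≤ nrm (Z *ᵥ v) ^ 2) (b : J → ℝ) :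
    (Zᵀ * Z + R)⁻¹ *ᵥ ((Zᵀ * Z + R) *ᵥ b) = b := by
  rw [mulVec_mulVec, nonsing_inv_mul _ (ridge_isUnit_det hR hc hZ), one_mulVec]

/-- Pairing with the solution of a ridge system. -/
lemma ridge_dotProduct_inv (hR : R.PosSemidef) (hc : 0 < c)
    (hZ : ∀ v, c * nrm v ^ 2 ≤ nrm (Z *ᵥ v) ^ 2) (w g : J → ℝ) :
    w ⬝ᵥ ((Zᵀ * Z + R)⁻¹ *ᵥ g) = ((Zᵀ * Z + R)⁻¹ *ᵥ w) ⬝ᵥ g := by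
  have h1 := PosSemidef.dotProduct_mulVec_comm ((posSemidef_transpose_mul_self Z).add hR)
    ((Zᵀ * Z + R)⁻¹ *ᵥ w) ((Zᵀ * Z + R)⁻¹ *ᵥ g)
  rw [ridge_solve hR hc hZ, ridge_solve hR hc hZ] at h1
  rw [h1, dotProduct_comm]

/-- The error of a linear functional of the ridge estimator. -/
lemma ridge_functional_error (hR : R.PosSemidef) (hc : 0 < c)
    (hZ : ∀ v, c * nrm v ^ 2 ≤ nrm (Z *ᵥ v) ^ 2) (w b : J → ℝ) (e : ι → ℝ) :
    ((Zᵀ * Z + R)⁻¹ *ᵥ (Zᵀ *ᵥ (Z *ᵥ b + e))) ⬝ᵥ w - b ⬝ᵥ w =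
      (Z *ᵥ ((Zᵀ * Z + R)⁻¹ *ᵥ w)) ⬝ᵥ e - ((Zᵀ * Z + R)⁻¹ *ᵥ w) ⬝ᵥ (R *ᵥ b) := by
  -- Adding and subtracting Rb makes b itself come out of the ridge inverse; the error is what the
  -- inverse does to Zᵀe - Rb.
  have h1 : Zᵀ *ᵥ (Z *ᵥ b + e) = (Zᵀ * Z + R) *ᵥ b + (Zᵀ *ᵥ e - R *ᵥ b) := by
    rw [mulVec_add, add_mulVec, mulVec_mulVec]
    abel
  rw [h1, mulVec_add, ridge_left_solve hR hc hZ, add_dotProduct, add_sub_cancel_left,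
    dotProduct_comm, ridge_dotProduct_inv hR hc hZ, dotProduct_sub, dotProduct_transpose_mulVec,
    dotProduct_comm e]

/-- The residuals of the ridge estimator. -/
lemma ridge_residual_sub_le (hR : R.PosSemidef) (hc : 0 < c)
    (hZ : ∀ v, c * nrm v ^ 2 ≤ nrm (Z *ᵥ v) ^ 2) (b : J → ℝ) (r e : ι → ℝ) :
    nrm ((Z *ᵥ b + (r + e)) - Z *ᵥ ((Zᵀ * Z + R)⁻¹ *ᵥ (Zᵀ *ᵥ (Z *ᵥ b + (r + e)))) - e) ≤
      2 * nrm r + nrm (Zᵀ *ᵥ e) / √c + √(b ⬝ᵥ (R *ᵥ b)) := by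
  have h1 : Zᵀ *ᵥ (Z *ᵥ b + (r + e)) =
      (Zᵀ * Z + R) *ᵥ b + (Zᵀ *ᵥ r + Zᵀ *ᵥ e - R *ᵥ b) := by
    rw [mulVec_add, add_mulVec, mulVec_mulVec, mulVec_add]
    abel
  have h2 := ridge_fit_response_le hR (ridge_solve hR hc hZ (Zᵀ *ᵥ r))
  have h3 := ridge_fit_le hR hc hZ (ridge_solve hR hc hZ (Zᵀ *ᵥ e))
  have h4 := ridge_fit_penalty_le hR (ridge_solve hR hc hZ (R *ᵥ b))
  rw [h1, mulVec_add (Zᵀ * Z + R)⁻¹, ridge_left_solve hR hc hZ, mulVec_sub (Zᵀ * Z + R)⁻¹,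
    mulVec_add (Zᵀ * Z + R)⁻¹]
  set h₁ := (Zᵀ * Z + R)⁻¹ *ᵥ (Zᵀ *ᵥ r)
  set h₂ := (Zᵀ * Z + R)⁻¹ *ᵥ (Zᵀ *ᵥ e)
  set h₃ := (Zᵀ * Z + R)⁻¹ *ᵥ (R *ᵥ b)
  have h5 : Z *ᵥ b + (r + e) - Z *ᵥ (b + (h₁ + h₂ - h₃)) - e =
      r - Z *ᵥ h₁ - Z *ᵥ h₂ + Z *ᵥ h₃ := by
    simp only [mulVec_add, mulVec_sub]
    abel
  rw [h5]
  have h6 := nrm_add_le (r - Z *ᵥ h₁ - Z *ᵥ h₂) (Z *ᵥ h₃)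
  have h7 := nrm_sub_le (r - Z *ᵥ h₁) (Z *ᵥ h₂)
  have h8 := nrm_sub_le r (Z *ᵥ h₁)
  linarith

/-- The ridge weights against a fit. -/
lemma ridge_weight_sub_le (hR : R.PosSemidef) (hc : 0 < c)
    (hZ : ∀ v, c * nrm v ^ 2 ≤ nrm (Z *ᵥ v) ^ 2) (N : ℝ) (w b : J → ℝ) :
    nrm (N • (Z *ᵥ ((Zᵀ * Z + R)⁻¹ *ᵥ w)) - Z *ᵥ b) ≤
      nrm (N • w - Zᵀ *ᵥ (Z *ᵥ b)) / √c + √(b ⬝ᵥ (R *ᵥ b)) := by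
  have h3 := ridge_fit_le hR hc hZ (ridge_solve hR hc hZ (N • w - Zᵀ *ᵥ (Z *ᵥ b)))
  have h4 := ridge_fit_penalty_le hR (ridge_solve hR hc hZ (R *ᵥ b))
  have h5 : N • (Z *ᵥ ((Zᵀ * Z + R)⁻¹ *ᵥ w)) - Z *ᵥ b =
      Z *ᵥ ((Zᵀ * Z + R)⁻¹ *ᵥ (N • w - Zᵀ *ᵥ (Z *ᵥ b))) -
        Z *ᵥ ((Zᵀ * Z + R)⁻¹ *ᵥ (R *ᵥ b)) := by
    -- Once b is written as the solution of its own ridge system, the difference splits into a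
    -- general right-hand side, bounded with 1/√c, and a multiple of R, bounded by the penalty
    -- alone.
    conv_lhs => rw [← ridge_left_solve hR hc hZ b]
    rw [← mulVec_smul, ← mulVec_smul, ← mulVec_sub, ← mulVec_sub, ← mulVec_sub, ← mulVec_sub,
      add_mulVec, ← mulVec_mulVec b, sub_add_eq_sub_sub]
  rw [h5]
  exact (nrm_sub_le _ _).trans (add_le_add h3 h4)

/-- The sandwich form of the ridge weights. -/
lemma ridge_sandwich (hR : R.PosSemidef) (hc : 0 < c)
    (hZ : ∀ v, c * nrm v ^ 2 ≤ nrm (Z *ᵥ v) ^ 2) {N : ℝ} (hN : 0 < N) (w : J → ℝ) :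
    w ⬝ᵥ (((N⁻¹ • (Zᵀ * Z) + N⁻¹ • R)⁻¹ * (N⁻¹ • (Zᵀ * Z)) *
      (N⁻¹ • (Zᵀ * Z) + N⁻¹ • R)⁻¹) *ᵥ w) =
      nrm (N • (Z *ᵥ ((Zᵀ * Z + R)⁻¹ *ᵥ w))) ^ 2 / N := by
  have hinv : (N⁻¹ • (Zᵀ * Z) + N⁻¹ • R)⁻¹ = N • (Zᵀ * Z + R)⁻¹ := by
    rw [← smul_add]
    refine inv_eq_right_inv ?_
    rw [smul_mul_smul_comm, inv_mul_cancel₀ hN.ne', one_smul,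
      mul_nonsing_inv _ (ridge_isUnit_det hR hc hZ)]
  rw [hinv]
  simp only [← mulVec_mulVec, smul_mulVec, mulVec_smul, dotProduct_smul, smul_eq_mul]
  rw [ridge_dotProduct_inv hR hc hZ, dotProduct_transpose_mulVec, ← nrm_sq_eq_dotProduct, nrm_smul,
    mul_pow, sq_abs]
  field_simp

end Decomposition


/-! ### The weights of the errors -/

section Weights

open Matrix

variable {Ω : Type*} [MeasurableSpace Ω] {p₁ p₂ : ℕ} {P : Measure Ω} [IsProbabilityMeasure P]
  {D : Model Ω p₁ p₂} {S : Scheme} {x : L2p p₁ p₂} {B : ℝ} {φ : Paths p₁ p₂ → ℝ}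

set_option linter.unusedSectionVars false

/-- The sandwich variance is the empirical second moment of the same weights that multiply the
errors, so one limit serves both the normal law and the variance estimator. -/
lemma wVw_eq {c C : ℝ} (hc : 0 < c) {n : ℕ} (hn : 0 < n) {ω : Ω} (h : GoodDesign D S c C n ω) :
    wVw D S x n ω = nrm (weightOf S x n (D.Zvec n ω)) ^ 2 / n := by
  have hn' : (0 : ℝ) < n := by exact_mod_cast hn
  exact ridge_sandwich (S.posSemidef_Rlam p₁ p₂ n) (mul_pos hn' hc) (fun v => (h v).1) hn' (S.w x n)

/-- The deviation of the weights from given numbers `ξ`, through a spline with coefficients `b`. -/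
lemma nrm_weight_sub_le {c C : ℝ} (hc : 0 < c) (hC : 0 < C) {n : ℕ} (hn : 0 < n) {ω : Ω}
    (h : GoodDesign D S c C n ω) (hB : ∀ i, ‖toL2p (D.Z i ω)‖ ≤ B) {b : S.Idx p₁ p₂ n → ℝ} {A L : ℝ}
    (hA : ‖toL2p (splinePath S n b)‖ ≤ A) (hL : nrm b ≤ L) (u : S.Idx p₁ p₂ n → ℝ)
    (ξ : Fin n → ℝ) :
    nrm (weightOf S x n (D.Zvec n ω) - ξ) / √(n : ℝ) ≤ ((1 + √C) / √c + 1) *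
      (nrm (S.w x n - u) +
        (nrm ((n : ℝ)⁻¹ • ((exactDesign D S n ω)ᵀ *ᵥ (exactDesign D S n ω *ᵥ b)) - u) +
          smoothErr D S n ω * (B * A + L) + √(b ⬝ᵥ (S.Rlam p₁ p₂ n *ᵥ b))) +
        nrm (exactDesign D S n ω *ᵥ b - ξ) / √(n : ℝ)) := by
  have hn' : (1 : ℝ) ≤ n := by exact_mod_cast hn
  have hn0 : (0 : ℝ) < n := by linarith
  have hB0 : 0 ≤ B := (norm_nonneg _).trans (hB 0)
  have hA0 : 0 ≤ A := (norm_nonneg _).trans hA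
  have hL0 : 0 ≤ L := (nrm_nonneg _).trans hL
  have hF0 := smoothErr_nonneg (D := D) (S := S) n ω
  have hs1 : 1 ≤ √(n : ℝ) := Real.one_le_sqrt.mpr hn'
  have hss : √(n : ℝ) * √(n : ℝ) = n := Real.mul_self_sqrt hn0.le
  have hsc : 0 < √c := Real.sqrt_pos.mpr hc
  have hsC := Real.sqrt_nonneg C
  have hw := ridge_weight_sub_le (S.posSemidef_Rlam p₁ p₂ n) (mul_pos hn0 hc) (fun v => (h v).1) n
    (S.w x n) b
  change nrm (weightOf S x n (D.Zvec n ω) - design D S n ω *ᵥ b) ≤ _ at hw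
  have hZU : nrm (design D S n ω *ᵥ b - exactDesign D S n ω *ᵥ b) ≤ smoothErr D S n ω * L := by
    rw [← sub_mulVec]
    exact (nrm_mulVec_le _ _).trans (mul_le_mul_of_nonneg_left hL hF0)
  have hU : nrm (exactDesign D S n ω *ᵥ b) ≤ √(n : ℝ) * (B * A) := by
    refine nrm_le_sqrt_mul (by positivity) fun i => ?_
    rw [exactDesign_mulVec]
    refine (abs_real_inner_le_norm _ _).trans ?_
    gcongr
    exact hB i
  have hcov : nrm ((design D S n ω - exactDesign D S n ω)ᵀ *ᵥ (exactDesign D S n ω *ᵥ b)) ≤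
      smoothErr D S n ω * (√(n : ℝ) * (B * A)) :=
    (nrm_transpose_mulVec_le_frob _ _).trans (mul_le_mul_of_nonneg_left hU hF0)
  have hcov' : nrm ((design D S n ω)ᵀ *ᵥ (design D S n ω *ᵥ b - exactDesign D S n ω *ᵥ b)) ≤
      √(n : ℝ) * √C * (smoothErr D S n ω * L) := by
    refine nrm_le_of_sq_le (by positivity) ?_
    refine (nrm_transpose_mulVec_sq_le (mul_pos hn0 hC) (fun v => (h v).2) _).trans ?_
    rw [mul_pow (√(n : ℝ) * √C), mul_pow (√(n : ℝ)), Real.sq_sqrt hn0.le, Real.sq_sqrt hC.le]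
    gcongr
    exact nrm_nonneg _
  set w := S.w x n
  set Z := design D S n ω
  set U := exactDesign D S n ω
  set F := smoothErr D S n ω
  set a := weightOf S x n (D.Zvec n ω)
  set t := nrm ((n : ℝ)⁻¹ • (Uᵀ *ᵥ (U *ᵥ b)) - u)
  set r := √(b ⬝ᵥ (S.Rlam p₁ p₂ n *ᵥ b))
  have hr0 : 0 ≤ r := Real.sqrt_nonneg _
  have ht0 : 0 ≤ t := nrm_nonneg _
  -- u stands for a population moment vector and is compared with w and with the exact empirical
  -- covariance. Replacing the exact design U by Z costs (Z - U)ᵀUb and Zᵀ(Zb - Ub), both of order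
  -- √n times the pre-smoothing error, which is small against n.
  have hsplit : (n : ℝ) • w - Zᵀ *ᵥ (Z *ᵥ b) =
      (n : ℝ) • ((w - u) - ((n : ℝ)⁻¹ • (Uᵀ *ᵥ (U *ᵥ b)) - u)) -
        ((Z - U)ᵀ *ᵥ (U *ᵥ b) + Zᵀ *ᵥ (Z *ᵥ b - U *ᵥ b)) := by
    rw [transpose_sub, sub_mulVec, mulVec_sub, smul_sub, smul_sub, smul_sub, smul_smul,
      mul_inv_cancel₀ hn0.ne', one_smul]
    abel
  have hnum : nrm ((n : ℝ) • w - Zᵀ *ᵥ (Z *ᵥ b)) ≤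
      n * (nrm (w - u) + t + (1 + √C) * (F * (B * A + L))) := by
    rw [hsplit]
    refine (nrm_sub_le _ _).trans ?_
    rw [nrm_smul, abs_of_pos hn0]
    have h1 := nrm_sub_le (w - u) ((n : ℝ)⁻¹ • (Uᵀ *ᵥ (U *ᵥ b)) - u)
    have h2 := nrm_add_le ((Z - U)ᵀ *ᵥ (U *ᵥ b)) (Zᵀ *ᵥ (Z *ᵥ b - U *ᵥ b))
    have h3 : F * (√(n : ℝ) * (B * A)) + √(n : ℝ) * √C * (F * L) ≤
        √(n : ℝ) * ((1 + √C) * (F * (B * A + L))) := by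
      have h4 : 0 ≤ √(n : ℝ) * (F * L) := by positivity
      have h5 : 0 ≤ √(n : ℝ) * √C * (F * (B * A)) := by positivity
      linear_combination h4 + h5
    have h6 : √(n : ℝ) * ((1 + √C) * (F * (B * A + L))) ≤ n * ((1 + √C) * (F * (B * A + L))) := by
      refine mul_le_mul_of_nonneg_right ?_ (by positivity)
      exact (le_mul_of_one_le_left (Real.sqrt_nonneg _) hs1).trans_eq hss
    have h7 := mul_le_mul_of_nonneg_left h1 hn0.le
    linarith
  have hquot : nrm (a - Z *ᵥ b) / √(n : ℝ) ≤
      (nrm (w - u) + t + (1 + √C) * (F * (B * A + L))) / √c + r := by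
    rw [div_le_iff₀ (by linarith)]
    refine hw.trans ?_
    rw [add_mul, Real.sqrt_mul hn0.le]
    refine add_le_add ?_ (le_mul_of_one_le_right hr0 hs1)
    rw [div_le_iff₀ (by positivity)]
    refine hnum.trans (le_of_eq ?_)
    have e : ∀ T : ℝ, √(n : ℝ) * √(n : ℝ) * T = T / √c * √(n : ℝ) * (√(n : ℝ) * √c) := fun T => by
      field_simp
    rw [← e, hss]
  have htri : nrm (a - ξ) ≤ nrm (a - Z *ᵥ b) + F * L + nrm (U *ᵥ b - ξ) := by
    have h1 : a - ξ = (a - Z *ᵥ b) + (Z *ᵥ b - U *ᵥ b) + (U *ᵥ b - ξ) := by abel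
    rw [h1]
    refine (nrm_add_le _ _).trans (add_le_add_left ((nrm_add_le _ _).trans ?_) _)
    exact add_le_add_right hZU _
  have hfin : nrm (a - ξ) / √(n : ℝ) ≤ nrm (a - Z *ᵥ b) / √(n : ℝ) + F * L +
      nrm (U *ᵥ b - ξ) / √(n : ℝ) := by
    have h1 : nrm (a - ξ) / √(n : ℝ) ≤ _ := div_le_div_of_nonneg_right htri (by linarith)
    rw [add_div, add_div] at h1
    have h2 : F * L / √(n : ℝ) ≤ F * L := div_le_self (by positivity) hs1
    linarith
  refine hfin.trans ?_
  have hk : 1 / √c ≤ (1 + √C) / √c := by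
    gcongr
    linarith
  have hk0 : 0 ≤ (1 + √C) / √c := by positivity
  have e1 : (nrm (w - u) + t + (1 + √C) * (F * (B * A + L))) / √c =
      (1 / √c) * (nrm (w - u) + t) + (1 + √C) / √c * (F * (B * A + L)) := by
    field_simp
  have e2 : (1 / √c) * (nrm (w - u) + t) ≤ (1 + √C) / √c * (nrm (w - u) + t) :=
    mul_le_mul_of_nonneg_right hk (add_nonneg (nrm_nonneg _) ht0)
  have e3 : F * L ≤ F * (B * A + L) :=
    mul_le_mul_of_nonneg_left (le_add_of_nonneg_left (by positivity)) hF0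
  have e4 : 0 ≤ (1 + √C) / √c * (r + nrm (U *ᵥ b - ξ) / √(n : ℝ)) :=
    mul_nonneg hk0 (add_nonneg hr0 (div_nonneg (nrm_nonneg _) (Real.sqrt_nonneg _)))
  have e5 := nrm_nonneg (w - u)
  rw [e1] at hquot
  linarith

lemma memLp_comp_Z (hs : RandomSample P D) (hφm : Measurable φ) (hφ : MemLp φ 2 (D.law P)) (i : ℕ) :
    MemLp (fun ω => φ (D.Z i ω)) 2 P :=
  ((identDistrib_Z hs i).comp hφm).memLp_iff.mpr
    (hφ.comp_of_map (hs.measurable_Z 0).aemeasurable)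

/-- The representing property of φ makes w the moment vector of φ(Z) against the coordinates.
Approximating φ(Z) in mean square therefore approximates w, by `nrm_moment_sq_le`. -/
lemma w_eq_integral
    (hφr : ∀ f, ∫ ω, φ (D.Z 0 ω) * inner ℝ (toL2p (D.Z 0 ω)) f ∂P = inner ℝ x f) {n : ℕ}
    (a : S.Idx p₁ p₂ n) : S.w x n a = ∫ ω, exactCoord D S n 0 ω a * φ (D.Z 0 ω) ∂P := by
  have h1 : S.w x n a = Pi.single a 1 ⬝ᵥ S.w x n := by simp
  rw [h1, dotProduct_w, ← hφr]
  simp_rw [exactCoord_eq, mul_comm]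

/-- The mean squared error of the approximation of `φ(Z)` along splines. -/
lemma eventually_integral_sq_le (hs : RandomSample P D)
    (hB0 : 0 ≤ B) (hB : ∀ᵐ ω ∂P, ∀ i, ‖toL2p (D.Z i ω)‖ ≤ B) (hφm : Measurable φ)
    (hφ : MemLp φ 2 (D.law P)) {g : Paths p₁ p₂} {ρ : ℝ}
    (hg : ∫ ω, (φ (D.Z 0 ω) - inner ℝ (toL2p (D.Z 0 ω)) (toL2p g)) ^ 2 ∂P < ρ)
    {b : (n : ℕ) → S.Idx p₁ p₂ n → ℝ}
    (hb : Tendsto (fun n => ‖g - splinePath S n (b n)‖) atTop (𝓝 0)) :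
    ∀ᶠ n in atTop, ∫ ω, (φ (D.Z 0 ω) -
      inner ℝ (toL2p (D.Z 0 ω)) (toL2p (splinePath S n (b n)))) ^ 2 ∂P ≤ 2 * ρ := by
  have hlim : Tendsto (fun n => 2 * ∫ ω, (φ (D.Z 0 ω) - inner ℝ (toL2p (D.Z 0 ω)) (toL2p g)) ^ 2 ∂P +
      2 * (B * (embConst p₁ p₂ * ‖g - splinePath S n (b n)‖)) ^ 2) atTop
      (𝓝 (2 * ∫ ω, (φ (D.Z 0 ω) - inner ℝ (toL2p (D.Z 0 ω)) (toL2p g)) ^ 2 ∂P +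
      2 * (B * (embConst p₁ p₂ * 0)) ^ 2)) :=
    ((((hb.const_mul _).const_mul _).pow 2).const_mul _).const_add _
  filter_upwards [hlim.eventually_lt_const (u := 2 * ρ) (by simpa using hg)] with n hn
  refine le_trans ?_ hn.le
  have hφL := memLp_comp_Z hs hφm hφ 0
  have hgL := (hφL.sub (memLp_inner_Z hs hB 0 (toL2p g))).integrable_sq
  have hbL := (hφL.sub (memLp_inner_Z hs hB 0 (toL2p (splinePath S n (b n))))).integrable_sq
  refine (integral_mono_ae hbL ((hgL.const_mul 2).add (integrable_const
    (2 * (B * (embConst p₁ p₂ * ‖g - splinePath S n (b n)‖)) ^ 2))) ?_).trans (le_of_eq ?_)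
  · filter_upwards [hB] with ω hω
    simp only [Pi.sub_apply, Pi.add_apply]
    have h1 : |(inner ℝ (toL2p (D.Z 0 ω)) (toL2p g) : ℝ) -
        inner ℝ (toL2p (D.Z 0 ω)) (toL2p (splinePath S n (b n)))| ≤
        B * (embConst p₁ p₂ * ‖g - splinePath S n (b n)‖) := by
      rw [← inner_sub_right, ← toL2p_sub]
      refine (abs_real_inner_le_norm _ _).trans ?_
      gcongr
      · exact hω 0
      · exact norm_toL2p_le_norm _
    have h2 := pow_le_pow_left₀ (abs_nonneg _) h1 2
    rw [sq_abs] at h2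
    set s := φ (D.Z 0 ω) - inner ℝ (toL2p (D.Z 0 ω)) (toL2p g)
    set t := (inner ℝ (toL2p (D.Z 0 ω)) (toL2p g) : ℝ) -
        inner ℝ (toL2p (D.Z 0 ω)) (toL2p (splinePath S n (b n)))
    have h3 : φ (D.Z 0 ω) - inner ℝ (toL2p (D.Z 0 ω)) (toL2p (splinePath S n (b n))) = s + t := by
      ring
    rw [h3]
    nlinarith [sq_nonneg (s - t)]
  · refine (integral_add (hgL.const_mul 2) (integrable_const _)).trans ?_
    simp [integral_const_mul]

/-- The empirical mean squared error of the approximation of `φ(Z)`. -/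
lemma measure_nrm_sub_ge_le (hs : RandomSample P D)
    (hB : ∀ᵐ ω ∂P, ∀ i, ‖toL2p (D.Z i ω)‖ ≤ B) (hφm : Measurable φ)
    (hφ : MemLp φ 2 (D.law P)) {n : ℕ} (hn : 0 < n) (b : S.Idx p₁ p₂ n → ℝ) {e ρ : ℝ} (hρ : 0 < ρ)
    (he : ∫ ω, (φ (D.Z 0 ω) - inner ℝ (toL2p (D.Z 0 ω)) (toL2p (splinePath S n b))) ^ 2 ∂P ≤ e) :
    P {ω | ρ ≤ nrm (exactDesign D S n ω *ᵥ b - fun i : Fin n => φ (D.Z i ω)) / √(n : ℝ)} ≤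
      ENNReal.ofReal (e / ρ ^ 2) := by
  have hn' : (0 : ℝ) < n := by exact_mod_cast hn
  let h : Paths p₁ p₂ → ℝ := fun z => (φ z - inner ℝ (toL2p z) (toL2p (splinePath S n b))) ^ 2
  have hh : Measurable h := (hφm.sub (measurable_inner_toL2p _)).pow_const 2
  have hint : ∀ i, Integrable (fun ω => h (D.Z i ω)) P := fun i =>
    ((memLp_comp_Z hs hφm hφ i).sub (memLp_inner_Z hs hB i _)).integrable_sq
  have hexp : ∀ ω, (nrm (exactDesign D S n ω *ᵥ b - fun i : Fin n => φ (D.Z i ω)) / √(n : ℝ)) ^ 2 =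
      (n : ℝ)⁻¹ * ∑ i : Fin n, h (D.Z i ω) := fun ω => by
    rw [div_pow, Real.sq_sqrt hn'.le, nrm_sq, div_eq_inv_mul]
    congr 1
    refine Finset.sum_congr rfl fun i _ => ?_
    rw [Pi.sub_apply, exactDesign_mulVec]
    ring
  refine (measure_mono fun ω hω => ?_).trans (measure_ge_le_ofReal
    (X := fun ω => (n : ℝ)⁻¹ * ∑ i : Fin n, h (D.Z i ω))
    (Eventually.of_forall fun ω => mul_nonneg (by positivity)
      (Finset.sum_nonneg fun i _ => sq_nonneg _))
    ((integrable_finsetSum _ fun (i : Fin n) _ => hint i).const_mul _) (pow_pos hρ 2) ?_)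
  · rw [Set.mem_ofPred_eq, ← hexp]
    exact pow_le_pow_left₀ hρ.le hω 2
  · rw [integral_const_mul, integral_finsetSum _ fun (i : Fin n) _ => hint i]
    simp_rw [integral_comp_Z hs hh]
    rw [Finset.sum_const, Finset.card_univ, Fintype.card_fin, nsmul_eq_mul,
      inv_mul_cancel_left₀ hn'.ne']
    exact he

variable {s' : ℕ} {ν : ℝ≥0}

/-- The empirical covariance of the exact coordinates along convergent splines. -/
lemma tendsto_empirical_cov (hs : RandomSample P D) (hU : CondU S s' ν)
    (hB : ∀ᵐ ω ∂P, ∀ i, ‖toL2p (D.Z i ω)‖ ≤ B) {C : ℝ} (hC : ∀ n, ∀ b : S.Idx p₁ p₂ n → ℝ,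
      ∫ ω, (∑ a, b a * exactCoord D S n 0 ω a) ^ 2 ∂P ≤ C * ∑ a, b a ^ 2)
    {b : (n : ℕ) → S.Idx p₁ p₂ n → ℝ} {A : ℝ}
    (hA : ∀ᶠ n in atTop, ‖toL2p (splinePath S n (b n))‖ ≤ A) {u : (n : ℕ) → S.Idx p₁ p₂ n → ℝ}
    (hu : ∀ n a, u n a = ∫ ω, exactCoord D S n 0 ω a *
      inner ℝ (toL2p (D.Z 0 ω)) (toL2p (splinePath S n (b n))) ∂P) :
    TendstoInMeasure P (fun (n : ℕ) ω => nrm ((n : ℝ)⁻¹ •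
      ((exactDesign D S n ω)ᵀ *ᵥ (exactDesign D S n ω *ᵥ b n)) - u n)) atTop (fun _ => (0 : ℝ)) := by
  have hlim : Tendsto (fun n : ℕ => (B * A) ^ 2 * C * (((p₁ + p₂ : ℕ) : ℝ) * (S.K n / n))) atTop
      (𝓝 0) := by
    simpa using ((tendsto_K_div S hU).const_mul ((p₁ + p₂ : ℕ) : ℝ)).const_mul ((B * A) ^ 2 * C)
  have h1 : TendstoInMeasure P (fun (n : ℕ) ω => nrm ((n : ℝ)⁻¹ •
      ((exactDesign D S n ω)ᵀ *ᵥ (exactDesign D S n ω *ᵥ b n)) - u n) ^ 2) atTop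
      (fun _ => (0 : ℝ)) := by
    refine tendstoInMeasure_zero_of_integral
      (fun n => Eventually.of_forall fun ω => sq_nonneg _) ?_ hlim
    filter_upwards [hA, eventually_gt_atTop 0] with n hA hn using
      integral_empirical_cov_sub_sq_le hs hB hn (hC n) hA (hu n)
  have h2 := TendstoInMeasure.comp_continuousAt h1 Real.continuous_sqrt.continuousAt
  simpa only [Real.sqrt_sq (nrm_nonneg _), Real.sqrt_zero] using h2

/-- The weights are asymptotically `φ(Z_i)`. -/
theorem tendsto_nrm_weight_sub (hs : RandomSample P D) (h3 : CondA3 P D S) (h7 : CondA7 P D S)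
    (hU : CondU S s' ν) (hq : 1 ≤ S.q) {C : ℝ} (hC0 : 0 < C) (hC : ∀ n, ∀ b : S.Idx p₁ p₂ n → ℝ,
      ∫ ω, (∑ a, b a * exactCoord D S n 0 ω a) ^ 2 ∂P ≤ C * ∑ a, b a ^ 2)
    (hφm : Measurable φ) (hφ : MemLp φ 2 (D.law P))
    (hφr : ∀ f, ∫ ω, φ (D.Z 0 ω) * inner ℝ (toL2p (D.Z 0 ω)) f ∂P = inner ℝ x f)
    (happ : ∀ ρ : ℝ, 0 < ρ → ∃ g : Paths p₁ p₂,
      ∫ ω, (φ (D.Z 0 ω) - inner ℝ (toL2p (D.Z 0 ω)) (toL2p g)) ^ 2 ∂P < ρ) :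
    TendstoInMeasure P (fun n ω =>
      nrm (weightOf S x n (D.Zvec n ω) - fun i : Fin n => φ (D.Z i ω)) / √(n : ℝ)) atTop
      (fun _ => (0 : ℝ)) := by
  obtain ⟨B, hB0, hB⟩ := h3.exists_bound
  refine tendstoInMeasure_zero_of_forall_approx fun δ hδ => ?_
  obtain ⟨c, Cg, hc, hCg, hgood⟩ := h7.exists_good hδ
  refine ⟨(1 + √Cg) / √c + 1, by positivity, fun ρ hρ => ?_⟩
  -- For large n the splines approximate φ(Z) with mean squared error at most 2e. The first
  -- condition makes ‖w - u‖ < ρ/3; the second is the Markov bound for the empirical error.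
  obtain ⟨e, he0, heC, heδ⟩ : ∃ e : ℝ, 0 < e ∧ C * (2 * e) < (ρ / 3) ^ 2 ∧
      2 * e / (ρ / 3) ^ 2 ≤ δ / 2 := by
    refine ⟨min ((ρ / 3) ^ 2 / (4 * C)) (δ / 4 * (ρ / 3) ^ 2), by positivity, ?_, ?_⟩
    · have := min_le_left ((ρ / 3) ^ 2 / (4 * C)) (δ / 4 * (ρ / 3) ^ 2)
      rw [le_div_iff₀ (by positivity)] at this
      have h0 : 0 < (ρ / 3) ^ 2 := by positivity
      linarith
    · rw [div_le_iff₀ (by positivity)]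
      linarith [min_le_right ((ρ / 3) ^ 2 / (4 * C)) (δ / 4 * (ρ / 3) ^ 2)]
  obtain ⟨g, hg⟩ := happ e he0
  obtain ⟨b, hb⟩ := exists_splinePath_tendsto S hq hU.u1_tendsto g
  obtain ⟨A, L, hA0, hL0, hAL⟩ := exists_coeff_bound h3 h7 hb
  let u : (n : ℕ) → S.Idx p₁ p₂ n → ℝ := fun n a => ∫ ω, exactCoord D S n 0 ω a *
      inner ℝ (toL2p (D.Z 0 ω)) (toL2p (splinePath S n (b n))) ∂P
  have hT : TendstoInMeasure P (fun (n : ℕ) ω => nrm ((n : ℝ)⁻¹ •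
      ((exactDesign D S n ω)ᵀ *ᵥ (exactDesign D S n ω *ᵥ b n)) - u n) +
      smoothErr D S n ω * (B * A + L) + √(b n ⬝ᵥ (S.Rlam p₁ p₂ n *ᵥ b n))) atTop
      (fun _ => (0 : ℝ)) := by
    refine TendstoInMeasure.add_zero_limit (TendstoInMeasure.add_zero_limit
      (tendsto_empirical_cov hs hU hB hC (hAL.mono fun n h => h.1) fun _ _ => rfl) ?_) ?_
    · simpa using TendstoInMeasure.mul_const_limit h3.tendsto_smoothErr
        (tendstoInMeasure_of_tendsto (tendsto_const_nhds (x := B * A + L)))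
    · refine tendstoInMeasure_of_tendsto ?_
      simpa using (tendsto_penalty S hU hb).sqrt
  -- The bound has three summands, each compared with ρ/3: a deterministic one, one that tends to 0
  -- in probability, and one that is small with large probability. The first and third become small
  -- only through e; they need not tend to 0 along the fixed g.
  refine ⟨fun (n : ℕ) ω => nrm (S.w x n - u n) + (nrm ((n : ℝ)⁻¹ •
      ((exactDesign D S n ω)ᵀ *ᵥ (exactDesign D S n ω *ᵥ b n)) - u n) +
      smoothErr D S n ω * (B * A + L) + √(b n ⬝ᵥ (S.Rlam p₁ p₂ n *ᵥ b n))) +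
      nrm (exactDesign D S n ω *ᵥ b n - fun i : Fin n => φ (D.Z i ω)) / √(n : ℝ), ?_, ?_⟩
  · filter_upwards [hgood, hAL, eventually_gt_atTop 0] with n hn hAL hn0
    refine (measure_mono_ae ?_).trans hn
    filter_upwards [hB] with ω hω hX hG
    refine hX ?_
    rw [abs_of_nonneg (div_nonneg (nrm_nonneg _) (Real.sqrt_nonneg _))]
    exact nrm_weight_sub_le hc hCg hn0 hG hω hAL.1 hAL.2 (u n) _
  · filter_upwards [eventually_integral_sq_le hs hB0 hB hφm hφ hg hb, eventually_gt_atTop 0,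
      tendstoInMeasure_zero_iff.mp hT (ρ / 3) (by positivity) (δ / 2) (by positivity)] with
      n hn1 hn0 hn2
    have hw : nrm (S.w x n - u n) < ρ / 3 := by
      have hψ := (memLp_comp_Z hs hφm hφ 0).sub
        (memLp_inner_Z hs hB 0 (toL2p (splinePath S n (b n))))
      have h1 := nrm_moment_sq_le hs hB hC0 (hC n) hψ (u := S.w x n - u n) fun a => by
        simp only [Pi.sub_apply, mul_sub]
        exact (congrArg (· - u n a) (w_eq_integral hφr a)).trans (integral_sub
          ((memLp_exactCoord hs hB n 0 a).integrable_mul (memLp_comp_Z hs hφm hφ 0))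
          ((memLp_exactCoord hs hB n 0 a).integrable_mul (memLp_inner_Z hs hB 0 _))).symm
      refine lt_of_pow_lt_pow_left₀ 2 (by positivity) (h1.trans_lt (lt_of_le_of_lt ?_ heC))
      exact mul_le_mul_of_nonneg_left hn1 hC0.le
    have h5 := (measure_nrm_sub_ge_le hs hB hφm hφ hn0 (b n) (show 0 < ρ / 3 by positivity)
      hn1).trans (ENNReal.ofReal_le_ofReal heδ)
    rw [← add_halves δ]
    refine measure_union_le_ofReal (by positivity) (by positivity) (fun ω hω => ?_) hn2 h5
    by_contra hcon
    simp only [Set.mem_union, Set.mem_ofPred_eq, not_or, not_le] at hcon hω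
    have h6 := (le_abs_self _).trans_lt hcon.1
    linarith [hcon.2]

end Weights


/-! ### The error of the estimator -/

section ErrorTerms

open Matrix

variable {Ω : Type*} [MeasurableSpace Ω] {p₁ p₂ : ℕ} {P : Measure Ω} [IsProbabilityMeasure P]
  {D : Model Ω p₁ p₂} {S : Scheme} {x : L2p p₁ p₂} {B : ℝ}

set_option linter.unusedSectionVars false

/-- The error vector. -/
def Model.noise (D : Model Ω p₁ p₂) (n : ℕ) (ω : Ω) : Fin n → ℝ := fun i => D.ε i ω

/-- The deterministic part of the response which is not fitted by the coefficients `b`. -/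
def lackOfFit (hβ : ∀ j, ContinuousOn (D.β j) (Set.Icc 0 1)) (S : Scheme) (n : ℕ) (ω : Ω)
    (b : S.Idx p₁ p₂ n → ℝ) : Fin n → ℝ :=
  fun i => inner ℝ (toL2p (D.Z i ω)) (toL2p (betaPath D hβ)) - (design D S n ω *ᵥ b) i

variable (hβ : ∀ j, ContinuousOn (D.β j) (Set.Icc 0 1))

lemma yvec_eq (n : ℕ) (ω : Ω) (b : S.Idx p₁ p₂ n → ℝ) :
    yvec D n ω = design D S n ω *ᵥ b + (lackOfFit hβ S n ω b + D.noise n ω) := by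
  funext i
  simp only [yvec, Pi.add_apply, lackOfFit, Model.noise, Y_eq D hβ]
  ring

lemma nrm_lackOfFit_le {n : ℕ} {ω : Ω} (hB : ∀ i, ‖toL2p (D.Z i ω)‖ ≤ B) {b : S.Idx p₁ p₂ n → ℝ}
    {L : ℝ} (hL : nrm b ≤ L) :
    nrm (lackOfFit hβ S n ω b) ≤
      B * embConst p₁ p₂ * (√(n : ℝ) * ‖betaPath D hβ - splinePath S n b‖) +
        L * smoothErr D S n ω := by
  have hB0 : 0 ≤ B := (norm_nonneg _).trans (hB 0)
  have h1 : lackOfFit hβ S n ω b =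
      (fun i : Fin n => (inner ℝ (toL2p (D.Z i ω)) (toL2p (betaPath D hβ - splinePath S n b)) : ℝ)) -
        (design D S n ω - exactDesign D S n ω) *ᵥ b := by
    funext i
    rw [Pi.sub_apply, sub_mulVec, Pi.sub_apply, exactDesign_mulVec, toL2p_sub, inner_sub_right,
      lackOfFit]
    ring
  rw [h1]
  refine (nrm_sub_le _ _).trans (add_le_add ?_ ?_)
  · refine (nrm_le_sqrt_mul (A := B * (embConst p₁ p₂ * ‖betaPath D hβ - splinePath S n b‖))
      (mul_nonneg hB0 (mul_nonneg (embConst_nonneg _ _) (norm_nonneg _))) fun i => ?_).trans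
      (le_of_eq (by ring))
    refine (abs_real_inner_le_norm _ _).trans ?_
    gcongr
    · exact hB i
    · exact norm_toL2p_le_norm _
  · refine (nrm_mulVec_le _ _).trans ?_
    rw [mul_comm L]
    exact mul_le_mul_of_nonneg_left hL (smoothErr_nonneg n ω)

/-- The estimation error of the functional beyond its leading linear term. -/
lemma abs_error_sub_linear_le {c C : ℝ} (hc : 0 < c) {n : ℕ} (hn : 0 < n) {ω : Ω}
    (h : GoodDesign D S c C n ω) (hB : ∀ i, ‖toL2p (D.Z i ω)‖ ≤ B) {b : S.Idx p₁ p₂ n → ℝ} {L W : ℝ}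
    (hL : nrm b ≤ L) (hW : nrm (S.w x n) ≤ W) :
    |√(n : ℝ) * (Psihat D S x n ω - Psi D x) -
      (√(n : ℝ))⁻¹ * (weightOf S x n (D.Zvec n ω) ⬝ᵥ D.noise n ω)| ≤
      (W / √c * (B * embConst p₁ p₂ + L + 1) + ‖x‖ * embConst p₁ p₂) *
        (√(n : ℝ) * ‖betaPath D hβ - splinePath S n b‖ + smoothErr D S n ω +
          √(b ⬝ᵥ (S.Rlam p₁ p₂ n *ᵥ b))) := by
  have hn0 : (0 : ℝ) < n := by exact_mod_cast hn
  have hB0 : 0 ≤ B := (norm_nonneg _).trans (hB 0)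
  have hL0 : 0 ≤ L := (nrm_nonneg _).trans hL
  have hW0 : 0 ≤ W := (nrm_nonneg _).trans hW
  have hF0 := smoothErr_nonneg (D := D) (S := S) n ω
  have hE0 := embConst_nonneg p₁ p₂
  have hsc : 0 < √c := Real.sqrt_pos.mpr hc
  have hs0 : 0 < √(n : ℝ) := Real.sqrt_pos.mpr hn0
  have hss : √(n : ℝ) * √(n : ℝ) = n := Real.mul_self_sqrt hn0.le
  have hR := S.posSemidef_Rlam p₁ p₂ n
  have hZ := fun v => (h v).1
  have hlin := ridge_functional_error hR (mul_pos hn0 hc) hZ (S.w x n) b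
    (lackOfFit hβ S n ω b + D.noise n ω)
  rw [← yvec_eq hβ] at hlin
  have hsolve := ridge_solve hR (mul_pos hn0 hc) hZ (S.w x n)
  have hfit := ridge_fit_le hR (mul_pos hn0 hc) hZ hsolve
  have hpair := ridge_penalty_pairing_le hR (mul_pos hn0 hc) hZ hsolve b
  have hlack := nrm_lackOfFit_le hβ hB hL
  have hbias : |b ⬝ᵥ S.w x n - Psi D x| ≤
      ‖x‖ * (embConst p₁ p₂ * ‖betaPath D hβ - splinePath S n b‖) := by
    rw [dotProduct_w, Psi_eq D hβ, ← inner_sub_right, ← toL2p_sub]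
    refine (abs_real_inner_le_norm _ _).trans ?_
    gcongr
    rw [norm_sub_rev (betaPath D hβ)]
    exact norm_toL2p_le_norm _
  have hPh : Psihat D S x n ω = (((design D S n ω)ᵀ * design D S n ω + S.Rlam p₁ p₂ n)⁻¹ *ᵥ
      ((design D S n ω)ᵀ *ᵥ yvec D n ω)) ⬝ᵥ S.w x n := Psihat_eq D S x n ω
  have hwt : weightOf S x n (D.Zvec n ω) = (n : ℝ) • (design D S n ω *ᵥ
      (((design D S n ω)ᵀ * design D S n ω + S.Rlam p₁ p₂ n)⁻¹ *ᵥ S.w x n)) := rfl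
  set f := ((design D S n ω)ᵀ * design D S n ω + S.Rlam p₁ p₂ n)⁻¹ *ᵥ S.w x n
  set ρ := lackOfFit hβ S n ω b
  set r := √(b ⬝ᵥ (S.Rlam p₁ p₂ n *ᵥ b))
  set η := ‖betaPath D hβ - splinePath S n b‖
  set F := smoothErr D S n ω
  have hr0 : 0 ≤ r := Real.sqrt_nonneg _
  have hη0 : 0 ≤ η := norm_nonneg _
  have hq : nrm (S.w x n) / √(n * c) ≤ W / (√(n : ℝ) * √c) := by
    rw [Real.sqrt_mul hn0.le]
    gcongr
  -- Lack of fit, penalty and bias remain. The ridge solution f gives a factor of order n^(-1/2) in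
  -- the first two, which cancels the outer √n; the bias is killed by undersmoothing.
  have hdec : √(n : ℝ) * (Psihat D S x n ω - Psi D x) -
      (√(n : ℝ))⁻¹ * (weightOf S x n (D.Zvec n ω) ⬝ᵥ D.noise n ω) =
      √(n : ℝ) * ((design D S n ω *ᵥ f) ⬝ᵥ ρ - f ⬝ᵥ (S.Rlam p₁ p₂ n *ᵥ b) +
        (b ⬝ᵥ S.w x n - Psi D x)) := by
    have h1 : (√(n : ℝ))⁻¹ * (weightOf S x n (D.Zvec n ω) ⬝ᵥ D.noise n ω) =
        √(n : ℝ) * ((design D S n ω *ᵥ f) ⬝ᵥ D.noise n ω) := by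
      rw [hwt, smul_dotProduct, smul_eq_mul]
      nth_rewrite 2 [← hss]
      field_simp
    rw [dotProduct_add] at hlin
    rw [h1, hPh, ← mul_sub]
    congr 1
    linarith
  rw [hdec, abs_mul, abs_of_pos hs0]
  have h1 : |(design D S n ω *ᵥ f) ⬝ᵥ ρ| ≤ W / (√(n : ℝ) * √c) *
      (B * embConst p₁ p₂ * (√(n : ℝ) * η) + L * F) :=
    (abs_dotProduct_le _ _).trans
      (mul_le_mul (hfit.trans hq) hlack (nrm_nonneg _) (by positivity))
  have h2 : |f ⬝ᵥ (S.Rlam p₁ p₂ n *ᵥ b)| ≤ W / (√(n : ℝ) * √c) * r :=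
    hpair.trans (mul_le_mul_of_nonneg_right hq hr0)
  have h3 : √(n : ℝ) * |(design D S n ω *ᵥ f) ⬝ᵥ ρ - f ⬝ᵥ (S.Rlam p₁ p₂ n *ᵥ b) +
        (b ⬝ᵥ S.w x n - Psi D x)| ≤ √(n : ℝ) * (W / (√(n : ℝ) * √c) *
      (B * embConst p₁ p₂ * (√(n : ℝ) * η) + L * F) + W / (√(n : ℝ) * √c) * r +
      ‖x‖ * (embConst p₁ p₂ * η)) := by
    refine mul_le_mul_of_nonneg_left ?_ hs0.le
    exact (abs_add_le _ _).trans (add_le_add ((abs_sub _ _).trans (add_le_add h1 h2)) hbias)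
  refine h3.trans ?_
  have h4 : √(n : ℝ) * (W / (√(n : ℝ) * √c) *
      (B * embConst p₁ p₂ * (√(n : ℝ) * η) + L * F) + W / (√(n : ℝ) * √c) * r +
      ‖x‖ * (embConst p₁ p₂ * η)) = W / √c * (B * embConst p₁ p₂ * (√(n : ℝ) * η) + L * F + r) +
      ‖x‖ * embConst p₁ p₂ * (√(n : ℝ) * η) := by
    field_simp
  rw [h4, add_mul, mul_assoc (W / √c)]
  have hsη : 0 ≤ √(n : ℝ) * η := by positivity
  refine add_le_add (mul_le_mul_of_nonneg_left ?_ (by positivity))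
    (mul_le_mul_of_nonneg_left (by linarith) (by positivity))
  have h5 : 0 ≤ B * embConst p₁ p₂ * (F + r) + L * (√(n : ℝ) * η + r) + (√(n : ℝ) * η + F) := by
    positivity
  linarith

/-- The residuals are close to the errors. -/
lemma nrm_residual_sub_noise_le {c C : ℝ} (hc : 0 < c) {n : ℕ} (hn : 0 < n) {ω : Ω}
    (h : GoodDesign D S c C n ω) (hB : ∀ i, ‖toL2p (D.Z i ω)‖ ≤ B) {b : S.Idx p₁ p₂ n → ℝ} {L : ℝ}
    (hL : nrm b ≤ L) :
    nrm (yvec D n ω - design D S n ω *ᵥ bhat D S n ω - D.noise n ω) / √(n : ℝ) ≤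
      (2 * (B * embConst p₁ p₂ + L) + 1 / √c + 1) *
        (√(n : ℝ) * ‖betaPath D hβ - splinePath S n b‖ + smoothErr D S n ω +
          √(b ⬝ᵥ (S.Rlam p₁ p₂ n *ᵥ b)) +
          (nrm ((exactDesign D S n ω)ᵀ *ᵥ D.noise n ω) / n +
            smoothErr D S n ω * (nrm (D.noise n ω) / √(n : ℝ)))) := by
  have hn' : (1 : ℝ) ≤ n := by exact_mod_cast hn
  have hn0 : (0 : ℝ) < n := by linarith
  have hB0 : 0 ≤ B := (norm_nonneg _).trans (hB 0)
  have hL0 : 0 ≤ L := (nrm_nonneg _).trans hL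
  have hF0 := smoothErr_nonneg (D := D) (S := S) n ω
  have hE0 := embConst_nonneg p₁ p₂
  have hsc : 0 < √c := Real.sqrt_pos.mpr hc
  have hs1 : 1 ≤ √(n : ℝ) := Real.one_le_sqrt.mpr hn'
  have hs0 : 0 < √(n : ℝ) := by linarith
  have hss : √(n : ℝ) * √(n : ℝ) = n := Real.mul_self_sqrt hn0.le
  have hres := ridge_residual_sub_le (S.posSemidef_Rlam p₁ p₂ n) (mul_pos hn0 hc)
    (fun v => (h v).1) b (lackOfFit hβ S n ω b) (D.noise n ω)
  rw [← yvec_eq hβ, Real.sqrt_mul hn0.le] at hres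
  change nrm (yvec D n ω - design D S n ω *ᵥ bhat D S n ω - D.noise n ω) ≤ _ at hres
  have hlack := nrm_lackOfFit_le hβ hB hL
  have hscore : nrm ((design D S n ω)ᵀ *ᵥ D.noise n ω) ≤
      nrm ((exactDesign D S n ω)ᵀ *ᵥ D.noise n ω) + smoothErr D S n ω * nrm (D.noise n ω) := by
    have h1 : (design D S n ω)ᵀ *ᵥ D.noise n ω = (exactDesign D S n ω)ᵀ *ᵥ D.noise n ω +
        (design D S n ω - exactDesign D S n ω)ᵀ *ᵥ D.noise n ω := by
      rw [transpose_sub, sub_mulVec]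
      abel
    rw [h1]
    exact (nrm_add_le _ _).trans (add_le_add_right (nrm_transpose_mulVec_le_frob _ _) _)
  set η := ‖betaPath D hβ - splinePath S n b‖
  set F := smoothErr D S n ω
  set r := √(b ⬝ᵥ (S.Rlam p₁ p₂ n *ᵥ b))
  set T := nrm ((exactDesign D S n ω)ᵀ *ᵥ D.noise n ω)
  set N := nrm (D.noise n ω)
  have hr0 : 0 ≤ r := Real.sqrt_nonneg _
  have hη0 : 0 ≤ √(n : ℝ) * η := mul_nonneg hs0.le (norm_nonneg _)
  have hT0 : 0 ≤ T := nrm_nonneg _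
  have hN0 : 0 ≤ N := nrm_nonneg _
  have h1 : nrm ((design D S n ω)ᵀ *ᵥ D.noise n ω) / (√(n : ℝ) * √c) ≤
      √(n : ℝ) * (1 / √c * (T / n + F * (N / √(n : ℝ)))) := by
    rw [div_le_iff₀ (by positivity)]
    refine hscore.trans ?_
    have h2 : √(n : ℝ) * (1 / √c * (T / n + F * (N / √(n : ℝ)))) * (√(n : ℝ) * √c) =
        (√(n : ℝ) * √(n : ℝ)) * (T / n) + √(n : ℝ) * (F * N) := by
      field_simp
    rw [h2, hss, mul_div_cancel₀ _ hn0.ne']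
    exact add_le_add_right (le_mul_of_one_le_left (by positivity) hs1) _
  rw [div_le_iff₀ hs0]
  set G := T / n + F * (N / √(n : ℝ))
  have hG0 : 0 ≤ G := by positivity
  set k := 1 / √c
  have hk0 : 0 ≤ k := by positivity
  have h3 : 2 * (B * embConst p₁ p₂ * (√(n : ℝ) * η) + L * F) + r ≤
      √(n : ℝ) * (2 * (B * embConst p₁ p₂ * (√(n : ℝ) * η) + L * F) + r) :=
    le_mul_of_one_le_left (by positivity) hs1
  have h4 : 2 * (B * embConst p₁ p₂ * (√(n : ℝ) * η) + L * F) + r + k * G ≤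
      (2 * (B * embConst p₁ p₂ + L) + k + 1) * (√(n : ℝ) * η + F + r + G) := by
    have h5 : 0 ≤ 2 * (B * embConst p₁ p₂) * (F + r + G) + 2 * L * (√(n : ℝ) * η + r + G) +
        k * (√(n : ℝ) * η + F + r) + (√(n : ℝ) * η + F + G) := by positivity
    linarith
  have h6 := mul_le_mul_of_nonneg_left h4 hs0.le
  linarith

end ErrorTerms


/-! ### Limit theorems -/

section Limits

open Matrix

variable {Ω : Type*} [MeasurableSpace Ω] {p₁ p₂ : ℕ} {P : Measure Ω} [IsProbabilityMeasure P]
  {D : Model Ω p₁ p₂} {S : Scheme} {x : L2p p₁ p₂} {φ : Paths p₁ p₂ → ℝ} {s' : ℕ} {ν : ℝ≥0}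
  {σ2 : ℝ}

set_option linter.unusedSectionVars false

lemma trace_hatMatrix_nonneg (n : ℕ) (ω : Ω) : 0 ≤ (hatMatrix D S n ω).trace :=
  ridge_trace_nonneg (S.posSemidef_Rlam p₁ p₂ n)

lemma trace_hatMatrix_le (n : ℕ) (ω : Ω) :
    (hatMatrix D S n ω).trace ≤ ((p₁ + p₂ : ℕ) : ℝ) * S.K n :=
  (ridge_trace_le (S.posSemidef_Rlam p₁ p₂ n)).trans_eq (card_idx n)

lemma tendsto_trace_div (hU : CondU S s' ν) :
    TendstoInMeasure P (fun (n : ℕ) ω => (hatMatrix D S n ω).trace / (n : ℝ)) atTop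
      (fun _ => (0 : ℝ)) := by
  refine tendstoInMeasure_zero_of_forall_le
    (tendstoInMeasure_of_tendsto (tendsto_K_div S hU)) fun δ hδ =>
    ⟨((p₁ + p₂ : ℕ) : ℝ), Nat.cast_nonneg _, Eventually.of_forall fun n => ?_⟩
  have h : ∀ ω, |(hatMatrix D S n ω).trace / (n : ℝ)| ≤ ((p₁ + p₂ : ℕ) : ℝ) * (S.K n / n) := fun ω => by
    rw [abs_of_nonneg (div_nonneg (trace_hatMatrix_nonneg n ω) (Nat.cast_nonneg n)), ← mul_div_assoc]
    exact div_le_div_of_nonneg_right (trace_hatMatrix_le n ω) (Nat.cast_nonneg n)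
  simp only [h, not_true, Set.ofPred_false, measure_empty, zero_le]

/-- The law of large numbers for squares, as a statement on empirical norms. -/
lemma tendsto_nrm_sq_div (hs : RandomSample P D) {f : Paths p₁ p₂ × ℝ → ℝ} (hf : Measurable f)
    (hint : Integrable (fun ω => f (D.Z 0 ω, D.ε 0 ω) ^ 2) P) :
    TendstoInMeasure P (fun n ω => nrm (fun i : Fin n => f (D.Z i ω, D.ε i ω)) ^ 2 / (n : ℝ)) atTop
      (fun _ => ∫ ω, f (D.Z 0 ω, D.ε 0 ω) ^ 2 ∂P) := by
  simp_rw [nrm_sq]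
  exact tendstoInMeasure_mean (X := fun i ω => f (D.Z i ω, D.ε i ω) ^ 2) hint
    (fun i j hij => (hs.indep.indepFun hij).comp (hf.pow_const 2) (hf.pow_const 2))
    fun i => (hs.identDistrib i).comp (hf.pow_const 2)

/-- The sandwich variance. -/
lemma tendsto_wVw (hs : RandomSample P D) (h7 : CondA7 P D S) (hφm : Measurable φ)
    (hφ : MemLp φ 2 (D.law P))
    (hwt : TendstoInMeasure P (fun n ω =>
      nrm (weightOf S x n (D.Zvec n ω) - fun i : Fin n => φ (D.Z i ω)) / √(n : ℝ)) atTop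
      (fun _ => (0 : ℝ))) :
    TendstoInMeasure P (wVw D S x) atTop (fun _ => ∫ ω, φ (D.Z 0 ω) ^ 2 ∂P) := by
  have h1 := tendstoInMeasure_nrm_of_sub (tendsto_nrm_sq_div hs (f := fun p => φ p.1)
    (hφm.comp measurable_fst) (memLp_comp_Z hs hφm hφ 0).integrable_sq) hwt
  rw [max_eq_left (integral_nonneg fun ω => sq_nonneg _)] at h1
  -- The difference is exactly 0 on the event of a well conditioned design, so it is dominated there
  -- by the zero sequence.
  have h2 : TendstoInMeasure P (fun n ω => wVw D S x n ω -
      nrm (weightOf S x n (D.Zvec n ω)) ^ 2 / (n : ℝ)) atTop (fun _ => (0 : ℝ)) := by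
    refine tendstoInMeasure_zero_of_forall_le
      (tendstoInMeasure_of_tendsto (tendsto_const_nhds (x := (0 : ℝ)))) fun δ hδ => ?_
    obtain ⟨c, C, hc, -, hgood⟩ := h7.exists_good hδ
    refine ⟨0, le_rfl, ?_⟩
    filter_upwards [hgood, eventually_gt_atTop 0] with n hn hn0
    refine (measure_mono ?_).trans hn
    intro ω hω hG
    refine hω ?_
    simp [wVw_eq hc hn0 hG]
  simpa using TendstoInMeasure.add_const_limit h2 h1

/-- Coefficients of undersmoothed approximants of the coefficient functions. -/
lemma exists_undersmoothed_coeff (h1 : CondA1 D S s' ν) (hU : CondU S s' ν) (h3 : CondA3 P D S)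
    (h7 : CondA7 P D S) :
    ∃ (b : (n : ℕ) → S.Idx p₁ p₂ n → ℝ) (L : ℝ), 0 ≤ L ∧ (∀ᶠ n in atTop, nrm (b n) ≤ L) ∧
      TendstoInMeasure P (fun (n : ℕ) ω =>
        √(n : ℝ) * ‖betaPath D (continuousOn_beta D S h1) - splinePath S n (b n)‖ +
          smoothErr D S n ω + √(b n ⬝ᵥ (S.Rlam p₁ p₂ n *ᵥ b n))) atTop (fun _ => (0 : ℝ)) := by
  obtain ⟨b, hb⟩ := exists_splinePath_beta D S h1 hU
  have hb' : Tendsto (fun n => ‖betaPath D (continuousOn_beta D S h1) - splinePath S n (b n)‖)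
      atTop (𝓝 0) := by
    refine squeeze_zero' (Eventually.of_forall fun n => norm_nonneg _) ?_ hb
    filter_upwards [eventually_ge_atTop 1] with n hn
    exact le_mul_of_one_le_left (norm_nonneg _) (Real.one_le_sqrt.mpr (by exact_mod_cast hn))
  obtain ⟨A, L, -, hL, hAL⟩ := exists_coeff_bound h3 h7 hb'
  refine ⟨b, L, hL, hAL.mono fun n h => h.2, TendstoInMeasure.add_zero_limit
    (TendstoInMeasure.add_zero_limit (tendstoInMeasure_of_tendsto hb) h3.tendsto_smoothErr)
    (tendstoInMeasure_of_tendsto ?_)⟩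
  simpa using (tendsto_penalty S hU hb').sqrt

/-- The estimation error is asymptotically linear. -/
lemma tendsto_error_sub_linear (h1 : CondA1 D S s' ν) (hU : CondU S s' ν) (h3 : CondA3 P D S)
    (h7 : CondA7 P D S) {W : ℝ} (hW0 : 0 ≤ W) (hW : ∀ n, nrm (S.w x n) ≤ W) :
    TendstoInMeasure P (fun (n : ℕ) ω => √(n : ℝ) * (Psihat D S x n ω - Psi D x) -
      (√(n : ℝ))⁻¹ * (weightOf S x n (D.Zvec n ω) ⬝ᵥ D.noise n ω)) atTop (fun _ => (0 : ℝ)) := by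
  obtain ⟨b, L, hL0, hL, hlim⟩ := exists_undersmoothed_coeff h1 hU h3 h7
  obtain ⟨B, hB0, hB⟩ := h3.exists_bound
  refine tendstoInMeasure_zero_of_forall_le hlim fun δ hδ => ?_
  obtain ⟨c, C, hc, -, hgood⟩ := h7.exists_good hδ
  refine ⟨W / √c * (B * embConst p₁ p₂ + L + 1) + ‖x‖ * embConst p₁ p₂, ?_, ?_⟩
  · have := embConst_nonneg p₁ p₂
    positivity
  filter_upwards [hgood, hL, eventually_gt_atTop 0] with n hn hL hn0
  refine (measure_mono_ae ?_).trans hn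
  filter_upwards [hB] with ω hω hX hG
  exact hX (abs_error_sub_linear_le (continuousOn_beta D S h1) hc hn0 hG hω hL (hW n))

/-- The squared norm of the score has mean of order nK, hence K/n after division by n². -/
lemma tendsto_score (hs : RandomSample P D) (h5 : CondA5 P D σ2) (h3 : CondA3 P D S)
    (hU : CondU S s' ν) {C : ℝ} (hC : ∀ n, ∀ b : S.Idx p₁ p₂ n → ℝ,
      ∫ ω, (∑ a, b a * exactCoord D S n 0 ω a) ^ 2 ∂P ≤ C * ∑ a, b a ^ 2) :
    TendstoInMeasure P (fun n ω => nrm ((exactDesign D S n ω)ᵀ *ᵥ D.noise n ω) / (n : ℝ)) atTop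
      (fun _ => (0 : ℝ)) := by
  obtain ⟨B, hB0, hB⟩ := h3.exists_bound
  have hlim : Tendsto (fun n : ℕ => σ2 * C * (((p₁ + p₂ : ℕ) : ℝ) * (S.K n / n))) atTop (𝓝 0) := by
    simpa using ((tendsto_K_div S hU).const_mul ((p₁ + p₂ : ℕ) : ℝ)).const_mul (σ2 * C)
  have h1 : TendstoInMeasure P (fun n ω => nrm ((exactDesign D S n ω)ᵀ *ᵥ D.noise n ω) ^ 2 /
      (n : ℝ) ^ 2) atTop (fun _ => (0 : ℝ)) := by
    refine tendstoInMeasure_zero_of_integral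
      (fun n => Eventually.of_forall fun ω => by positivity) ?_ hlim
    filter_upwards [eventually_gt_atTop 0] with n hn
    have hn' : (0 : ℝ) < n := by exact_mod_cast hn
    obtain ⟨h1, h2⟩ := integral_score_sq_le hs h5 hB (hC n)
    refine ⟨h1.div_const _, ?_⟩
    rw [integral_div, div_le_iff₀ (by positivity)]
    refine h2.trans (le_of_eq ?_)
    field_simp
  have h2 := TendstoInMeasure.comp_continuousAt h1 Real.continuous_sqrt.continuousAt
  simpa only [← div_pow, Real.sqrt_sq (div_nonneg (nrm_nonneg _) (Nat.cast_nonneg _)),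
    Real.sqrt_zero] using h2

lemma tendsto_noise (hs : RandomSample P D) (h5 : CondA5 P D σ2) :
    TendstoInMeasure P (fun n ω => nrm (D.noise n ω) ^ 2 / (n : ℝ)) atTop (fun _ => σ2) := by
  have := tendsto_nrm_sq_div hs (f := Prod.snd) measurable_snd (h5.integrable_sq hs 0)
  rwa [h5.second 0] at this

/-- Consistency of the error variance estimator. -/
lemma tendsto_sigma2hat (hs : RandomSample P D) (h1 : CondA1 D S s' ν) (hU : CondU S s' ν)
    (h3 : CondA3 P D S) (h5 : CondA5 P D σ2) (h7 : CondA7 P D S) {C : ℝ}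
    (hC : ∀ n, ∀ b : S.Idx p₁ p₂ n → ℝ,
      ∫ ω, (∑ a, b a * exactCoord D S n 0 ω a) ^ 2 ∂P ≤ C * ∑ a, b a ^ 2) :
    TendstoInMeasure P (sigma2hat D S) atTop (fun _ => σ2) := by
  obtain ⟨b, L, hL0, hL, hlim⟩ := exists_undersmoothed_coeff h1 hU h3 h7
  obtain ⟨B, hB0, hB⟩ := h3.exists_bound
  have hnoise := tendsto_noise hs h5
  have hnoise' : TendstoInMeasure P (fun n ω => nrm (D.noise n ω) / √(n : ℝ)) atTop
      (fun _ => √σ2) := by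
    have h := TendstoInMeasure.comp_continuousAt hnoise Real.continuous_sqrt.continuousAt
    simpa only [Real.sqrt_div (sq_nonneg _), Real.sqrt_sq (nrm_nonneg _)] using h
  have hprod : TendstoInMeasure P (fun (n : ℕ) ω => smoothErr D S n ω *
      (nrm (D.noise n ω) / √(n : ℝ))) atTop (fun _ => (0 : ℝ)) := by
    simpa using TendstoInMeasure.mul_const_limit h3.tendsto_smoothErr hnoise'
  have hres : TendstoInMeasure P (fun n ω => nrm (yvec D n ω - design D S n ω *ᵥ bhat D S n ω -
      D.noise n ω) / √(n : ℝ)) atTop (fun _ => (0 : ℝ)) := by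
    refine tendstoInMeasure_zero_of_forall_le (TendstoInMeasure.add_zero_limit hlim
      (TendstoInMeasure.add_zero_limit (tendsto_score hs h5 h3 hU hC) hprod)) fun δ hδ => ?_
    obtain ⟨c, Cg, hc, -, hgood⟩ := h7.exists_good hδ
    refine ⟨2 * (B * embConst p₁ p₂ + L) + 1 / √c + 1, ?_, ?_⟩
    · have := embConst_nonneg p₁ p₂
      positivity
    filter_upwards [hgood, hL, eventually_gt_atTop 0] with n hn hL hn0
    refine (measure_mono_ae ?_).trans hn
    filter_upwards [hB] with ω hω hX hG
    refine hX ?_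
    rw [abs_of_nonneg (div_nonneg (nrm_nonneg _) (Real.sqrt_nonneg _))]
    exact nrm_residual_sub_noise_le (continuousOn_beta D S h1) hc hn0 hG hω hL
  have hrss := tendstoInMeasure_nrm_of_sub hnoise hres
  rw [max_eq_left h5.nonneg] at hrss
  -- Since tr S = o(n), the correction for degrees of freedom does not change the limit of the mean
  -- squared residual.
  have hdf : TendstoInMeasure P (fun (n : ℕ) ω => (1 - (hatMatrix D S n ω).trace / (n : ℝ))⁻¹) atTop
      (fun _ => (1 : ℝ)) := by
    have h := TendstoInMeasure.comp_continuousAt (g := fun t : ℝ => (1 - t)⁻¹)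
      (tendsto_trace_div (P := P) (D := D) hU)
      (ContinuousAt.inv₀ (by fun_prop) (by norm_num))
    simpa using h
  have hfin := TendstoInMeasure.mul_const_limit hdf hrss
  rw [one_mul] at hfin
  refine hfin.congr_left fun n => Eventually.of_forall fun ω => ?_
  rcases Nat.eq_zero_or_pos n with rfl | hn
  · simp [sigma2hat]
  · have hn' : (0 : ℝ) < n := by exact_mod_cast hn
    have h : (n : ℝ) - (hatMatrix D S n ω).trace =
        n * (1 - (hatMatrix D S n ω).trace / (n : ℝ)) := by
      field_simp
    rw [sigma2hat, h, mul_inv, nrm_sq]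
    simp only [Pi.sub_apply]
    ring

/-- The central limit theorem for the leading term. -/
lemma tendstoInDistribution_linear (hs : RandomSample P D) (h5 : CondA5 P D σ2)
    (hφm : Measurable φ) (hφ : MemLp φ 2 (D.law P)) :
    TendstoInDistribution (fun (n : ℕ) ω => (√(n : ℝ))⁻¹ * ∑ i : Fin n, φ (D.Z i ω) * D.ε i ω) atTop
      (id : ℝ → ℝ) (fun _ => P)
      (gaussianReal 0 (σ2 * ∫ ω, φ (D.Z 0 ω) ^ 2 ∂P).toNNReal) := by
  obtain ⟨hL, hmean, hsq⟩ := h5.memLp_mul hs hφm hφ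
  have hf : Measurable fun p : Paths p₁ p₂ × ℝ => φ p.1 * p.2 :=
    (hφm.comp measurable_fst).mul measurable_snd
  have hvar : Var[fun ω => φ (D.Z 0 ω) * D.ε 0 ω; P] = σ2 * ∫ ω, φ (D.Z 0 ω) ^ 2 ∂P := by
    rw [variance_of_integral_eq_zero hL.aemeasurable hmean, hsq]
  have h := tendstoInDistribution_inv_sqrt_mul_sum_sub (P := P)
    (X := fun i ω => φ (D.Z i ω) * D.ε i ω) (Y := (id : ℝ → ℝ))
    (P' := gaussianReal 0 (σ2 * ∫ ω, φ (D.Z 0 ω) ^ 2 ∂P).toNNReal)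
    ⟨aemeasurable_id, by rw [Measure.map_id, hvar]⟩ hL
    (hs.indep.comp (fun _ p => φ p.1 * p.2) fun _ => hf)
    fun i => (hs.identDistrib i).comp hf
  convert! h using 4 with n ω
  rw [hmean, mul_zero, sub_zero, Finset.sum_range]

/-- Asymptotic normality of the estimated functional. -/
lemma tendstoInDistribution_error (hs : RandomSample P D) (h1 : CondA1 D S s' ν) (hU : CondU S s' ν)
    (h3 : CondA3 P D S) (h5 : CondA5 P D σ2) (h7 : CondA7 P D S) (hφm : Measurable φ)
    (hφ : MemLp φ 2 (D.law P)) {W : ℝ} (hW0 : 0 ≤ W) (hW : ∀ n, nrm (S.w x n) ≤ W)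
    (hwt : TendstoInMeasure P (fun n ω =>
      nrm (weightOf S x n (D.Zvec n ω) - fun i : Fin n => φ (D.Z i ω)) / √(n : ℝ)) atTop
      (fun _ => (0 : ℝ))) :
    TendstoInDistribution (fun (n : ℕ) ω => √(n : ℝ) * (Psihat D S x n ω - Psi D x)) atTop
      (id : ℝ → ℝ) (fun _ => P)
      (gaussianReal 0 (σ2 * ∫ ω, φ (D.Z 0 ω) ^ 2 ∂P).toNNReal) := by
  refine tendstoInDistribution_of_tendstoInMeasure_sub _ _
    (tendstoInDistribution_linear hs h5 hφm hφ) ?_ fun n =>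
    (((measurable_Psihat hs (continuousOn_beta D S h1) x n).sub_const _).const_mul _).aemeasurable
  -- Two replacements, to be combined with Slutsky's lemma: the error by the weighted sum of the εᵢ,
  -- then the weights by φ(Zᵢ).
  have h := TendstoInMeasure.add_zero_limit (tendsto_error_sub_linear h1 hU h3 h7 hW0 hW)
    (h5.tendstoInMeasure_sum_mul hs (d := fun n i z => weightOf S x n z i - φ (z i))
      (fun n i => (measurable_weightOf S x n i).sub (hφm.comp (measurable_pi_apply i))) hwt)
  refine h.congr_left fun n => Eventually.of_forall fun ω => ?_
  simp only [Pi.sub_apply, sub_mul, Finset.sum_sub_distrib, dotProduct, Model.noise, Model.Zvec]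
  ring

end Limits


end FRidge

end

/-! ### Assembly of the theorem -/

open FRidge in
theorem mainTheorem4 {Ω : Type*} [MeasurableSpace Ω] (P : Measure Ω) [IsProbabilityMeasure P]
    {p₁ p₂ : ℕ} (D : Model Ω p₁ p₂) (S : Scheme) (s' : ℕ) (ν : ℝ≥0) (σ2 : ℝ)
    (γ : ℕ → ℝ) (v : HilbertBasis ℕ ℝ (L2p p₁ p₂))
    (hiid : RandomSample P D)
    (hA1 : CondA1 D S s' ν) (hA2 : CondA2 S s' ν) (hA3 : CondA3 P D S) (hA4 : CondA4 S)
    (hA5 : CondA5 P D σ2) (hA6 : CondA6 P D S γ v) (hA7 : CondA7 P D S)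
    (hU : CondU S s' ν)
    (x : L2p p₁ p₂) (hA9 : CondA9 P D S x)
    (hx : Summable fun k => (inner ℝ x (v k) : ℝ) ^ 2 / γ k) :
    TendstoInDistribution (fun (n : ℕ) ω => √(n : ℝ) * (Psihat D S x n ω - Psi D x)) atTop
        (id : ℝ → ℝ) (fun _ => P) (gaussianReal 0 (σ2 * invForm γ v x).toNNReal) ∧
      TendstoInMeasure P (Vhat D S x) atTop (fun _ => σ2 * invForm γ v x) ∧
      IsBigOInProb P (fun n ω => (hatMatrix D S n ω).trace)
        (fun n => ((p₁ + p₂ : ℕ) : ℝ) * (S.K n : ℝ)) ∧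
      TendstoInMeasure P (fun (n : ℕ) ω => (hatMatrix D S n ω).trace / (n : ℝ)) atTop
        (fun _ => 0) ∧
      (0 < σ2 →
        TendstoInMeasure P (fun n ω => Vhat D S x n ω / (σ2 * invForm γ v x)) atTop
          (fun _ => 1)) := by
  obtain ⟨B, hB0, hB⟩ := hA3.exists_bound
  obtain ⟨φ, hφm, hφ, hφr, hφsq, happ⟩ := exists_representer (hiid.measurable_Z 0)
    (by filter_upwards [hB] with ω hω using hω 0) hA6.pos hA6.eigen hx
  obtain ⟨C', hC'⟩ := hA6.coeffBound
  obtain ⟨C, hC0, hC⟩ : ∃ C : ℝ, 0 < C ∧ ∀ n, ∀ b : S.Idx p₁ p₂ n → ℝ,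
      ∫ ω, (∑ a, b a * exactCoord D S n 0 ω a) ^ 2 ∂P ≤ C * ∑ a, b a ^ 2 :=
    ⟨max C' 1, by positivity, fun n b => (hC' n b).trans
      (mul_le_mul_of_nonneg_right (le_max_left _ _) (Finset.sum_nonneg fun a _ => sq_nonneg _))⟩
  -- The representation of w by moments of φ(Z) bounds it uniformly in n for a basis that is not
  -- orthonormal, through the constant in (A6).
  have hw : ∀ n, nrm (S.w x n) ^ 2 ≤ C * invForm γ v x := fun n => by
    rw [← hφsq]
    exact nrm_moment_sq_le hiid hB hC0 (hC n) (memLp_comp_Z hiid hφm hφ 0) (w_eq_integral hφr)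
  have hwt := tendsto_nrm_weight_sub hiid hA3 hA7 hU (one_le_degree D S hA1 hU) hC0 hC hφm hφ hφr
    happ
  have hdist := tendstoInDistribution_error hiid hA1 hU hA3 hA5 hA7 hφm hφ (x := x)
    (Real.sqrt_nonneg (C * invForm γ v x)) (fun n => Real.le_sqrt_of_sq_le (hw n)) hwt
  have hvar := tendsto_wVw hiid hA7 hφm hφ hwt
  rw [hφsq] at hdist hvar
  have hVhat : TendstoInMeasure P (Vhat D S x) atTop (fun _ => σ2 * invForm γ v x) :=
    TendstoInMeasure.mul_const_limit (tendsto_sigma2hat hiid hA1 hU hA3 hA5 hA7 hC) hvar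
  refine ⟨hdist, hVhat, fun δ _ => ⟨1, Eventually.of_forall fun n => ?_⟩, tendsto_trace_div hU,
    fun hσ => ?_⟩
  · have : {ω | 1 * (((p₁ + p₂ : ℕ) : ℝ) * (S.K n : ℝ)) < |(hatMatrix D S n ω).trace|} = ∅ := by
      refine Set.eq_empty_of_forall_notMem fun ω hω => ?_
      rw [Set.mem_ofPred_eq, one_mul, abs_of_nonneg (trace_hatMatrix_nonneg n ω)] at hω
      exact absurd hω (not_lt.mpr (trace_hatMatrix_le n ω))
    rw [this]
    simp
  -- If the form vanished, the bound on w would give w = 0 for every n, hence wᵀVw = 0 at every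
  -- sample point, contrary to (A9).
  · have hV : invForm γ v x ≠ 0 := fun h0 => by
      obtain ⟨c, hc, h9⟩ := hA9 (1 / 2) (by norm_num)
      obtain ⟨n, hn⟩ := h9.exists
      have hw0 : S.w x n = 0 := by
        have := hw n
        rw [h0, mul_zero, nrm_sq] at this
        funext a
        have h1 := (Finset.sum_eq_zero_iff_of_nonneg fun a _ => sq_nonneg _).mp
          (this.antisymm (Finset.sum_nonneg fun a _ => sq_nonneg (S.w x n a))) a (Finset.mem_univ a)
        exact pow_eq_zero_iff two_ne_zero |>.mp h1
      have huniv : {ω | wVw D S x n ω < c} = Set.univ :=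
        Set.eq_univ_of_forall fun ω => by simp [wVw, hw0, hc]
      rw [huniv, measure_univ, ENNReal.one_le_ofReal] at hn
      norm_num at hn
    have h := TendstoInMeasure.mul_const_limit hVhat (tendstoInMeasure_of_tendsto
      (tendsto_const_nhds (x := (σ2 * invForm γ v x)⁻¹)))
    rw [mul_inv_cancel₀ (mul_ne_zero hσ.ne' hV)] at h
    exact h
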